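/- For $n\ge 0$ let $N=2^n$. For a permutation $\pi$ of $[N]$, the in-place oracle of $\pi$ is the unitary $\widetilde U_\pi$ on $\mathbb C^{2N}$ with $\widetilde U_\pi|x,z\rangle=|\pi^{z}(x),z\rangle$ for $x\in[N]$, $z\in\{1,-1\}$. For a nonempty set $F$ of permutations of $[N]$, the randomized in-place oracle presenting $F$ is the channel $\widetilde{\mathcal O}_F[\rho]=\frac1{|F|}\sum_{\pi\in F}\widetilde U_\pi\,\rho\,\widetilde U_\pi^\dagger$. For $V\subseteq[N]$ let $T_V$ be the set of all permutations $\pi$ of $[N]$ with $\pi(x)\in V\iff x\in V$ for all $x\in[N]$, and let $T_\varnothing$ be the set of all permutations of $[N]$. A query algorithm with $w$ workspace qubits consists of a density matrix $\rho_0$ on $\mathbb C^{2N}\otimes\mathbb C^{2^w}$, unitaries $U_1,\dots,U_T$ on this space, and a two-outcome POVM $\{E,I-E\}$ on it. When given an oracle $\mathcal O$, it makes $T$ queries and accepts (answers YES) with probability $$\mathrm{Tr}\big[E\,(\mathcal O\otimes I)\circ\mathcal U_T\circ\cdots\circ(\mathcal O\otimes I)\circ\mathcal U_1[\rho_0]\big],\qquad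 \mathcal U_i[\rho]=U_i\rho U_i^\dagger .$$ A verifier at size $n$ consists of a number $w(n)$ of workspace qubits, a witness length $m(n)$, and, for every classical witness $y\in\{0,1\}^{m(n)}$, a query algorithm with $w(n)$ workspace qubits; no uniformity or bound on the number of gates is imposed. Its query count $q(n)$ is the largest number of queries made over all witnesses $y$. The verifier decides HIDDEN-SUBSET for subsets of size $k$ with completeness $c$ and soundness $s$ if - for every $V\subseteq[N]$ with $|V|=k$ there is a witness $y$ with which it accepts with probability at least $c$ when given the oracle $\widetilde{\mathcal O}_{T_V}$ (YES instances), and - for every witness $y$ it accepts with probability at most $s$ when given the oracle $\widetilde{\mathcal O}_{T_\varnothing}$ (NO instance). **Theorem.** Let $0<\alpha<\frac12$. Consider any family of verifiers, one for each $n$, with $w(n)=O(\log n)$ workspace qubits, witness length $m(n)=n^{O(1)}$ and query count $q(n)=n^{O(1)}$. Let $c,s:\mathbb N\to\mathbb R$ be such that for some $d\in\mathbb N$ we have $c(n)-s(n)\ge n^{-d}$ for all sufficiently large $n$. Then for all sufficiently large $n$ and every integer $k\ge 0$ with $|k-N^\alpha|<1$ (that is, $k=N^\alpha$ if this is an integer,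 and either rounding of $N^\alpha$ otherwise), the verifier at size $n$ does not decide HIDDEN-SUBSET for subsets of size $k$ with completeness $c(n)$ and soundness $s(n)$. In particular, no polynomial-time quantum verifier whose oracle queries are entangled with at most $O(\log n)$ additional qubits decides the problem, even with a polynomial-length classical witness. -/

import Mathlib

open Filter Asymptotics
open scoped Kronecker ComplexOrder Matrix

noncomputable section

namespace HiddenSubset

/-- Basis labels `(x, z)` of the oracle register `ℂ^{2N}`, where `N = 2 ^ n`, `x ∈ [N]`, and the
sign `z ∈ {1, -1}` selects whether a permutation or its inverse is applied. -/
abbrev OracleIdx (n : ℕ) : Type := Fin (2 ^ n) × ℤˣ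

/-- Basis labels of the whole state space `H_O ⊗ H_W`: the oracle register together with a
workspace of `w` additional qubits. -/
abbrev StateIdx (n w : ℕ) : Type := OracleIdx n × Fin (2 ^ w)

/-- The in-place oracle of a permutation: the unitary `|x, z⟩ ↦ |π ^ z (x), z⟩`. -/
def inPlace {n : ℕ} (π : Equiv.Perm (Fin (2 ^ n))) : Matrix (OracleIdx n) (OracleIdx n) ℂ :=
  Matrix.of fun p q => if p = ((π ^ (q.2 : ℤ)) q.1, q.2) then 1 else 0

/-- The randomized in-place oracle presenting the set `F` of permutations, acting on the oracle
register of a (possibly entangled) state of oracle register and workspace: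
`ρ ↦ |F|⁻¹ ∑_{π ∈ F} (U_π ⊗ I) ρ (U_π ⊗ I)†`. -/
def randomizedOracle {n : ℕ} (F : Finset (Equiv.Perm (Fin (2 ^ n)))) {w : ℕ}
    (ρ : Matrix (StateIdx n w) (StateIdx n w) ℂ) : Matrix (StateIdx n w) (StateIdx n w) ℂ :=
  (F.card : ℂ)⁻¹ • ∑ π ∈ F,
    (inPlace π ⊗ₖ (1 : Matrix (Fin (2 ^ w)) (Fin (2 ^ w)) ℂ)) * ρ *
      (inPlace π ⊗ₖ (1 : Matrix (Fin (2 ^ w)) (Fin (2 ^ w)) ℂ))ᴴ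

/-- The set `T_V` of all permutations of `[N]` that stabilize the subset `V`. -/
def stabilizing {n : ℕ} (V : Finset (Fin (2 ^ n))) : Finset (Equiv.Perm (Fin (2 ^ n))) :=
  Finset.univ.filter fun π => ∀ x, π x ∈ V ↔ x ∈ V

/-- A query algorithm on the oracle register and `w` workspace qubits: an initial density matrix,
a list `U₁, …, U_k` of unitaries, each of which is followed by one oracle query, and a final
two-outcome measurement `{E, I - E}`, whose outcome `E` means that the algorithm answers YES. -/
structure QueryAlgorithm (n w : ℕ) where
  init : Matrix (StateIdx n w) (StateIdx n w) ℂ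
  init_posSemidef : init.PosSemidef
  init_trace : init.trace = 1
  unitaries : List (Matrix.unitaryGroup (StateIdx n w) ℂ)
  accept : Matrix (StateIdx n w) (StateIdx n w) ℂ
  accept_posSemidef : accept.PosSemidef
  accept_compl_posSemidef : (1 - accept).PosSemidef

/-- The final state `O ∘ U_k ∘ ⋯ ∘ O ∘ U₁ [ρ₀]` for the randomized in-place oracle `O` that
presents `F`. -/
def QueryAlgorithm.finalState {n w : ℕ} (Q : QueryAlgorithm n w)
    (F : Finset (Equiv.Perm (Fin (2 ^ n)))) : Matrix (StateIdx n w) (StateIdx n w) ℂ :=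
  Q.unitaries.foldl
    (fun ρ U => randomizedOracle F
      ((U : Matrix (StateIdx n w) (StateIdx n w) ℂ) * ρ *
        (U : Matrix (StateIdx n w) (StateIdx n w) ℂ)ᴴ))
    Q.init

/-- The probability that the algorithm answers YES when the oracle presents `F`. -/
def QueryAlgorithm.acceptProb {n w : ℕ} (Q : QueryAlgorithm n w)
    (F : Finset (Equiv.Perm (Fin (2 ^ n)))) : ℝ :=
  (Q.accept * Q.finalState F).trace.re

/-- A verifier at input size `n`: every classical witness (a bit string of length
`witnessLength`) determines the query algorithm that the verifier runs on the oracle register and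
`workspace` additional qubits. No uniformity or gate count is imposed. -/
structure Verifier (n : ℕ) where
  workspace : ℕ
  witnessLength : ℕ
  algorithm : (Fin witnessLength → Bool) → QueryAlgorithm n workspace

/-- The number of oracle queries that the verifier makes in the worst case over all witnesses. -/
def Verifier.queryCount {n : ℕ} (A : Verifier n) : ℕ :=
  Finset.univ.sup fun y => (A.algorithm y).unitaries.length

/-- The verifier decides the hidden-subset problem for randomized in-place oracles, for subsets of
size `k`, with the given completeness and soundness: every YES instance `T_V` with `|V| = k` has a
witness on which it answers YES with probability at least `completeness`, and on the NO instance
(all permutations) it answers YES with probability at most `soundness` whatever the witness. -/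
def Verifier.Decides {n : ℕ} (A : Verifier n) (k : ℕ) (completeness soundness : ℝ) : Prop :=
  (∀ V : Finset (Fin (2 ^ n)), V.card = k →
    ∃ y, completeness ≤ (A.algorithm y).acceptProb (stabilizing V)) ∧
  (∀ y, (A.algorithm y).acceptProb Finset.univ ≤ soundness)

end HiddenSubset

end

/-! Let p be the normalized uniform vector on [N] and u = `devVec V` the unit vector orthogonal to p
that is constant on V and on its complement. Averaging over T_V differs from averaging over all
permutations essentially because T_V also fixes u. It therefore suffices to find a V for which no
run of the verifier, with any witness, puts noticeable weight on u or measures correlations with V.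

Averages. A query averages over permutations only through the joint law of (π a, π c), which is
uniform on an orbit of T_V on pairs; `pairProb_eq_pairFormula` writes this law with projections.
Split the state space by sign and workspace label into L = 2·2^w blocks of dimension N. A block X of
an observable averages to P X P, with P = pp† + uu†, plus a correction on the mean-zero vectors of
each class S. For equal signs the correction is a multiple of the mean-zero projection, with
coefficient close to the mean diagonal entry of X on S; for opposite signs it is a transposed block
damped by 1/(|S| - 1). Hence (`norm_blockAvg_sub_le`) the averages for V and for all permutations
differ only through the discrepancy of diagonal means, ⟨u, X p⟩, ⟨p, X u⟩, 1/(|V| - 1), and the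
overlap of the state with u.

Hybrid argument. Queries are replaced one at a time, with states run forward under T_V and
observables run backward under all permutations (`norm_trace_foldl_sub_le`). The observables, gates
and initial state then do not depend on V. A T_V query preserves the weight along u, and the
following gate adds little to it, because outside u the query leaves a nearly mixed or uniform state
(`devProb_step_le`). The weight thus grows only quadratically with the number of queries.

Choice of V. The conditions on V involve 2^m · poly(n) · 2^n functions fixed in advance, covering
all witnesses at once. An exponential moment bound for random k-subsets and a union bound
(`exists_uncorrelated_subset`) give a V whose correlations with all of them are at most η = 4τ/√k,
once e^τ exceeds a constant times the number of functions. With τ = N^(α/4) and k about τ^4, this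
holds eventually and η ≤ 8/τ is exponentially small. The condition α < 1/2 ensures 2k² ≤ N, which
makes N^k / k! comparable to the binomial coefficient. For this V every witness has acceptance gap
at most 58 η L³ (T+1)³, where T bounds the query count. A workspace of O(log n) qubits makes L
polynomial, so the gap is eventually below n^(-d). -/

noncomputable section
namespace HiddenSubset

/-! ### Euclidean norms and contractions -/

section Vectors

variable {ι κ : Type*} [Fintype ι] [Fintype κ]

/-- The Euclidean norm of a vector of complex numbers. -/
def l2 (f : ι → ℂ) : ℝ := ‖(WithLp.toLp 2 f : EuclideanSpace ℂ ι)‖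

lemma l2_nonneg (f : ι → ℂ) : 0 ≤ l2 f := norm_nonneg _

lemma l2_sq (f : ι → ℂ) : l2 f ^ 2 = ∑ a, ‖f a‖ ^ 2 := by
  simp [l2, EuclideanSpace.norm_sq_eq]

lemma l2_sq_eq_dotProduct (f : ι → ℂ) : ((l2 f ^ 2 : ℝ) : ℂ) = star f ⬝ᵥ f := by
  rw [l2_sq]
  simp [dotProduct, Complex.conj_mul']

lemma norm_dotProduct_le (f g : ι → ℂ) : ‖star f ⬝ᵥ g‖ ≤ l2 f * l2 g := by
  have := norm_inner_le_norm (𝕜 := ℂ) (WithLp.toLp 2 f : EuclideanSpace ℂ ι) (WithLp.toLp 2 g)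
  rwa [EuclideanSpace.inner_eq_star_dotProduct, dotProduct_comm] at this

lemma l2_sub_le (f g : ι → ℂ) : l2 (f - g) ≤ l2 f + l2 g := by
  simpa [l2, WithLp.toLp_sub] using norm_sub_le (WithLp.toLp 2 f : EuclideanSpace ℂ ι) (WithLp.toLp 2 g)

lemma l2_smul (c : ℂ) (f : ι → ℂ) : l2 (c • f) = ‖c‖ * l2 f := by
  simp [l2, WithLp.toLp_smul, norm_smul]

lemma l2_star (f : ι → ℂ) : l2 (star f) = l2 f := by
  rw [← sq_eq_sq₀ (l2_nonneg _) (l2_nonneg _), l2_sq, l2_sq]; simp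

lemma l2_comp_equiv (f : ι → ℂ) (σ : Equiv.Perm ι) : l2 (f ∘ σ) = l2 f := by
  rw [← sq_eq_sq₀ (l2_nonneg _) (l2_nonneg _), l2_sq, l2_sq]
  exact Equiv.sum_comp σ fun a => ‖f a‖ ^ 2

lemma l2_le_of_norm_le {f g : ι → ℂ} (h : ∀ a, ‖f a‖ ≤ ‖g a‖) : l2 f ≤ l2 g := by
  rw [← sq_le_sq₀ (l2_nonneg _) (l2_nonneg _), l2_sq, l2_sq]
  exact Finset.sum_le_sum fun a _ => by gcongr; exact h a

lemma l2_eq_zero {f : ι → ℂ} (h : l2 f = 0) : f = 0 := by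
  have := norm_eq_zero.mp h
  simpa using this

/-- A matrix whose sesquilinear form is bounded by the product of the Euclidean norms. -/
def Contraction (A : Matrix ι κ ℂ) : Prop :=
  ∀ f g, ‖star f ⬝ᵥ A *ᵥ g‖ ≤ l2 f * l2 g

lemma Contraction.l2_mulVec_le {A : Matrix ι κ ℂ} (hA : Contraction A) (g : κ → ℂ) :
    l2 (A *ᵥ g) ≤ l2 g := by
  have h := hA (A *ᵥ g) g
  rw [← l2_sq_eq_dotProduct, Complex.norm_real, Real.norm_of_nonneg (sq_nonneg _), sq] at h
  rcases (l2_nonneg (A *ᵥ g)).eq_or_lt with h0 | h0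
  · rw [← h0]; exact l2_nonneg g
  · exact le_of_mul_le_mul_left h h0

lemma contraction_of_l2_mulVec_le {A : Matrix ι κ ℂ} (hA : ∀ g, l2 (A *ᵥ g) ≤ l2 g) :
    Contraction A := fun f g =>
  (norm_dotProduct_le f _).trans (mul_le_mul_of_nonneg_left (hA g) (l2_nonneg f))

lemma star_dotProduct_mulVec (A : Matrix ι κ ℂ) (f : ι → ℂ) (g : κ → ℂ) :
    star f ⬝ᵥ A *ᵥ g = star (star g ⬝ᵥ Aᴴ *ᵥ f) := by
  rw [Matrix.star_dotProduct]
  congr 1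
  rw [Matrix.star_mulVec, ← Matrix.dotProduct_mulVec]

lemma Contraction.conjTranspose {A : Matrix ι κ ℂ} (hA : Contraction A) : Contraction Aᴴ := by
  intro f g
  rw [star_dotProduct_mulVec, Matrix.conjTranspose_conjTranspose, norm_star, mul_comm]
  exact hA g f

lemma Contraction.norm_apply_le [DecidableEq ι] [DecidableEq κ] {A : Matrix ι κ ℂ}
    (hA : Contraction A) (i : ι) (j : κ) : ‖A i j‖ ≤ 1 := by
  have h1 : l2 (Pi.single i (1 : ℂ)) = 1 := by
    simp [l2]
  have h2 : l2 (Pi.single j (1 : ℂ)) = 1 := by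
    simp [l2]
  have := hA (Pi.single i 1) (Pi.single j 1)
  rw [h1, h2] at this
  simpa [← Pi.single_star] using this

variable [DecidableEq ι]

lemma l2_mulVec_unitary (U : Matrix.unitaryGroup ι ℂ) (g : ι → ℂ) :
    l2 ((U : Matrix ι ι ℂ) *ᵥ g) = l2 g := by
  rw [← sq_eq_sq₀ (l2_nonneg _) (l2_nonneg _), ← Complex.ofReal_inj, l2_sq_eq_dotProduct,
    l2_sq_eq_dotProduct, Matrix.star_mulVec, ← Matrix.dotProduct_mulVec, Matrix.mulVec_mulVec]
  have : (U : Matrix ι ι ℂ)ᴴ * U = 1 := Matrix.mem_unitaryGroup_iff'.mp U.2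
  rw [this, Matrix.one_mulVec]

lemma contraction_of_posSemidef {E : Matrix ι ι ℂ} (h0 : E.PosSemidef) (h1 : (1 - E).PosSemidef) :
    Contraction E := by
  -- `‖E g‖² ≤ ‖g‖²` since `E = E (1 - E) E + (1 - E) E (1 - E) + E²`
  apply contraction_of_l2_mulVec_le
  intro g
  have hE : Eᴴ = E := h0.1
  have e1 : (E * (1 - E) * E).PosSemidef := by
    simpa [hE] using h1.conjTranspose_mul_mul_same E
  have e2 : ((1 - E) * E * (1 - E)).PosSemidef := by
    have := h0.conjTranspose_mul_mul_same (1 - E)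
    simpa [hE] using this
  have e3 : (1 - E * E).PosSemidef := by
    have : 1 - E * E = (1 - E) + (E * (1 - E) * E + (1 - E) * E * (1 - E)) := by noncomm_ring
    rw [this]
    exact h1.add (e1.add e2)
  have h := e3.re_dotProduct_nonneg g
  rw [Matrix.sub_mulVec, Matrix.one_mulVec, dotProduct_sub, ← Matrix.mulVec_mulVec,
    Matrix.dotProduct_mulVec (star g)] at h
  have h2 : star g ᵥ* E = star (E *ᵥ g) := by rw [Matrix.star_mulVec, hE]
  rw [h2, ← l2_sq_eq_dotProduct, ← l2_sq_eq_dotProduct, ← Complex.ofReal_sub] at h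
  have h3 : 0 ≤ l2 g ^ 2 - l2 (E *ᵥ g) ^ 2 := h
  exact (sq_le_sq₀ (l2_nonneg _) (l2_nonneg _)).mp (by linarith)

end Vectors

/-! ### The law of two values of a random permutation in T_V -/

section Stabilizing

variable {n : ℕ}

lemma mem_stabilizing {V : Finset (Fin (2 ^ n))} {π : Equiv.Perm (Fin (2 ^ n))} :
    π ∈ stabilizing V ↔ ∀ x, π x ∈ V ↔ x ∈ V := by simp [stabilizing]

lemma stabilizing_univ : stabilizing (Finset.univ : Finset (Fin (2 ^ n))) = Finset.univ := by
  ext π; simp [mem_stabilizing]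

lemma stabilizing_compl (V : Finset (Fin (2 ^ n))) : stabilizing Vᶜ = stabilizing V := by
  ext π; simp [mem_stabilizing, not_iff_not]

lemma one_mem_stabilizing (V : Finset (Fin (2 ^ n))) : 1 ∈ stabilizing V := by
  simp [mem_stabilizing]

lemma mul_mem_stabilizing {V : Finset (Fin (2 ^ n))} {σ τ : Equiv.Perm (Fin (2 ^ n))}
    (hσ : σ ∈ stabilizing V) (hτ : τ ∈ stabilizing V) : σ * τ ∈ stabilizing V := by
  rw [mem_stabilizing] at *
  intro x
  rw [Equiv.Perm.mul_apply, hσ, hτ]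

lemma inv_mem_stabilizing {V : Finset (Fin (2 ^ n))} {σ : Equiv.Perm (Fin (2 ^ n))}
    (hσ : σ ∈ stabilizing V) : σ⁻¹ ∈ stabilizing V := by
  rw [mem_stabilizing] at *
  intro x
  rw [← hσ]
  simp

lemma swap_mem_stabilizing {V : Finset (Fin (2 ^ n))} {a b : Fin (2 ^ n)} (h : a ∈ V ↔ b ∈ V) :
    Equiv.swap a b ∈ stabilizing V := by
  rw [mem_stabilizing]
  intro x
  rcases eq_or_ne x a with rfl | ha
  · simp [h]
  · rcases eq_or_ne x b with rfl | hb
    · simp [h]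
    · rw [Equiv.swap_apply_of_ne_of_ne ha hb]

/-- T_V acts transitively on pairs with prescribed classes and equality pattern: one swap brings the
first point into place, and a second swap, which does not touch it, corrects the other. -/
lemma exists_stabilizing_map_pair {V : Finset (Fin (2 ^ n))} {b d b' d' : Fin (2 ^ n)}
    (hb : b ∈ V ↔ b' ∈ V) (hd : d ∈ V ↔ d' ∈ V) (hne : b = d ↔ b' = d') :
    ∃ τ ∈ stabilizing V, τ b = b' ∧ τ d = d' := by
  have h1 := swap_mem_stabilizing hb
  by_cases h : b = d
  · subst h
    obtain rfl := hne.mp rfl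
    exact ⟨_, h1, by simp, by simp⟩
  · have h' : b' ≠ d' := fun e => h (hne.mpr e)
    have h2 : Equiv.swap b b' d ∈ V ↔ d' ∈ V := by rw [mem_stabilizing.mp h1, hd]
    refine ⟨_, mul_mem_stabilizing (swap_mem_stabilizing h2) h1, ?_, by simp⟩
    rw [Equiv.Perm.mul_apply, Equiv.swap_apply_left]
    apply Equiv.swap_apply_of_ne_of_ne _ h'
    intro e
    apply h
    apply (Equiv.swap b b').injective
    rw [← e, Equiv.swap_apply_left]

/-- The number of permutations stabilizing `V` that send `a` to `b` and `c` to `d`. -/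
def pairCount (V : Finset (Fin (2 ^ n))) (a c b d : Fin (2 ^ n)) : ℕ :=
  ((stabilizing V).filter fun π => π a = b ∧ π c = d).card

lemma pairCount_map {V : Finset (Fin (2 ^ n))} {τ : Equiv.Perm (Fin (2 ^ n))}
    (hτ : τ ∈ stabilizing V) (a c b d : Fin (2 ^ n)) :
    pairCount V a c (τ b) (τ d) = pairCount V a c b d := by
  symm
  refine Finset.card_bij (fun π _ => τ * π) ?_ ?_ ?_
  · intro π hπ
    rw [Finset.mem_filter] at hπ ⊢
    exact ⟨mul_mem_stabilizing hτ hπ.1, by simp [hπ.2.1], by simp [hπ.2.2]⟩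
  · intro π _ π' _ h
    exact mul_left_cancel h
  · intro π hπ
    rw [Finset.mem_filter] at hπ
    refine ⟨τ⁻¹ * π, ?_, by simp⟩
    rw [Finset.mem_filter]
    exact ⟨mul_mem_stabilizing (inv_mem_stabilizing hτ) hπ.1, by simp [hπ.2.1], by simp [hπ.2.2]⟩

/-- Left multiplication by T_V makes the count constant on the orbit O, and the counts over O add up
to the size of T_V. -/
lemma pairCount_mul_card {V : Finset (Fin (2 ^ n))} {a c : Fin (2 ^ n)}
    (O : Finset (Fin (2 ^ n) × Fin (2 ^ n)))
    (hO : ∀ π ∈ stabilizing V, (π a, π c) ∈ O)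
    (htrans : ∀ p ∈ O, ∀ p' ∈ O, ∃ τ ∈ stabilizing V, τ p.1 = p'.1 ∧ τ p.2 = p'.2)
    (b d : Fin (2 ^ n)) :
    pairCount V a c b d * O.card = if (b, d) ∈ O then (stabilizing V).card else 0 := by
  split_ifs with h
  · rw [Finset.card_eq_sum_card_fiberwise (f := fun π => (π a, π c)) (t := O) (fun π hπ => hO π hπ),
      mul_comm, ← smul_eq_mul, ← Finset.sum_const]
    refine Finset.sum_congr rfl fun p hp => ?_
    obtain ⟨τ, hτ, e1, e2⟩ := htrans (b, d) h p hp
    rw [← pairCount_map hτ, e1, e2, pairCount]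
    simp [Prod.ext_iff]
  · rw [mul_eq_zero]
    left
    rw [pairCount, Finset.card_eq_zero, Finset.filter_eq_empty_iff]
    rintro π hπ ⟨rfl, rfl⟩
    exact h (hO π hπ)

/-- The probability that a random permutation stabilizing `V` sends `a` to `b` and `c` to `d`. -/
def pairProb (V : Finset (Fin (2 ^ n))) (a c b d : Fin (2 ^ n)) : ℂ :=
  ((stabilizing V).card : ℂ)⁻¹ * pairCount V a c b d

lemma stabilizing_card_ne_zero (V : Finset (Fin (2 ^ n))) : ((stabilizing V).card : ℂ) ≠ 0 := by
  rw [Nat.cast_ne_zero]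
  exact Finset.card_ne_zero_of_mem (one_mem_stabilizing V)

lemma pairProb_eq {V : Finset (Fin (2 ^ n))} {a c : Fin (2 ^ n)}
    (O : Finset (Fin (2 ^ n) × Fin (2 ^ n)))
    (hO : ∀ π ∈ stabilizing V, (π a, π c) ∈ O)
    (htrans : ∀ p ∈ O, ∀ p' ∈ O, ∃ τ ∈ stabilizing V, τ p.1 = p'.1 ∧ τ p.2 = p'.2)
    (b d : Fin (2 ^ n)) :
    pairProb V a c b d = if (b, d) ∈ O then (O.card : ℂ)⁻¹ else 0 := by
  have h := congrArg (Nat.cast (R := ℂ)) (pairCount_mul_card O hO htrans b d)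
  have h1 := stabilizing_card_ne_zero V
  have h2 : (O.card : ℂ) ≠ 0 := by
    rw [Nat.cast_ne_zero]
    exact Finset.card_ne_zero_of_mem (hO 1 (one_mem_stabilizing V))
  rw [pairProb]
  split_ifs at h ⊢ with hm
  · push_cast at h
    field_simp
    exact h
  · push_cast at h
    simp only [mul_eq_zero, h2, or_false] at h
    rw [h, mul_zero]

/-- The averaging projection onto the multiples of the indicator vector of `S`. -/
def avgProj {ι : Type*} [DecidableEq ι] (S : Finset ι) : Matrix ι ι ℂ :=
  Matrix.of fun a b => if a ∈ S ∧ b ∈ S then (S.card : ℂ)⁻¹ else 0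

/-- The projection onto the vectors supported on `S` with vanishing sum. -/
def meanZeroProj {ι : Type*} [DecidableEq ι] (S : Finset ι) : Matrix ι ι ℂ :=
  Matrix.of fun a b => (if a = b ∧ a ∈ S then 1 else 0) - avgProj S a b

/-- The value of `pairProb` in terms of projections. -/
def pairFormula {ι : Type*} [Fintype ι] [DecidableEq ι] (V : Finset ι) (a c b d : ι) : ℂ :=
  (avgProj V + avgProj Vᶜ) a b * (avgProj V + avgProj Vᶜ) c d +
    (((V.card : ℂ) - 1)⁻¹ * (meanZeroProj V a c * meanZeroProj V b d) +
      ((Vᶜ.card : ℂ) - 1)⁻¹ * (meanZeroProj Vᶜ a c * meanZeroProj Vᶜ b d))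

lemma pairFormula_compl {ι : Type*} [Fintype ι] [DecidableEq ι] (V : Finset ι) (a c b d : ι) :
    pairFormula Vᶜ a c b d = pairFormula V a c b d := by
  simp only [pairFormula, compl_compl, Matrix.add_apply]
  ring

lemma pairProb_compl (V : Finset (Fin (2 ^ n))) (a c b d : Fin (2 ^ n)) :
    pairProb Vᶜ a c b d = pairProb V a c b d := by
  simp only [pairProb, pairCount, stabilizing_compl]

/-- The pair (a, c) lies in one of three orbits: the diagonal of V, its off-diagonal, or V × Vᶜ. In
each the uniform probability is compared with the formula. -/
lemma pairProb_eq_pairFormula_of_mem {V : Finset (Fin (2 ^ n))} (hV : V.card ≠ 1)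
    {a : Fin (2 ^ n)} (ha : a ∈ V) (c b d : Fin (2 ^ n)) :
    pairProb V a c b d = pairFormula V a c b d := by
  have hV0 : (V.card : ℂ) ≠ 0 := by
    rw [Nat.cast_ne_zero]; exact Finset.card_ne_zero_of_mem ha
  have hV1 : (V.card : ℂ) - 1 ≠ 0 := by
    rw [sub_ne_zero]; exact_mod_cast hV
  by_cases hc : c ∈ V
  · by_cases hac : a = c
    · subst hac
      rw [pairProb_eq V.diag]
      · by_cases hb : b ∈ V <;> by_cases hd : d ∈ V <;> by_cases hbd : b = d <;>
          simp [pairFormula, avgProj, meanZeroProj, ha, hb, hd, hbd] <;> field_simp <;> ring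
      · intro π hπ
        simp [mem_stabilizing.mp hπ, ha]
      · rintro ⟨x, y⟩ hp ⟨x', y'⟩ hp'
        simp only [Finset.mem_diag] at hp hp'
        obtain ⟨hx, rfl⟩ := hp
        obtain ⟨hx', rfl⟩ := hp'
        exact exists_stabilizing_map_pair (by simp [hx, hx']) (by simp [hx, hx']) (by simp)
    · rw [pairProb_eq V.offDiag]
      · have hcard : ((V.offDiag.card : ℕ) : ℂ) = V.card * (V.card - 1) := by
          rw [Finset.offDiag_card, Nat.cast_sub (Nat.le_mul_self _)]
          push_cast; ring
        rw [hcard]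
        by_cases hb : b ∈ V <;> by_cases hd : d ∈ V <;> by_cases hbd : b = d <;>
          simp [pairFormula, avgProj, meanZeroProj, ha, hc, hac, hb, hd, hbd] <;> field_simp <;> ring
      · intro π hπ
        simp [mem_stabilizing.mp hπ, ha, hc, hac]
      · rintro ⟨x, y⟩ hp ⟨x', y'⟩ hp'
        simp only [Finset.mem_offDiag] at hp hp'
        exact exists_stabilizing_map_pair (by simp [hp, hp']) (by simp [hp, hp'])
          (by simp [hp.2.2, hp'.2.2])
  · have hac : a ≠ c := fun h => hc (h ▸ ha)
    rw [pairProb_eq (V ×ˢ Vᶜ)]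
    · by_cases hb : b ∈ V <;> by_cases hd : d ∈ V <;>
        simp [pairFormula, avgProj, meanZeroProj, ha, hc, hac, hb, hd, mul_comm]
    · intro π hπ
      simp [mem_stabilizing.mp hπ, ha, hc]
    · rintro ⟨x, y⟩ hp ⟨x', y'⟩ hp'
      simp only [Finset.mem_product, Finset.mem_compl] at hp hp'
      have h1 : x ≠ y := fun h => hp.2 (h ▸ hp.1)
      have h2 : x' ≠ y' := fun h => hp'.2 (h ▸ hp'.1)
      exact exists_stabilizing_map_pair (by simp [hp, hp']) (by simp [hp, hp']) (by simp [h1, h2])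

/-- Only singleton classes are excluded, because of the factor 1/(|S| - 1). An empty class
contributes zero, so V = univ is allowed and covers the NO instance. -/
lemma pairProb_eq_pairFormula {V : Finset (Fin (2 ^ n))} (hV : V.card ≠ 1) (hV' : Vᶜ.card ≠ 1)
    (a c b d : Fin (2 ^ n)) : pairProb V a c b d = pairFormula V a c b d := by
  by_cases ha : a ∈ V
  · exact pairProb_eq_pairFormula_of_mem hV ha c b d
  · rw [← pairProb_compl, ← pairFormula_compl]
    exact pairProb_eq_pairFormula_of_mem hV' (by simpa using ha) c b d

end Stabilizing

/-! ### Averaging and mean-zero projections -/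

section Projections

variable {ι : Type*} [DecidableEq ι]

/-- The normalized indicator vector of `S`. -/
def unitInd (S : Finset ι) : ι → ℂ := fun a => if a ∈ S then (((√(S.card : ℝ))⁻¹ : ℝ) : ℂ) else 0

lemma star_unitInd (S : Finset ι) : star (unitInd S) = unitInd S := by
  ext a
  by_cases h : a ∈ S <;> simp [unitInd, h]

lemma avgProj_eq (S : Finset ι) : avgProj S = Matrix.vecMulVec (unitInd S) (unitInd S) := by
  ext a b
  have h : (S.card : ℂ) = ((√(S.card : ℝ) * √(S.card : ℝ) : ℝ) : ℂ) := by
    rw [Real.mul_self_sqrt (Nat.cast_nonneg _)]; simp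
  by_cases ha : a ∈ S <;> by_cases hb : b ∈ S <;>
    simp [avgProj, unitInd, Matrix.vecMulVec_apply, ha, hb]
  rw [h]; push_cast; rw [mul_inv]

lemma star_avgProj_apply (S : Finset ι) (a b : ι) : star (avgProj S a b) = avgProj S a b := by
  by_cases ha : a ∈ S <;> by_cases hb : b ∈ S <;> simp [avgProj, ha, hb]

variable [Fintype ι]

lemma l2_unitInd_le (S : Finset ι) : l2 (unitInd S) ≤ 1 := by
  rw [← sq_le_sq₀ (l2_nonneg _) zero_le_one, l2_sq]
  have : ∀ a, ‖unitInd S a‖ ^ 2 = if a ∈ S then (S.card : ℝ)⁻¹ else 0 := by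
    intro a
    by_cases h : a ∈ S
    · simp only [unitInd, h, if_true, Complex.norm_real, Real.norm_eq_abs, sq_abs, inv_pow]
      rw [Real.sq_sqrt (Nat.cast_nonneg _)]
    · simp [unitInd, h]
  simp only [this, Finset.sum_ite_mem, Finset.univ_inter, Finset.sum_const, nsmul_eq_mul, one_pow]
  exact mul_inv_le_one

lemma avgProj_mulVec (S : Finset ι) (f : ι → ℂ) :
    avgProj S *ᵥ f = (unitInd S ⬝ᵥ f) • unitInd S := by
  rw [avgProj_eq, Matrix.vecMulVec_mulVec]
  simp

lemma norm_unitInd_dotProduct_le (S : Finset ι) (f : ι → ℂ) : ‖unitInd S ⬝ᵥ f‖ ≤ l2 f := by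
  have := norm_dotProduct_le (unitInd S) f
  rw [star_unitInd] at this
  exact this.trans (mul_le_of_le_one_left (l2_nonneg _) (l2_unitInd_le S))

/-- The projection is restriction to S minus averaging over S, and each of these does not increase
the norm; the crude factor 2 is enough. -/
lemma l2_meanZeroProj_mulVec_le (S : Finset ι) (f : ι → ℂ) :
    l2 (meanZeroProj S *ᵥ f) ≤ 2 * l2 f := by
  have e : meanZeroProj S *ᵥ f = (fun a => if a ∈ S then f a else 0) - avgProj S *ᵥ f := by
    ext a
    simp only [Matrix.mulVec, dotProduct, meanZeroProj, Matrix.of_apply, sub_mul,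
      Finset.sum_sub_distrib, Pi.sub_apply]
    congr 1
    by_cases h : a ∈ S <;> simp [h]
  have h1 : l2 (fun a => if a ∈ S then f a else 0) ≤ l2 f :=
    l2_le_of_norm_le fun a => by by_cases h : a ∈ S <;> simp [h]
  have h2 : l2 (avgProj S *ᵥ f) ≤ l2 f := by
    rw [avgProj_mulVec, l2_smul]
    calc _ ≤ l2 f * 1 := mul_le_mul (norm_unitInd_dotProduct_le S f) (l2_unitInd_le S)
          (l2_nonneg _) (l2_nonneg _)
      _ = l2 f := mul_one _
  rw [e]
  exact (l2_sub_le _ _).trans (by linarith)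

lemma norm_meanZeroProj_form_le (S : Finset ι) (f g : ι → ℂ) :
    ‖star f ⬝ᵥ meanZeroProj S *ᵥ g‖ ≤ 2 * (l2 f * l2 g) := by
  refine (norm_dotProduct_le _ _).trans ?_
  have := mul_le_mul_of_nonneg_left (l2_meanZeroProj_mulVec_le S g) (l2_nonneg f)
  linarith

/-- The coefficient of `meanZeroProj S` in the average of the conjugates of `X`. -/
def meanZeroCoeff (S : Finset ι) (X : Matrix ι ι ℂ) : ℂ :=
  ((S.card : ℂ) - 1)⁻¹ * ∑ a, ∑ c, X a c * meanZeroProj S a c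

/-- The mean-zero projection is the restriction to S minus the rank-one projection onto `unitInd S`;
pairing X with the two parts gives a partial trace and a form. -/
lemma sum_mul_meanZeroProj (S : Finset ι) (X : Matrix ι ι ℂ) :
    ∑ a, ∑ c, X a c * meanZeroProj S a c =
      ∑ a ∈ S, X a a - star (unitInd S) ⬝ᵥ X *ᵥ unitInd S := by
  rw [star_unitInd]
  simp only [meanZeroProj, Matrix.of_apply, mul_sub, Finset.sum_sub_distrib, avgProj_eq,
    Matrix.vecMulVec_apply, dotProduct, Matrix.mulVec, Finset.mul_sum]
  congr 1
  · have h1 : ∀ a, (∑ c, X a c * if a = c ∧ a ∈ S then 1 else 0) = if a ∈ S then X a a else 0 := by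
      intro a
      by_cases h : a ∈ S <;> simp [h]
    rw [Finset.sum_congr rfl fun a _ => h1 a, Finset.sum_ite_mem, Finset.univ_inter]
  · exact Finset.sum_congr rfl fun a _ => Finset.sum_congr rfl fun c _ => by ring

end Projections

/-! ### Averages of the blocks of an observable -/

section BlockAverages

variable {n : ℕ}

/-- The average over `π ∈ T_V` of the sesquilinear form of `X` at `f` and `g`, permuted according
to the signs `z` and `z'`. -/
def blockAvg (V : Finset (Fin (2 ^ n))) (z z' : ℤˣ) (X : Matrix (Fin (2 ^ n)) (Fin (2 ^ n)) ℂ)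
    (f g : Fin (2 ^ n) → ℂ) : ℂ :=
  ((stabilizing V).card : ℂ)⁻¹ * ∑ π ∈ stabilizing V,
    star (f ∘ ⇑(π ^ (-(z : ℤ)))) ⬝ᵥ X *ᵥ (g ∘ ⇑(π ^ (-(z' : ℤ))))

lemma sum_stabilizing_inv {M : Type*} [AddCommMonoid M] (V : Finset (Fin (2 ^ n)))
    (F : Equiv.Perm (Fin (2 ^ n)) → M) :
    ∑ π ∈ stabilizing V, F π⁻¹ = ∑ π ∈ stabilizing V, F π :=
  Finset.sum_nbij' (·⁻¹) (·⁻¹) (fun _ h => inv_mem_stabilizing h)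
    (fun _ h => inv_mem_stabilizing h) (by simp) (by simp) (by simp)

lemma avg_pair (V : Finset (Fin (2 ^ n))) (φ : Fin (2 ^ n) → Fin (2 ^ n) → ℂ)
    (a c : Fin (2 ^ n)) :
    ((stabilizing V).card : ℂ)⁻¹ * ∑ π ∈ stabilizing V, φ (π a) (π c) =
      ∑ b, ∑ d, φ b d * pairProb V a c b d := by
  have h : ∀ π : Equiv.Perm (Fin (2 ^ n)), φ (π a) (π c) =
      ∑ b, ∑ d, φ b d * if π a = b ∧ π c = d then 1 else 0 := by
    intro π
    rw [Finset.sum_eq_single (π a), Finset.sum_eq_single (π c)]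
    · simp
    · intro d _ hd; simp [hd.symm]
    · simp
    · intro b _ hb; simp [hb.symm]
    · simp
  simp_rw [h]
  rw [Finset.sum_comm, Finset.mul_sum]
  refine Finset.sum_congr rfl fun b _ => ?_
  rw [Finset.sum_comm, Finset.mul_sum]
  refine Finset.sum_congr rfl fun d _ => ?_
  rw [← Finset.mul_sum, pairProb, pairCount, Finset.sum_boole]
  ring

/-- Inversion permutes T_V, so both equal-sign cases reduce to averaging over pairs (π a, π c). -/
lemma blockAvg_same (V : Finset (Fin (2 ^ n))) (z : ℤˣ)
    (X : Matrix (Fin (2 ^ n)) (Fin (2 ^ n)) ℂ) (f g : Fin (2 ^ n) → ℂ) :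
    blockAvg V z z X f g =
      ∑ a, ∑ c, X a c * ∑ b, ∑ d, star (f b) * g d * pairProb V a c b d := by
  have h1 : blockAvg V z z X f g = ((stabilizing V).card : ℂ)⁻¹ * ∑ π ∈ stabilizing V,
      star (f ∘ ⇑π) ⬝ᵥ X *ᵥ (g ∘ ⇑π) := by
    rcases Int.units_eq_one_or z with rfl | rfl
    · rw [blockAvg, ← sum_stabilizing_inv V fun π => star (f ∘ ⇑π) ⬝ᵥ X *ᵥ (g ∘ ⇑π)]
      simp
    · simp [blockAvg]
  have h2 : ∀ π : Equiv.Perm (Fin (2 ^ n)), star (f ∘ ⇑π) ⬝ᵥ X *ᵥ (g ∘ ⇑π) =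
      ∑ a, ∑ c, X a c * (star (f (π a)) * g (π c)) := by
    intro π
    simp only [dotProduct, Matrix.mulVec, Finset.mul_sum, Pi.star_apply, Function.comp_apply]
    exact Finset.sum_congr rfl fun a _ => Finset.sum_congr rfl fun c _ => by ring
  simp_rw [h1, h2]
  rw [Finset.sum_comm, Finset.mul_sum]
  refine Finset.sum_congr rfl fun a _ => ?_
  rw [Finset.sum_comm, Finset.mul_sum]
  refine Finset.sum_congr rfl fun c _ => ?_
  rw [← avg_pair V fun b d => star (f b) * g d, ← Finset.mul_sum]
  ring

/-- With opposite signs both π and π⁻¹ occur. Writing π⁻¹ d = c as π c = d turns this again into the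
law of a pair of values, with the roles of c and d exchanged. -/
lemma blockAvg_cross (V : Finset (Fin (2 ^ n))) {z z' : ℤˣ} (hz : z ≠ z')
    (X : Matrix (Fin (2 ^ n)) (Fin (2 ^ n)) ℂ) (f g : Fin (2 ^ n) → ℂ) :
    blockAvg V z z' X f g =
      ∑ a, ∑ d, X a d * ∑ b, ∑ c, star (f b) * g c * pairProb V a c b d := by
  have h1 : blockAvg V z z' X f g = ((stabilizing V).card : ℂ)⁻¹ * ∑ π ∈ stabilizing V,
      star (f ∘ ⇑π) ⬝ᵥ X *ᵥ (g ∘ ⇑π⁻¹) := by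
    rcases Int.units_eq_one_or z with rfl | rfl <;>
      rcases Int.units_eq_one_or z' with rfl | rfl <;> try exact absurd rfl hz
    · rw [blockAvg, ← sum_stabilizing_inv V fun π => star (f ∘ ⇑π) ⬝ᵥ X *ᵥ (g ∘ ⇑π⁻¹)]
      simp
    · simp [blockAvg]
  have h2 : ∀ π : Equiv.Perm (Fin (2 ^ n)), star (f ∘ ⇑π) ⬝ᵥ X *ᵥ (g ∘ ⇑π⁻¹) =
      ∑ a, ∑ d, ∑ c, X a d * g c * (star (f (π a)) * if π c = d then 1 else 0) := by
    intro π
    simp only [dotProduct, Matrix.mulVec, Finset.mul_sum, Pi.star_apply, Function.comp_apply]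
    refine Finset.sum_congr rfl fun a _ => Finset.sum_congr rfl fun d _ => ?_
    rw [Finset.sum_eq_single (π⁻¹ d)]
    · simp; ring
    · intro c _ hc
      have : π c ≠ d := fun h => hc (by simp [← h])
      simp [this]
    · simp
  simp_rw [h1, h2]
  rw [Finset.sum_comm, Finset.mul_sum]
  refine Finset.sum_congr rfl fun a _ => ?_
  rw [Finset.sum_comm, Finset.mul_sum]
  refine Finset.sum_congr rfl fun d _ => ?_
  rw [Finset.sum_comm, Finset.mul_sum]
  conv_rhs => rw [Finset.sum_comm, Finset.mul_sum]
  refine Finset.sum_congr rfl fun c _ => ?_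
  rw [← Finset.mul_sum]
  have := avg_pair V (fun b d' => star (f b) * if d' = d then 1 else 0) a c
  rw [mul_left_comm, this, Finset.mul_sum, Finset.mul_sum]
  refine Finset.sum_congr rfl fun b _ => ?_
  rw [Finset.sum_eq_single d]
  · simp; ring
  · intro d' _ h; simp [h]
  · simp

/-- The projection onto the vectors that are constant on `V` and on its complement. -/
def classProj {ι : Type*} [Fintype ι] [DecidableEq ι] (V : Finset ι) : Matrix ι ι ℂ :=
  avgProj V + avgProj Vᶜ

lemma classProj_symm {ι : Type*} [Fintype ι] [DecidableEq ι] (V : Finset ι) (a b : ι) :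
    classProj V a b = classProj V b a := by
  simp only [classProj, avgProj, Matrix.add_apply, Matrix.of_apply, and_comm]

lemma star_classProj_apply {ι : Type*} [Fintype ι] [DecidableEq ι] (V : Finset ι) (a b : ι) :
    star (classProj V a b) = classProj V a b := by
  simp only [classProj, Matrix.add_apply, star_add, star_avgProj_apply]

lemma meanZeroProj_symm {ι : Type*} [DecidableEq ι] (S : Finset ι) (a b : ι) :
    meanZeroProj S a b = meanZeroProj S b a := by
  simp only [meanZeroProj, avgProj, Matrix.of_apply, and_comm (a := a ∈ S)]
  congr 1
  by_cases h : a = b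
  · subst h; rfl
  · simp [h, Ne.symm h]

lemma sum_classProj {ι : Type*} [Fintype ι] [DecidableEq ι] (V : Finset ι) (X : Matrix ι ι ℂ)
    (f g : ι → ℂ) :
    ∑ a, ∑ c, X a c * ∑ b, ∑ d, star (f b) * g d * (classProj V a b * classProj V c d) =
      star (classProj V *ᵥ f) ⬝ᵥ X *ᵥ (classProj V *ᵥ g) := by
  simp only [dotProduct, Matrix.mulVec, Pi.star_apply, star_sum, star_mul', star_classProj_apply]
  refine Finset.sum_congr rfl fun a _ => ?_
  rw [Finset.mul_sum]
  refine Finset.sum_congr rfl fun c _ => ?_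
  rw [mul_left_comm, Finset.sum_mul_sum]
  congr 1
  exact Finset.sum_congr rfl fun b _ => Finset.sum_congr rfl fun d _ => by ring

/-- The first term of `pairFormula` compresses X to the class-constant vectors; the others pair X
with a mean-zero projection and leave a multiple of that projection. -/
lemma blockAvg_same_eq {V : Finset (Fin (2 ^ n))} (hV : V.card ≠ 1) (hV' : Vᶜ.card ≠ 1) (z : ℤˣ)
    (X : Matrix (Fin (2 ^ n)) (Fin (2 ^ n)) ℂ) (f g : Fin (2 ^ n) → ℂ) :
    blockAvg V z z X f g = star (classProj V *ᵥ f) ⬝ᵥ X *ᵥ (classProj V *ᵥ g) +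
      (meanZeroCoeff V X * (star f ⬝ᵥ meanZeroProj V *ᵥ g) +
        meanZeroCoeff Vᶜ X * (star f ⬝ᵥ meanZeroProj Vᶜ *ᵥ g)) := by
  have key : ∀ S : Finset (Fin (2 ^ n)), ∑ a, ∑ c, X a c * ∑ b, ∑ d, star (f b) * g d *
      (((S.card : ℂ) - 1)⁻¹ * (meanZeroProj S a c * meanZeroProj S b d)) =
      meanZeroCoeff S X * (star f ⬝ᵥ meanZeroProj S *ᵥ g) := by
    intro S
    rw [meanZeroCoeff, Finset.mul_sum, Finset.sum_mul]
    refine Finset.sum_congr rfl fun a _ => ?_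
    rw [Finset.mul_sum, Finset.sum_mul]
    refine Finset.sum_congr rfl fun c _ => ?_
    simp only [dotProduct, Matrix.mulVec, Finset.mul_sum, Pi.star_apply]
    exact Finset.sum_congr rfl fun b _ => Finset.sum_congr rfl fun d _ => by ring
  rw [blockAvg_same, ← sum_classProj, ← key, ← key]
  simp only [← Finset.sum_add_distrib, ← mul_add]
  simp only [pairProb_eq_pairFormula hV hV', pairFormula, classProj]

/-- Exchanging c and d keeps the compression but turns the mean-zero terms into transposed blocks: g
now stands to the left of X and the conjugate of f to the right. No trace appears, so the factor
1/(|S| - 1) makes these terms small. -/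
lemma blockAvg_cross_eq {V : Finset (Fin (2 ^ n))} (hV : V.card ≠ 1) (hV' : Vᶜ.card ≠ 1)
    {z z' : ℤˣ} (hz : z ≠ z')
    (X : Matrix (Fin (2 ^ n)) (Fin (2 ^ n)) ℂ) (f g : Fin (2 ^ n) → ℂ) :
    blockAvg V z z' X f g = star (classProj V *ᵥ f) ⬝ᵥ X *ᵥ (classProj V *ᵥ g) +
      (((V.card : ℂ) - 1)⁻¹ *
          ((meanZeroProj V *ᵥ g) ⬝ᵥ X *ᵥ (meanZeroProj V *ᵥ star f)) +
        ((Vᶜ.card : ℂ) - 1)⁻¹ *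
          ((meanZeroProj Vᶜ *ᵥ g) ⬝ᵥ X *ᵥ (meanZeroProj Vᶜ *ᵥ star f))) := by
  have key : ∀ S : Finset (Fin (2 ^ n)), ∑ a, ∑ d, X a d * ∑ b, ∑ c, star (f b) * g c *
      (((S.card : ℂ) - 1)⁻¹ * (meanZeroProj S a c * meanZeroProj S b d)) =
      ((S.card : ℂ) - 1)⁻¹ *
        ((meanZeroProj S *ᵥ g) ⬝ᵥ X *ᵥ (meanZeroProj S *ᵥ star f)) := by
    intro S
    simp only [dotProduct, Matrix.mulVec]
    rw [Finset.mul_sum]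
    refine Finset.sum_congr rfl fun a _ => ?_
    rw [Finset.mul_sum, Finset.mul_sum]
    refine Finset.sum_congr rfl fun d _ => ?_
    rw [show ∀ p q r s : ℂ, p * (q * (r * s)) = r * (p * (q * s)) from
        fun _ _ _ _ => by ring, Finset.sum_mul_sum, Finset.sum_comm]
    congr 1
    rw [Finset.mul_sum]
    refine Finset.sum_congr rfl fun c _ => ?_
    rw [Finset.mul_sum]
    refine Finset.sum_congr rfl fun b _ => ?_
    rw [meanZeroProj_symm S b d, Pi.star_apply]
    ring
  rw [blockAvg_cross V hz, ← sum_classProj, ← key, ← key]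
  simp only [← Finset.sum_add_distrib, ← mul_add]
  refine Finset.sum_congr rfl fun a _ => Finset.sum_congr rfl fun d _ => ?_
  congr 1
  refine Finset.sum_congr rfl fun b _ => Finset.sum_congr rfl fun c _ => ?_
  rw [classProj_symm V d c, pairProb_eq_pairFormula hV hV']
  rfl

end BlockAverages

/-! ### The deviation vector of V and the mean-zero coefficients -/

section Deviation

variable {ι : Type*}

lemma norm_inv_card_sub_one_le {S : Finset ι} {k : ℕ} (hk : 2 ≤ k) (hS : k ≤ S.card) :
    ‖((S.card : ℂ) - 1)⁻¹‖ ≤ 1 / ((k : ℝ) - 1) := by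
  have h1 : (2 : ℝ) ≤ k := by exact_mod_cast hk
  have h2 : (k : ℝ) ≤ S.card := by exact_mod_cast hS
  rw [norm_inv, show ((S.card : ℂ) - 1) = (((S.card : ℝ) - 1 : ℝ) : ℂ) by push_cast; rfl,
      Complex.norm_real, Real.norm_of_nonneg (by linarith), one_div]
  exact inv_anti₀ (by linarith) (by linarith)

variable [DecidableEq ι]

lemma avgProj_empty : avgProj (∅ : Finset ι) = 0 := by
  ext; simp [avgProj]

lemma meanZeroProj_empty : meanZeroProj (∅ : Finset ι) = 0 := by
  ext; simp [meanZeroProj, avgProj_empty]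

variable [Fintype ι]

/-- The unit vector that spans, together with the uniform vector, the vectors that are constant on
`V` and on its complement. -/
def devVec (V : Finset ι) : ι → ℂ := fun a =>
  ((√((Fintype.card ι : ℝ) / (V.card * (Fintype.card ι - V.card))) *
    ((if a ∈ V then 1 else 0) - (V.card : ℝ) / Fintype.card ι) : ℝ) : ℂ)

lemma star_devVec (V : Finset ι) : star (devVec V) = devVec V := by
  ext a
  simp [devVec, -Complex.ofReal_mul]

lemma classProj_eq {V : Finset ι} (h0 : V.Nonempty) (h1 : Vᶜ.Nonempty) :
    classProj V = avgProj Finset.univ + Matrix.vecMulVec (devVec V) (devVec V) := by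
  have hc : V.card + Vᶜ.card = Fintype.card ι := Finset.card_add_card_compl V
  have hk : (0 : ℝ) < V.card := by exact_mod_cast h0.card_pos
  have hk' : (0 : ℝ) < Vᶜ.card := by exact_mod_cast h1.card_pos
  have hN : (Fintype.card ι : ℝ) = V.card + Vᶜ.card := by exact_mod_cast hc.symm
  have hNk : (Fintype.card ι : ℝ) - V.card = Vᶜ.card := by rw [hN]; ring
  ext a b
  have e : Matrix.vecMulVec (devVec V) (devVec V) a b =
      (((Fintype.card ι : ℝ) / (V.card * (Fintype.card ι - V.card)) *
        (((if a ∈ V then 1 else 0) - (V.card : ℝ) / Fintype.card ι) *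
        ((if b ∈ V then 1 else 0) - (V.card : ℝ) / Fintype.card ι)) : ℝ) : ℂ) := by
    rw [Matrix.vecMulVec_apply, devVec, devVec, ← Complex.ofReal_mul]
    congr 1
    rw [mul_mul_mul_comm, Real.mul_self_sqrt]
    rw [hNk]
    positivity
  have e1 : (classProj V a b : ℂ) = ((if a ∈ V ∧ b ∈ V then (V.card : ℝ)⁻¹ else if
      a ∉ V ∧ b ∉ V then (Vᶜ.card : ℝ)⁻¹ else 0 : ℝ) : ℂ) := by
    by_cases ha : a ∈ V <;> by_cases hb : b ∈ V <;> simp [classProj, avgProj, ha, hb]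
  have e2 : (avgProj (Finset.univ : Finset ι) a b : ℂ) = (((Fintype.card ι : ℝ)⁻¹ : ℝ) : ℂ) := by
    simp [avgProj]
  rw [Matrix.add_apply, e, e1, e2, ← Complex.ofReal_add]
  congr 1
  rw [hN]
  by_cases ha : a ∈ V <;> by_cases hb : b ∈ V <;> simp [ha, hb] <;> field_simp <;> ring

/-- This rearranges `classProj_eq`: among the vectors of total mean zero, only the direction `devVec
V` fails to have mean zero on each class. -/
lemma meanZeroProj_univ_eq {V : Finset ι} (h0 : V.Nonempty) (h1 : Vᶜ.Nonempty) :
    meanZeroProj (Finset.univ : Finset ι) = meanZeroProj V + meanZeroProj Vᶜ +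
      Matrix.vecMulVec (devVec V) (devVec V) := by
  have h := classProj_eq h0 h1
  ext a b
  have hab := congrFun (congrFun h a) b
  rw [classProj, Matrix.add_apply, Matrix.add_apply] at hab
  rw [Matrix.add_apply, Matrix.add_apply]
  simp only [meanZeroProj, Matrix.of_apply, Finset.mem_univ, and_true, Finset.mem_compl]
  by_cases ha : a ∈ V <;> simp only [ha, and_true, and_false, not_true, not_false_iff, if_false] <;>
    linear_combination hab

lemma sum_devVec {V : Finset ι} : ∑ a, devVec V a = 0 := by
  simp only [devVec]
  rw [← Complex.ofReal_sum, ← Finset.mul_sum, Finset.sum_sub_distrib]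
  simp only [Finset.sum_ite_mem, Finset.univ_inter, Finset.sum_const, nsmul_eq_mul, mul_one,
    Finset.card_univ]
  rcases eq_or_ne (Fintype.card ι) 0 with h | h
  · simp [h]
  · have : (Fintype.card ι : ℝ) ≠ 0 := by exact_mod_cast h
    rw [mul_div_cancel₀ _ this, sub_self, mul_zero, Complex.ofReal_zero]

lemma devVec_dotProduct_unitInd_univ {V : Finset ι} : devVec V ⬝ᵥ unitInd Finset.univ = 0 := by
  simp only [dotProduct, unitInd, Finset.mem_univ, if_true]
  rw [← Finset.sum_mul, sum_devVec, zero_mul]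

lemma l2_devVec {V : Finset ι} (h0 : V.Nonempty) (h1 : Vᶜ.Nonempty) : l2 (devVec V) = 1 := by
  have hc : V.card + Vᶜ.card = Fintype.card ι := Finset.card_add_card_compl V
  have hk : (0 : ℝ) < V.card := by exact_mod_cast h0.card_pos
  have hk' : (0 : ℝ) < Vᶜ.card := by exact_mod_cast h1.card_pos
  have hN : (Fintype.card ι : ℝ) = V.card + Vᶜ.card := by exact_mod_cast hc.symm
  have hNk : (Fintype.card ι : ℝ) - V.card = Vᶜ.card := by rw [hN]; ring
  rw [← sq_eq_sq₀ (l2_nonneg _) zero_le_one, l2_sq]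
  simp only [devVec, Complex.norm_real, Real.norm_eq_abs, sq_abs, mul_pow]
  rw [← Finset.mul_sum, Real.sq_sqrt (by rw [hNk]; positivity),
    ← Finset.sum_add_sum_compl V]
  have s1 : ∑ a ∈ V, ((if a ∈ V then 1 else 0) - (V.card : ℝ) / Fintype.card ι) ^ 2 =
      V.card * (1 - (V.card : ℝ) / Fintype.card ι) ^ 2 := by
    rw [← nsmul_eq_mul, ← Finset.sum_const]
    exact Finset.sum_congr rfl fun a ha => by simp [ha]
  have s2 : ∑ a ∈ Vᶜ, ((if a ∈ V then 1 else 0) - (V.card : ℝ) / Fintype.card ι) ^ 2 =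
      Vᶜ.card * ((V.card : ℝ) / Fintype.card ι) ^ 2 := by
    rw [← nsmul_eq_mul, ← Finset.sum_const]
    exact Finset.sum_congr rfl fun a ha => by simp [Finset.mem_compl.mp ha]
  rw [s1, s2, hNk, hN]
  field_simp
  ring

lemma norm_devVec_dotProduct_le {V : Finset ι} (h0 : V.Nonempty) (h1 : Vᶜ.Nonempty) (f : ι → ℂ) :
    ‖devVec V ⬝ᵥ f‖ ≤ l2 f := by
  have := norm_dotProduct_le (devVec V) f
  rwa [star_devVec, l2_devVec h0 h1, one_mul] at this

lemma classProj_mulVec {V : Finset ι} (h0 : V.Nonempty) (h1 : Vᶜ.Nonempty) (f : ι → ℂ) :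
    classProj V *ᵥ f = (unitInd Finset.univ ⬝ᵥ f) • unitInd Finset.univ +
      (devVec V ⬝ᵥ f) • devVec V := by
  rw [classProj_eq h0 h1, Matrix.add_mulVec, avgProj_mulVec, Matrix.vecMulVec_mulVec]
  simp

lemma classProj_univ_mulVec (f : ι → ℂ) :
    classProj Finset.univ *ᵥ f = (unitInd Finset.univ ⬝ᵥ f) • unitInd Finset.univ := by
  rw [classProj, Finset.compl_univ, avgProj_empty, add_zero, avgProj_mulVec]

/-- The mean of the diagonal entries of `X` in `S`. -/
def diagMean (S : Finset ι) (X : Matrix ι ι ℂ) : ℂ := (S.card : ℂ)⁻¹ * ∑ a ∈ S, X a a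

lemma norm_diagMean_le (S : Finset ι) {X : Matrix ι ι ℂ} (hX : Contraction X) :
    ‖diagMean S X‖ ≤ 1 := by
  rw [diagMean, norm_mul, norm_inv, Complex.norm_natCast]
  have : ‖∑ a ∈ S, X a a‖ ≤ S.card := by
    refine (norm_sum_le _ _).trans ?_
    simpa using Finset.sum_le_sum fun a (_ : a ∈ S) => hX.norm_apply_le a a
  calc _ ≤ (S.card : ℝ)⁻¹ * S.card := by gcongr
    _ ≤ 1 := inv_mul_le_one

lemma norm_unitInd_form_le (S T : Finset ι) {X : Matrix ι ι ℂ} (hX : Contraction X) :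
    ‖unitInd S ⬝ᵥ X *ᵥ unitInd T‖ ≤ 1 := by
  have := hX (unitInd S) (unitInd T)
  rw [star_unitInd] at this
  exact this.trans (mul_le_one₀ (l2_unitInd_le _) (l2_nonneg _) (l2_unitInd_le _))

/-- The difference equals the diagonal mean minus the form at `unitInd S`, divided by |S| - 1; for a
contraction both terms are at most 1. -/
lemma norm_meanZeroCoeff_sub_le {S : Finset ι} (hS : 2 ≤ S.card) {X : Matrix ι ι ℂ}
    (hX : Contraction X) : ‖meanZeroCoeff S X - diagMean S X‖ ≤ 2 / (S.card - 1) := by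
  have h0 : (S.card : ℂ) ≠ 0 := by rw [Nat.cast_ne_zero]; omega
  have h1 : (S.card : ℂ) - 1 ≠ 0 := by rw [sub_ne_zero]; norm_cast; omega
  have h2 : (0 : ℝ) < S.card - 1 := by
    have : (2 : ℝ) ≤ S.card := by exact_mod_cast hS
    linarith
  have e : meanZeroCoeff S X - diagMean S X =
      ((S.card : ℂ) - 1)⁻¹ * (diagMean S X - star (unitInd S) ⬝ᵥ X *ᵥ unitInd S) := by
    rw [meanZeroCoeff, sum_mul_meanZeroProj, diagMean]
    field_simp
    ring
  have e2 : ‖((S.card : ℂ) - 1)⁻¹‖ = ((S.card : ℝ) - 1)⁻¹ := by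
    rw [norm_inv, show ((S.card : ℂ) - 1) = (((S.card : ℝ) - 1 : ℝ) : ℂ) by push_cast; rfl,
      Complex.norm_real, Real.norm_of_nonneg h2.le]
  rw [e, norm_mul, e2, mul_comm, div_eq_mul_inv]
  gcongr
  refine (norm_sub_le _ _).trans ?_
  have h3 := norm_diagMean_le S hX
  have h4 := norm_unitInd_form_le S S hX
  rw [star_unitInd]
  linarith

lemma norm_meanZeroCoeff_le {S : Finset ι} (hS : 2 ≤ S.card) {X : Matrix ι ι ℂ}
    (hX : Contraction X) : ‖meanZeroCoeff S X‖ ≤ 3 := by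
  have h2 : (1 : ℝ) ≤ S.card - 1 := by
    have : (2 : ℝ) ≤ S.card := by exact_mod_cast hS
    linarith
  have h3 := norm_diagMean_le S hX
  have h4 := norm_meanZeroCoeff_sub_le hS hX
  have h5 : 2 / ((S.card : ℝ) - 1) ≤ 2 := div_le_self zero_le_two h2
  calc ‖meanZeroCoeff S X‖ = ‖(meanZeroCoeff S X - diagMean S X) + diagMean S X‖ := by ring_nf
    _ ≤ _ := norm_add_le _ _
    _ ≤ 3 := by linarith

/-- The deviations on V and on Vᶜ, weighted by class size, cancel, so the larger class has the
smaller deviation. Testing V alone therefore suffices. -/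
lemma norm_diagMean_compl_sub_le {V : Finset ι} (h0 : V.Nonempty) (hV : V.card ≤ Vᶜ.card)
    (X : Matrix ι ι ℂ) :
    ‖diagMean Vᶜ X - diagMean Finset.univ X‖ ≤ ‖diagMean V X - diagMean Finset.univ X‖ := by
  have hc : V.card + Vᶜ.card = Fintype.card ι := Finset.card_add_card_compl V
  have hk : V.card ≠ 0 := h0.card_pos.ne'
  have hk' : Vᶜ.card ≠ 0 := by omega
  have hkC : (V.card : ℂ) ≠ 0 := by exact_mod_cast hk
  have hk'C : (Vᶜ.card : ℂ) ≠ 0 := by exact_mod_cast hk'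
  have hNC : (V.card + Vᶜ.card : ℂ) ≠ 0 := by norm_cast; omega
  have hk'R : (0 : ℝ) < Vᶜ.card := by exact_mod_cast Nat.pos_of_ne_zero hk'
  have e : diagMean Vᶜ X - diagMean Finset.univ X =
      -((V.card : ℂ) / Vᶜ.card * (diagMean V X - diagMean Finset.univ X)) := by
    simp only [diagMean, Finset.card_univ]
    rw [← hc, ← Finset.sum_add_sum_compl V]
    push_cast
    field_simp
    ring
  rw [e, norm_neg, norm_mul, norm_div, Complex.norm_natCast, Complex.norm_natCast]
  refine mul_le_of_le_one_left (norm_nonneg _) ?_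
  rw [div_le_one hk'R]
  exact_mod_cast hV

lemma norm_meanZero_cross_le (S : Finset ι) {k : ℕ} (hk : 2 ≤ k) (hS : k ≤ S.card)
    {X : Matrix ι ι ℂ} (hX : Contraction X) (f g : ι → ℂ) :
    ‖((S.card : ℂ) - 1)⁻¹ * ((meanZeroProj S *ᵥ g) ⬝ᵥ X *ᵥ (meanZeroProj S *ᵥ star f))‖ ≤
      4 / ((k : ℝ) - 1) * (l2 f * l2 g) := by
  have h1 : (0 : ℝ) ≤ 1 / ((k : ℝ) - 1) := by
    have : (2 : ℝ) ≤ k := by exact_mod_cast hk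
    apply one_div_nonneg.mpr; linarith
  have h2 := hX (star (meanZeroProj S *ᵥ g)) (meanZeroProj S *ᵥ star f)
  rw [star_star, l2_star] at h2
  have h3 := l2_meanZeroProj_mulVec_le S g
  have h4 := l2_meanZeroProj_mulVec_le S (star f)
  rw [l2_star] at h4
  have h5 := mul_le_mul h3 h4 (l2_nonneg _) (by linarith [l2_nonneg g])
  rw [norm_mul]
  calc _ ≤ 1 / ((k : ℝ) - 1) * (2 * l2 g * (2 * l2 f)) :=
        mul_le_mul (norm_inv_card_sub_one_le hk hS) (h2.trans h5) (norm_nonneg _) h1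
    _ = _ := by ring

end Deviation

/-! ### Comparing T_V with all permutations on one block -/

section BlockBounds

variable {n : ℕ}

/-- Expand with P = pp† + uu†. The pp† terms cancel, the two mixed terms cost η each, and the uu†
term is bounded by the overlaps of f and g with u. -/
lemma norm_classProj_form_sub_le {ι : Type*} [Fintype ι] [DecidableEq ι] {V : Finset ι}
    (h0 : V.Nonempty) (h1 : Vᶜ.Nonempty)
    {X : Matrix ι ι ℂ} (hX : Contraction X) {η : ℝ}
    (hrow : ‖devVec V ⬝ᵥ X *ᵥ unitInd Finset.univ‖ ≤ η)
    (hcol : ‖unitInd Finset.univ ⬝ᵥ X *ᵥ devVec V‖ ≤ η) (f g : ι → ℂ) :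
    ‖star (classProj V *ᵥ f) ⬝ᵥ X *ᵥ (classProj V *ᵥ g) -
        star (classProj Finset.univ *ᵥ f) ⬝ᵥ X *ᵥ (classProj Finset.univ *ᵥ g)‖ ≤
      2 * η * (l2 f * l2 g) + ‖devVec V ⬝ᵥ f‖ * ‖devVec V ⬝ᵥ g‖ := by
  have hη : 0 ≤ η := (norm_nonneg _).trans hrow
  have e : star (classProj V *ᵥ f) ⬝ᵥ X *ᵥ (classProj V *ᵥ g) -
        star (classProj Finset.univ *ᵥ f) ⬝ᵥ X *ᵥ (classProj Finset.univ *ᵥ g) =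
      star (unitInd Finset.univ ⬝ᵥ f) * (devVec V ⬝ᵥ g) *
          (unitInd Finset.univ ⬝ᵥ X *ᵥ devVec V) +
        star (devVec V ⬝ᵥ f) * (unitInd Finset.univ ⬝ᵥ g) *
          (devVec V ⬝ᵥ X *ᵥ unitInd Finset.univ) +
        star (devVec V ⬝ᵥ f) * (devVec V ⬝ᵥ g) * (devVec V ⬝ᵥ X *ᵥ devVec V) := by
    rw [classProj_mulVec h0 h1, classProj_mulVec h0 h1, classProj_univ_mulVec,
      classProj_univ_mulVec]
    simp only [star_add, star_smul, star_unitInd, star_devVec, Matrix.mulVec_add,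
      Matrix.mulVec_smul, add_dotProduct, dotProduct_add, smul_dotProduct, dotProduct_smul,
      smul_eq_mul]
    ring
  have hpf := norm_unitInd_dotProduct_le Finset.univ f
  have hpg := norm_unitInd_dotProduct_le Finset.univ g
  have huf := norm_devVec_dotProduct_le h0 h1 f
  have hug := norm_devVec_dotProduct_le h0 h1 g
  have huu : ‖devVec V ⬝ᵥ X *ᵥ devVec V‖ ≤ 1 := by
    have := hX (devVec V) (devVec V)
    rwa [star_devVec, l2_devVec h0 h1, one_mul] at this
  rw [e]
  refine (norm_add₃_le).trans ?_
  simp only [norm_mul, norm_star]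
  have t1 := mul_le_mul (mul_le_mul hpf hug (norm_nonneg _) (l2_nonneg _)) hcol (norm_nonneg _)
    (mul_nonneg (l2_nonneg f) (l2_nonneg g))
  have t2 := mul_le_mul (mul_le_mul huf hpg (norm_nonneg _) (l2_nonneg _)) hrow (norm_nonneg _)
    (mul_nonneg (l2_nonneg f) (l2_nonneg g))
  have t3 := mul_le_mul_of_nonneg_left huu
    (mul_nonneg (norm_nonneg (devVec V ⬝ᵥ f)) (norm_nonneg (devVec V ⬝ᵥ g)))
  linarith

/-- The averages over `T_V` and over all permutations of a block nearly agree, apart from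
the component along `devVec V`. -/
lemma norm_blockAvg_sub_le {V : Finset (Fin (2 ^ n))} (hk : 2 ≤ V.card) (hk' : V.card ≤ Vᶜ.card)
    (z z' : ℤˣ) {X : Matrix (Fin (2 ^ n)) (Fin (2 ^ n)) ℂ} (hX : Contraction X) {η : ℝ}
    (hdiag : ‖diagMean V X - diagMean Finset.univ X‖ ≤ η)
    (hrow : ‖devVec V ⬝ᵥ X *ᵥ unitInd Finset.univ‖ ≤ η)
    (hcol : ‖unitInd Finset.univ ⬝ᵥ X *ᵥ devVec V‖ ≤ η) (f g : Fin (2 ^ n) → ℂ) :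
    ‖blockAvg V z z' X f g - blockAvg Finset.univ z z' X f g‖ ≤
      (6 * η + 16 / ((V.card : ℝ) - 1)) * (l2 f * l2 g) +
        4 * (‖devVec V ⬝ᵥ f‖ * ‖devVec V ⬝ᵥ g‖) := by
  have hη : 0 ≤ η := (norm_nonneg _).trans hrow
  have h0 : V.Nonempty := Finset.card_pos.mp (by omega)
  have h1 : Vᶜ.Nonempty := Finset.card_pos.mp (by omega)
  have hc : V.card + Vᶜ.card = (Finset.univ : Finset (Fin (2 ^ n))).card := by
    rw [Finset.card_add_card_compl, Finset.card_univ]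
  have hkR : (1 : ℝ) ≤ V.card - 1 := by
    have : (2 : ℝ) ≤ V.card := by exact_mod_cast hk
    linarith
  -- The full set of permutations is treated as T_V for V = univ, whose empty complement contributes
  -- nothing.
  have hcU : (Finset.univ : Finset (Fin (2 ^ n))).card ≠ 1 := by omega
  have hcE : (Finset.univ : Finset (Fin (2 ^ n)))ᶜ.card ≠ 1 := by simp
  have hfg : 0 ≤ l2 f * l2 g := mul_nonneg (l2_nonneg f) (l2_nonneg g)
  have huv : 0 ≤ ‖devVec V ⬝ᵥ f‖ * ‖devVec V ⬝ᵥ g‖ := by positivity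
  have hform := norm_classProj_form_sub_le h0 h1 hX hrow hcol f g
  set r : ℝ := 1 / ((V.card : ℝ) - 1) with hr
  have hr0 : 0 ≤ r := by apply one_div_nonneg.mpr; linarith
  have hrk : 16 / ((V.card : ℝ) - 1) = 16 * r := by rw [hr]; ring
  rw [hrk]
  by_cases hz : z = z'
  · subst hz
    rw [blockAvg_same_eq (by omega) (by omega), blockAvg_same_eq hcU hcE]
    simp only [Finset.compl_univ, meanZeroProj_empty, Matrix.zero_mulVec, dotProduct_zero, mul_zero,
      add_zero]
    have hsub : ∀ S : Finset (Fin (2 ^ n)), V.card ≤ S.card →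
        ‖meanZeroCoeff S X - diagMean S X‖ ≤ 2 * r := by
      intro S hS
      refine (norm_meanZeroCoeff_sub_le (by omega) hX).trans ?_
      have : (V.card : ℝ) ≤ S.card := by exact_mod_cast hS
      rw [hr, mul_one_div]
      gcongr
    have hU := hsub Finset.univ (by omega)
    have hclose : ∀ S : Finset (Fin (2 ^ n)), V.card ≤ S.card →
        ‖diagMean S X - diagMean Finset.univ X‖ ≤ η →
        ‖meanZeroCoeff S X - meanZeroCoeff Finset.univ X‖ ≤ η + 4 * r := by
      intro S hS hd
      have h2 := hsub S hS
      calc _ = ‖(meanZeroCoeff S X - diagMean S X) + (diagMean S X - diagMean Finset.univ X) -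
            (meanZeroCoeff Finset.univ X - diagMean Finset.univ X)‖ := by congr 1; ring
        _ ≤ _ := norm_sub_le _ _
        _ ≤ _ := add_le_add_left (norm_add_le _ _) _
        _ ≤ _ := by linarith
    have hV := hclose V le_rfl hdiag
    have hV' := hclose Vᶜ hk' ((norm_diagMean_compl_sub_le h0 hk' X).trans hdiag)
    have ht := norm_meanZeroCoeff_le (S := Finset.univ) (by omega) hX
    have hRV := norm_meanZeroProj_form_le V f g
    have hRV' := norm_meanZeroProj_form_le Vᶜ f g
    have eR : star f ⬝ᵥ meanZeroProj Finset.univ *ᵥ g = star f ⬝ᵥ meanZeroProj V *ᵥ g +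
        star f ⬝ᵥ meanZeroProj Vᶜ *ᵥ g + star (devVec V ⬝ᵥ f) * (devVec V ⬝ᵥ g) := by
      rw [meanZeroProj_univ_eq h0 h1, Matrix.add_mulVec, Matrix.add_mulVec, dotProduct_add,
        dotProduct_add, Matrix.vecMulVec_mulVec]
      congr 1
      have : star (devVec V ⬝ᵥ f) = star f ⬝ᵥ devVec V := by
        rw [← star_devVec, Matrix.star_dotProduct, star_star, star_devVec, dotProduct_comm,
          dotProduct_comm]
      rw [this]
      simp [dotProduct_smul, mul_comm]
    rw [eR]
    set A := star (classProj V *ᵥ f) ⬝ᵥ X *ᵥ (classProj V *ᵥ g)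
    set B := star (classProj Finset.univ *ᵥ f) ⬝ᵥ X *ᵥ (classProj Finset.univ *ᵥ g)
    set t := meanZeroCoeff Finset.univ X
    set R := star f ⬝ᵥ meanZeroProj V *ᵥ g
    set R' := star f ⬝ᵥ meanZeroProj Vᶜ *ᵥ g
    have e : A + (meanZeroCoeff V X * R + meanZeroCoeff Vᶜ X * R') -
        (B + t * (R + R' + star (devVec V ⬝ᵥ f) * (devVec V ⬝ᵥ g))) =
        ((A - B) + (meanZeroCoeff V X - t) * R + (meanZeroCoeff Vᶜ X - t) * R') -
          t * (star (devVec V ⬝ᵥ f) * (devVec V ⬝ᵥ g)) := by ring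
    rw [e]
    refine (norm_sub_le _ _).trans ?_
    refine (add_le_add_left norm_add₃_le _).trans ?_
    simp only [norm_mul, norm_star]
    -- The constants arise as 6η = 2η + 2·2·η, 16r = 2·2·4r, and 4 = 1 + 3, the 3 being the bound on
    -- the coefficient t.
    have m1 := mul_le_mul hV hRV (norm_nonneg _) (by positivity)
    have m2 := mul_le_mul hV' hRV' (norm_nonneg _) (by positivity)
    have m3 := mul_le_mul_of_nonneg_right ht huv
    linarith
  · rw [blockAvg_cross_eq (by omega) (by omega) hz, blockAvg_cross_eq hcU hcE hz]
    simp only [Finset.compl_univ, meanZeroProj_empty, Matrix.zero_mulVec, zero_dotProduct, mul_zero,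
      add_zero]
    have c1 := norm_meanZero_cross_le V hk le_rfl hX f g
    have c2 := norm_meanZero_cross_le Vᶜ hk hk' hX f g
    have c3 := norm_meanZero_cross_le Finset.univ hk (by omega) hX f g
    have e4 : 4 / ((V.card : ℝ) - 1) = 4 * r := by rw [hr]; ring
    rw [e4] at c1 c2 c3
    rw [add_sub_add_comm]
    refine (norm_add_le _ _).trans ?_
    refine (add_le_add_right ((norm_sub_le _ _).trans (add_le_add_left (norm_add_le _ _) _)) _).trans ?_
    have : 0 ≤ r * (l2 f * l2 g) := by positivity
    have : 0 ≤ η * (l2 f * l2 g) := by positivity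
    linarith

/-- The average over `T_V` of a block that annihilates `devVec V` and has small trace is small. -/
lemma norm_blockAvg_le_of_mulVec_devVec_eq_zero {V : Finset (Fin (2 ^ n))} (hk : 2 ≤ V.card)
    (hk' : V.card ≤ Vᶜ.card) (z z' : ℤˣ) {X : Matrix (Fin (2 ^ n)) (Fin (2 ^ n)) ℂ}
    (hX : Contraction X) {η : ℝ} (hl : devVec V ᵥ* X = 0) (hr : X *ᵥ devVec V = 0)
    (hp : ‖unitInd Finset.univ ⬝ᵥ X *ᵥ unitInd Finset.univ‖ ≤ η)
    (htr : ∀ S : Finset (Fin (2 ^ n)), ‖∑ a ∈ S, X a a‖ ≤ 1) (f g : Fin (2 ^ n) → ℂ) :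
    ‖blockAvg V z z' X f g‖ ≤ (η + 8 / ((V.card : ℝ) - 1)) * (l2 f * l2 g) := by
  have h0 : V.Nonempty := Finset.card_pos.mp (by omega)
  have h1 : Vᶜ.Nonempty := Finset.card_pos.mp (by omega)
  have hkR : (1 : ℝ) ≤ V.card - 1 := by
    have : (2 : ℝ) ≤ V.card := by exact_mod_cast hk
    linarith
  have hη : 0 ≤ η := (norm_nonneg _).trans hp
  have hfg : 0 ≤ l2 f * l2 g := mul_nonneg (l2_nonneg f) (l2_nonneg g)
  have hform : ‖star (classProj V *ᵥ f) ⬝ᵥ X *ᵥ (classProj V *ᵥ g)‖ ≤ η * (l2 f * l2 g) := by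
    have e : star (classProj V *ᵥ f) ⬝ᵥ X *ᵥ (classProj V *ᵥ g) =
        star (unitInd Finset.univ ⬝ᵥ f) * (unitInd Finset.univ ⬝ᵥ g) *
          (unitInd Finset.univ ⬝ᵥ X *ᵥ unitInd Finset.univ) := by
      have hl' : ∀ v, devVec V ⬝ᵥ X *ᵥ v = 0 := fun v => by
        rw [Matrix.dotProduct_mulVec, hl, zero_dotProduct]
      rw [classProj_mulVec h0 h1, classProj_mulVec h0 h1]
      simp only [star_add, star_smul, star_unitInd, star_devVec, Matrix.mulVec_add,
        Matrix.mulVec_smul, add_dotProduct, dotProduct_add, smul_dotProduct, dotProduct_smul,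
        smul_eq_mul, hr, hl', dotProduct_zero]
      ring
    rw [e, norm_mul, norm_mul, norm_star, mul_comm]
    exact mul_le_mul hp (mul_le_mul (norm_unitInd_dotProduct_le _ f)
      (norm_unitInd_dotProduct_le _ g) (norm_nonneg _) (l2_nonneg _)) (by positivity) hη
  set r : ℝ := 1 / ((V.card : ℝ) - 1) with hr
  have hr0 : 0 ≤ r := by apply one_div_nonneg.mpr; linarith
  have hrk : 8 / ((V.card : ℝ) - 1) = 8 * r := by rw [hr]; ring
  rw [hrk]
  by_cases hz : z = z'
  · subst hz
    rw [blockAvg_same_eq (by omega) (by omega)]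
    have hcoeff : ∀ S : Finset (Fin (2 ^ n)), V.card ≤ S.card → ‖meanZeroCoeff S X‖ ≤ r * 2 := by
      intro S hS
      rw [meanZeroCoeff, norm_mul, sum_mul_meanZeroProj]
      refine mul_le_mul (norm_inv_card_sub_one_le hk hS) ?_ (norm_nonneg _) hr0
      refine (norm_sub_le _ _).trans ?_
      have := norm_unitInd_form_le S S hX
      rw [star_unitInd]
      linarith [htr S]
    have m1 := mul_le_mul (hcoeff V le_rfl) (norm_meanZeroProj_form_le V f g) (norm_nonneg _)
      (by positivity)
    have m2 := mul_le_mul (hcoeff Vᶜ hk') (norm_meanZeroProj_form_le Vᶜ f g) (norm_nonneg _)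
      (by positivity)
    refine (norm_add_le _ _).trans ((add_le_add_right (norm_add_le _ _) _).trans ?_)
    rw [norm_mul, norm_mul]
    linarith
  · rw [blockAvg_cross_eq (by omega) (by omega) hz]
    have c1 := norm_meanZero_cross_le V hk le_rfl hX f g
    have c2 := norm_meanZero_cross_le Vᶜ hk hk' hX f g
    have e4 : 4 / ((V.card : ℝ) - 1) = 4 * r := by rw [hr]; ring
    rw [e4] at c1 c2
    refine (norm_add_le _ _).trans ((add_le_add_right (norm_add_le _ _) _).trans ?_)
    linarith

end BlockBounds

/-! ### Blocks of states, the dual oracle, and the weight along `devVec V` -/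

section States

variable {n w : ℕ}

/-- Labels of the blocks of a state: the sign and the workspace label. -/
abbrev BlockIdx (w : ℕ) : Type := ℤˣ × Fin (2 ^ w)

/-- The component of a state vector with a given sign and workspace label. -/
def block (ψ : StateIdx n w → ℂ) (j : BlockIdx w) : Fin (2 ^ n) → ℂ := fun x => ψ ((x, j.1), j.2)

/-- The block of a matrix with given signs and workspace labels. -/
def matBlock (A : Matrix (StateIdx n w) (StateIdx n w) ℂ) (i j : BlockIdx w) :
    Matrix (Fin (2 ^ n)) (Fin (2 ^ n)) ℂ :=
  Matrix.of fun x y => A ((x, i.1), i.2) ((y, j.1), j.2)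

lemma sum_stateIdx {M : Type*} [AddCommMonoid M] (F : StateIdx n w → M) :
    ∑ p, F p = ∑ j : BlockIdx w, ∑ x, F ((x, j.1), j.2) := by
  simp only [Fintype.sum_prod_type]
  rw [Finset.sum_comm]
  exact Finset.sum_congr rfl fun z _ => Finset.sum_comm

lemma l2_sq_eq_sum_block (ψ : StateIdx n w → ℂ) : l2 ψ ^ 2 = ∑ j, l2 (block ψ j) ^ 2 := by
  simp only [l2_sq, sum_stateIdx, block]

lemma dotProduct_eq_sum_block (φ ψ : StateIdx n w → ℂ) :
    φ ⬝ᵥ ψ = ∑ j, block φ j ⬝ᵥ block ψ j := by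
  simp only [dotProduct, sum_stateIdx, block]

lemma block_mulVec (A : Matrix (StateIdx n w) (StateIdx n w) ℂ) (ψ : StateIdx n w → ℂ)
    (i : BlockIdx w) : block (A *ᵥ ψ) i = ∑ j, matBlock A i j *ᵥ block ψ j := by
  ext x
  simp only [block, Matrix.mulVec, dotProduct, sum_stateIdx, Finset.sum_apply, matBlock,
    Matrix.of_apply]

lemma form_eq_sum_block (A : Matrix (StateIdx n w) (StateIdx n w) ℂ) (φ ψ : StateIdx n w → ℂ) :
    star φ ⬝ᵥ A *ᵥ ψ = ∑ i, ∑ j, star (block φ i) ⬝ᵥ matBlock A i j *ᵥ block ψ j := by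
  rw [dotProduct_eq_sum_block]
  refine Finset.sum_congr rfl fun i _ => ?_
  rw [block_mulVec, dotProduct_sum]
  rfl

/-- The vector with block `f` at `j` and all other blocks zero. -/
def embed (j : BlockIdx w) (f : Fin (2 ^ n) → ℂ) : StateIdx n w → ℂ :=
  fun p => if (p.1.2, p.2) = j then f p.1.1 else 0

lemma block_embed (i j : BlockIdx w) (f : Fin (2 ^ n) → ℂ) :
    block (embed j f) i = if i = j then f else 0 := by
  ext x
  by_cases h : i = j <;> simp [block, embed, h]

lemma l2_embed (j : BlockIdx w) (f : Fin (2 ^ n) → ℂ) : l2 (embed j f) = l2 f := by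
  rw [← sq_eq_sq₀ (l2_nonneg _) (l2_nonneg _), l2_sq_eq_sum_block, Finset.sum_eq_single j]
  · simp [block_embed]
  · intro i _ h
    simp [block_embed, h, l2]
  · simp

lemma star_embed (j : BlockIdx w) (f : Fin (2 ^ n) → ℂ) : star (embed j f) = embed j (star f) := by
  ext p
  by_cases h : (p.1.2, p.2) = j <;> simp [embed, h]

lemma form_embed (A : Matrix (StateIdx n w) (StateIdx n w) ℂ) (i j : BlockIdx w)
    (f g : Fin (2 ^ n) → ℂ) :
    star (embed i f) ⬝ᵥ A *ᵥ embed j g = star f ⬝ᵥ matBlock A i j *ᵥ g := by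
  rw [form_eq_sum_block, Finset.sum_eq_single i, Finset.sum_eq_single j]
  · simp [block_embed]
  · intro j' _ h; simp [block_embed, h]
  · simp
  · intro i' _ h; simp [block_embed, h]
  · simp

lemma Contraction.matBlock {A : Matrix (StateIdx n w) (StateIdx n w) ℂ} (hA : Contraction A)
    (i j : BlockIdx w) : Contraction (matBlock A i j) := by
  intro f g
  rw [← form_embed, ← l2_embed i f, ← l2_embed j g]
  exact hA _ _

lemma l2_block_le (ψ : StateIdx n w → ℂ) (j : BlockIdx w) : l2 (block ψ j) ≤ l2 ψ := by
  rw [← sq_le_sq₀ (l2_nonneg _) (l2_nonneg _), l2_sq_eq_sum_block]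
  exact Finset.single_le_sum (f := fun j => l2 (block ψ j) ^ 2) (fun _ _ => sq_nonneg _)
    (Finset.mem_univ j)

/-- The in-place oracle on the whole state space. -/
def fullOracle (w : ℕ) (π : Equiv.Perm (Fin (2 ^ n))) :
    Matrix (StateIdx n w) (StateIdx n w) ℂ :=
  inPlace π ⊗ₖ (1 : Matrix (Fin (2 ^ w)) (Fin (2 ^ w)) ℂ)

lemma block_fullOracle_mulVec (π : Equiv.Perm (Fin (2 ^ n))) (ψ : StateIdx n w → ℂ)
    (j : BlockIdx w) : block (fullOracle w π *ᵥ ψ) j = block ψ j ∘ ⇑(π ^ (-(j.1 : ℤ))) := by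
  ext x
  simp only [block, Matrix.mulVec, dotProduct, fullOracle, Matrix.kroneckerMap_apply, inPlace,
    Matrix.of_apply, Function.comp_apply]
  rw [Finset.sum_eq_single (((π ^ (-(j.1 : ℤ))) x, j.1), j.2)]
  · simp [zpow_neg]
  · rintro ⟨⟨y, z⟩, v⟩ _ h
    by_cases hv : j.2 = v
    · by_cases hz : j.1 = z
      · subst hv hz
        have : x ≠ (π ^ (j.1 : ℤ)) y := by
          rintro rfl
          apply h
          simp [zpow_neg]
        simp [this]
      · simp [hz]
    · simp [hv]
  · simp

lemma l2_fullOracle_mulVec (π : Equiv.Perm (Fin (2 ^ n))) (ψ : StateIdx n w → ℂ) :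
    l2 (fullOracle w π *ᵥ ψ) = l2 ψ := by
  rw [← sq_eq_sq₀ (l2_nonneg _) (l2_nonneg _), l2_sq_eq_sum_block, l2_sq_eq_sum_block]
  simp only [block_fullOracle_mulVec, l2_comp_equiv]

/-- The dual of the randomized oracle, acting on observables. -/
def dualOracle (F : Finset (Equiv.Perm (Fin (2 ^ n))))
    (A : Matrix (StateIdx n w) (StateIdx n w) ℂ) : Matrix (StateIdx n w) (StateIdx n w) ℂ :=
  (F.card : ℂ)⁻¹ • ∑ π ∈ F, (fullOracle w π)ᴴ * A * fullOracle w π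

lemma trace_mul_randomizedOracle (F : Finset (Equiv.Perm (Fin (2 ^ n))))
    (A ρ : Matrix (StateIdx n w) (StateIdx n w) ℂ) :
    (A * randomizedOracle F ρ).trace = (dualOracle F A * ρ).trace := by
  rw [randomizedOracle, dualOracle, Matrix.mul_smul, Matrix.smul_mul, Matrix.trace_smul,
    Matrix.trace_smul, Finset.mul_sum, Finset.sum_mul, Matrix.trace_sum, Matrix.trace_sum]
  congr 1
  refine Finset.sum_congr rfl fun π _ => ?_
  change (A * (fullOracle w π * ρ * (fullOracle w π)ᴴ)).trace = _
  rw [← Matrix.mul_assoc, Matrix.trace_mul_comm, ← Matrix.mul_assoc, ← Matrix.mul_assoc]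

lemma form_dualOracle (F : Finset (Equiv.Perm (Fin (2 ^ n))))
    (A : Matrix (StateIdx n w) (StateIdx n w) ℂ) (φ ψ : StateIdx n w → ℂ) :
    star φ ⬝ᵥ dualOracle F A *ᵥ ψ = (F.card : ℂ)⁻¹ * ∑ π ∈ F,
      star (fullOracle w π *ᵥ φ) ⬝ᵥ A *ᵥ (fullOracle w π *ᵥ ψ) := by
  rw [dualOracle, Matrix.smul_mulVec, dotProduct_smul, smul_eq_mul, Matrix.sum_mulVec,
    dotProduct_sum]
  congr 1
  refine Finset.sum_congr rfl fun π _ => ?_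
  rw [← Matrix.mulVec_mulVec, ← Matrix.mulVec_mulVec, Matrix.dotProduct_mulVec, Matrix.star_mulVec]

/-- A query mixes neither signs nor workspace labels, so it permutes each block separately and the
average splits into block averages. -/
lemma form_dualOracle_stabilizing (V : Finset (Fin (2 ^ n)))
    (A : Matrix (StateIdx n w) (StateIdx n w) ℂ) (φ ψ : StateIdx n w → ℂ) :
    star φ ⬝ᵥ dualOracle (stabilizing V) A *ᵥ ψ =
      ∑ i, ∑ j, blockAvg V i.1 j.1 (matBlock A i j) (block φ i) (block ψ j) := by
  rw [form_dualOracle]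
  simp only [form_eq_sum_block, block_fullOracle_mulVec, blockAvg]
  rw [Finset.sum_comm, Finset.mul_sum]
  refine Finset.sum_congr rfl fun i _ => ?_
  rw [Finset.sum_comm, Finset.mul_sum]

lemma norm_avg_le {α : Type*} (F : Finset α) (G : α → ℂ) {c : ℝ} (hc : 0 ≤ c)
    (h : ∀ π ∈ F, ‖G π‖ ≤ c) : ‖(F.card : ℂ)⁻¹ * ∑ π ∈ F, G π‖ ≤ c := by
  rw [norm_mul, norm_inv, Complex.norm_natCast]
  have := (norm_sum_le F G).trans (Finset.sum_le_sum h)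
  rw [Finset.sum_const, nsmul_eq_mul] at this
  calc _ ≤ (F.card : ℝ)⁻¹ * (F.card * c) := by gcongr
    _ = (F.card : ℝ)⁻¹ * F.card * c := by ring
    _ ≤ c := mul_le_of_le_one_left hc inv_mul_le_one

lemma Contraction.dualOracle {A : Matrix (StateIdx n w) (StateIdx n w) ℂ} (hA : Contraction A)
    (F : Finset (Equiv.Perm (Fin (2 ^ n)))) : Contraction (dualOracle F A) := by
  intro φ ψ
  rw [form_dualOracle]
  refine norm_avg_le _ _ (mul_nonneg (l2_nonneg _) (l2_nonneg _)) fun π _ => ?_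
  have := hA (fullOracle w π *ᵥ φ) (fullOracle w π *ᵥ ψ)
  rwa [l2_fullOracle_mulVec, l2_fullOracle_mulVec] at this

lemma form_conj {κ : Type*} [Fintype κ] (U A : Matrix κ κ ℂ) (φ ψ : κ → ℂ) :
    star φ ⬝ᵥ (Uᴴ * A * U) *ᵥ ψ = star (U *ᵥ φ) ⬝ᵥ A *ᵥ (U *ᵥ ψ) := by
  rw [← Matrix.mulVec_mulVec, ← Matrix.mulVec_mulVec, Matrix.dotProduct_mulVec, Matrix.star_mulVec]

lemma Contraction.conj_unitary {κ : Type*} [Fintype κ] [DecidableEq κ] {A : Matrix κ κ ℂ}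
    (hA : Contraction A) (U : Matrix.unitaryGroup κ ℂ) :
    Contraction ((U : Matrix κ κ ℂ)ᴴ * A * (U : Matrix κ κ ℂ)) := by
  intro φ ψ
  rw [form_conj, ← l2_mulVec_unitary U φ, ← l2_mulVec_unitary U ψ]
  exact hA _ _

lemma contraction_unitary {κ : Type*} [Fintype κ] [DecidableEq κ] (U : Matrix.unitaryGroup κ ℂ) :
    Contraction (U : Matrix κ κ ℂ) :=
  contraction_of_l2_mulVec_le fun g => (l2_mulVec_unitary U g).le

open scoped MatrixOrder Matrix.Norms.L2Operator in
/-- A positive semidefinite matrix is a mixture of (unnormalized) pure states. -/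
lemma exists_ensemble {κ : Type*} [Fintype κ] {ρ : Matrix κ κ ℂ} (hρ : ρ.PosSemidef) :
    ∃ r : κ → κ → ℂ, ∀ A : Matrix κ κ ℂ, (A * ρ).trace = ∑ c, star (r c) ⬝ᵥ A *ᵥ r c := by
  classical
  obtain ⟨B, rfl⟩ := CStarAlgebra.nonneg_iff_eq_star_mul_self.mp hρ.nonneg
  rw [Matrix.star_eq_conjTranspose]
  refine ⟨fun c => star (B c), fun A => ?_⟩
  rw [← Matrix.mul_assoc, Matrix.trace_mul_comm, ← Matrix.mul_assoc, Matrix.trace]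
  refine Finset.sum_congr rfl fun c _ => ?_
  rw [Matrix.diag_apply, star_star, Matrix.mul_apply, Matrix.dotProduct_mulVec, dotProduct]
  exact Finset.sum_congr rfl fun x _ => by rfl

lemma sum_l2_sq_ensemble {κ : Type*} [Fintype κ] [DecidableEq κ] {ρ : Matrix κ κ ℂ}
    {r : κ → κ → ℂ} (hr : ∀ A : Matrix κ κ ℂ, (A * ρ).trace = ∑ c, star (r c) ⬝ᵥ A *ᵥ r c) :
    ((∑ c, l2 (r c) ^ 2 : ℝ) : ℂ) = ρ.trace := by
  have := hr 1
  rw [Matrix.one_mul] at this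
  rw [this, Complex.ofReal_sum]
  simp only [l2_sq_eq_dotProduct, Matrix.one_mulVec]

/-- The weight of a state vector along `devVec V`. -/
def devWeight (V : Finset (Fin (2 ^ n))) (ψ : StateIdx n w → ℂ) : ℝ :=
  ∑ j, ‖devVec V ⬝ᵥ block ψ j‖ ^ 2

/-- The projection onto the states whose oracle register is in the state `devVec V`. -/
def devMat (w : ℕ) (V : Finset (Fin (2 ^ n))) : Matrix (StateIdx n w) (StateIdx n w) ℂ :=
  Matrix.of fun p q => if (p.1.2, p.2) = (q.1.2, q.2) then devVec V p.1.1 * devVec V q.1.1 else 0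

lemma matBlock_devMat (V : Finset (Fin (2 ^ n))) (i j : BlockIdx w) :
    matBlock (devMat w V) i j = if i = j then Matrix.vecMulVec (devVec V) (devVec V) else 0 := by
  ext x y
  by_cases h : i = j
  · simp [matBlock, devMat, h, Matrix.vecMulVec_apply]
  · have : ¬ (i.1 = j.1 ∧ i.2 = j.2) := fun h' => h (Prod.ext h'.1 h'.2)
    simp [matBlock, devMat, h, this]

lemma block_devMat_mulVec (V : Finset (Fin (2 ^ n))) (ψ : StateIdx n w → ℂ) (i : BlockIdx w) :
    block (devMat w V *ᵥ ψ) i = (devVec V ⬝ᵥ block ψ i) • devVec V := by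
  rw [block_mulVec, Finset.sum_eq_single i]
  · rw [matBlock_devMat, if_pos rfl, Matrix.vecMulVec_mulVec]
    simp
  · intro j _ h
    rw [matBlock_devMat, if_neg h.symm, Matrix.zero_mulVec]
  · simp

lemma star_devVec_dotProduct (V : Finset (Fin (2 ^ n))) (f : Fin (2 ^ n) → ℂ) :
    star (devVec V ⬝ᵥ f) = star f ⬝ᵥ devVec V := by
  rw [Matrix.star_dotProduct, star_devVec]

lemma form_devMat (V : Finset (Fin (2 ^ n))) (ψ : StateIdx n w → ℂ) :
    star ψ ⬝ᵥ devMat w V *ᵥ ψ = (devWeight V ψ : ℂ) := by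
  rw [dotProduct_eq_sum_block, devWeight, Complex.ofReal_sum]
  refine Finset.sum_congr rfl fun j _ => ?_
  rw [block_devMat_mulVec, dotProduct_smul, smul_eq_mul]
  have : block (star ψ) j = star (block ψ j) := rfl
  rw [this, ← star_devVec_dotProduct]
  simp [Complex.mul_conj']

lemma devWeight_le {V : Finset (Fin (2 ^ n))} (h0 : V.Nonempty) (h1 : Vᶜ.Nonempty)
    (ψ : StateIdx n w → ℂ) : devWeight V ψ ≤ l2 ψ ^ 2 := by
  rw [l2_sq_eq_sum_block]
  exact Finset.sum_le_sum fun j _ =>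
    pow_le_pow_left₀ (norm_nonneg _) (norm_devVec_dotProduct_le h0 h1 _) 2

lemma l2_devMat_mulVec_sq {V : Finset (Fin (2 ^ n))} (h0 : V.Nonempty) (h1 : Vᶜ.Nonempty)
    (ψ : StateIdx n w → ℂ) : l2 (devMat w V *ᵥ ψ) ^ 2 = devWeight V ψ := by
  rw [l2_sq_eq_sum_block]
  refine Finset.sum_congr rfl fun j _ => ?_
  rw [block_devMat_mulVec, l2_smul, l2_devVec h0 h1, mul_one]

lemma devVec_comp {V : Finset (Fin (2 ^ n))} {π : Equiv.Perm (Fin (2 ^ n))}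
    (hπ : π ∈ stabilizing V) : devVec V ∘ π = devVec V := by
  ext x
  simp only [Function.comp_apply, devVec, mem_stabilizing.mp hπ]

lemma zpow_units_mem_stabilizing {V : Finset (Fin (2 ^ n))} {π : Equiv.Perm (Fin (2 ^ n))}
    (hπ : π ∈ stabilizing V) (z : ℤˣ) : π ^ (-(z : ℤ)) ∈ stabilizing V := by
  rcases Int.units_eq_one_or z with rfl | rfl
  · simpa using inv_mem_stabilizing hπ
  · simpa using hπ

/-- Permutations in T_V and their inverses fix `devVec V`, so a query cannot change the overlaps
with it. -/
lemma devWeight_fullOracle {V : Finset (Fin (2 ^ n))} {π : Equiv.Perm (Fin (2 ^ n))}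
    (hπ : π ∈ stabilizing V) (ψ : StateIdx n w → ℂ) :
    devWeight V (fullOracle w π *ᵥ ψ) = devWeight V ψ := by
  refine Finset.sum_congr rfl fun j _ => ?_
  rw [block_fullOracle_mulVec]
  have hσ := zpow_units_mem_stabilizing hπ j.1
  set σ := π ^ (-(j.1 : ℤ))
  congr 2
  conv_lhs => rw [← devVec_comp hσ]
  simp only [dotProduct, Function.comp_apply]
  exact Equiv.sum_comp σ fun x => devVec V x * block ψ j x

end States

/-! ### The error of one query -/

section Dynamics

variable {n w : ℕ}

/-- The subset `V` does not correlate with the blocks of the observable `A`. -/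
structure GoodObservable (V : Finset (Fin (2 ^ n))) (η : ℝ)
    (A : Matrix (StateIdx n w) (StateIdx n w) ℂ) : Prop where
  diag : ∀ i j, ‖diagMean V (matBlock A i j) - diagMean Finset.univ (matBlock A i j)‖ ≤ η
  row : ∀ i j, ‖devVec V ⬝ᵥ matBlock A i j *ᵥ unitInd Finset.univ‖ ≤ η
  col : ∀ i j, ‖unitInd Finset.univ ⬝ᵥ matBlock A i j *ᵥ devVec V‖ ≤ η

/-- The matrix `U` maps uniform superpositions to vectors with little weight along `devVec V`. -/
def GoodGate (V : Finset (Fin (2 ^ n))) (η : ℝ)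
    (U : Matrix (StateIdx n w) (StateIdx n w) ℂ) : Prop :=
  ∀ i j, ‖devVec V ⬝ᵥ matBlock U i j *ᵥ unitInd Finset.univ‖ ≤ η

lemma sum_sum_mul_le {J : Type*} [Fintype J] (a : J → ℝ) :
    ∑ i, ∑ j, a i * a j ≤ Fintype.card J * ∑ i, a i ^ 2 := by
  rw [← Finset.sum_mul_sum, ← sq]
  exact sq_sum_le_card_mul_sum_sq

/-- The block bounds are summed over all pairs of blocks; by Cauchy–Schwarz this costs one factor
equal to the number of blocks. -/
lemma norm_form_dualOracle_sub_le {V : Finset (Fin (2 ^ n))} (hk : 2 ≤ V.card)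
    (hk' : V.card ≤ Vᶜ.card) {A : Matrix (StateIdx n w) (StateIdx n w) ℂ} (hA : Contraction A)
    {η : ℝ} (hη : 0 ≤ η) (hgood : GoodObservable V η A) (ψ : StateIdx n w → ℂ) :
    ‖star ψ ⬝ᵥ (dualOracle (stabilizing V) A - dualOracle Finset.univ A) *ᵥ ψ‖ ≤
      (6 * η + 16 / ((V.card : ℝ) - 1)) * (Fintype.card (BlockIdx w) * l2 ψ ^ 2) +
        4 * (Fintype.card (BlockIdx w) * devWeight V ψ) := by
  have hkR : (1 : ℝ) ≤ V.card - 1 := by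
    have : (2 : ℝ) ≤ V.card := by exact_mod_cast hk
    linarith
  rw [Matrix.sub_mulVec, dotProduct_sub, ← stabilizing_univ, form_dualOracle_stabilizing,
    form_dualOracle_stabilizing, ← Finset.sum_sub_distrib]
  simp only [← Finset.sum_sub_distrib]
  have h1 := sum_sum_mul_le fun i => l2 (block ψ i)
  have h2 := sum_sum_mul_le fun i => ‖devVec V ⬝ᵥ block ψ i‖
  rw [← l2_sq_eq_sum_block] at h1
  calc _ ≤ ∑ i, ∑ j, ((6 * η + 16 / ((V.card : ℝ) - 1)) * (l2 (block ψ i) * l2 (block ψ j)) +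
        4 * (‖devVec V ⬝ᵥ block ψ i‖ * ‖devVec V ⬝ᵥ block ψ j‖)) := by
        refine (norm_sum_le _ _).trans (Finset.sum_le_sum fun i _ => ?_)
        refine (norm_sum_le _ _).trans (Finset.sum_le_sum fun j _ => ?_)
        exact norm_blockAvg_sub_le hk hk' _ _ (hA.matBlock i j) (hgood.diag i j) (hgood.row i j)
          (hgood.col i j) _ _
    _ = (6 * η + 16 / ((V.card : ℝ) - 1)) * (∑ i, ∑ j, l2 (block ψ i) * l2 (block ψ j)) +
        4 * (∑ i, ∑ j, ‖devVec V ⬝ᵥ block ψ i‖ * ‖devVec V ⬝ᵥ block ψ j‖) := by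
        simp only [Finset.sum_add_distrib, Finset.mul_sum]
    _ ≤ _ := by
        refine add_le_add (mul_le_mul_of_nonneg_left h1 ?_) (mul_le_mul_of_nonneg_left h2 (by norm_num))
        have : 0 ≤ 16 / ((V.card : ℝ) - 1) := div_nonneg (by norm_num) (by linarith)
        linarith

/-- The weight of a mixed state along `devVec V`. -/
def devProb (V : Finset (Fin (2 ^ n))) (ρ : Matrix (StateIdx n w) (StateIdx n w) ℂ) : ℝ :=
  (devMat w V * ρ).trace.re

lemma devProb_eq_sum {V : Finset (Fin (2 ^ n))} {ρ : Matrix (StateIdx n w) (StateIdx n w) ℂ}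
    {r : StateIdx n w → StateIdx n w → ℂ}
    (hr : ∀ A : Matrix (StateIdx n w) (StateIdx n w) ℂ,
      (A * ρ).trace = ∑ c, star (r c) ⬝ᵥ A *ᵥ r c) :
    devProb V ρ = ∑ c, devWeight V (r c) := by
  rw [devProb, hr]
  simp only [form_devMat]
  rw [← Complex.ofReal_sum, Complex.ofReal_re]

lemma sum_l2_sq_ensemble_eq_one {κ : Type*} [Fintype κ] [DecidableEq κ] {ρ : Matrix κ κ ℂ}
    {r : κ → κ → ℂ} (hr : ∀ A : Matrix κ κ ℂ, (A * ρ).trace = ∑ c, star (r c) ⬝ᵥ A *ᵥ r c)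
    (h1 : ρ.trace = 1) : ∑ c, l2 (r c) ^ 2 = 1 := by
  have := sum_l2_sq_ensemble hr
  rw [h1] at this
  exact_mod_cast this

lemma norm_trace_dualOracle_sub_le {V : Finset (Fin (2 ^ n))} (hk : 2 ≤ V.card)
    (hk' : V.card ≤ Vᶜ.card) {A : Matrix (StateIdx n w) (StateIdx n w) ℂ} (hA : Contraction A)
    {η : ℝ} (hη : 0 ≤ η) (hgood : GoodObservable V η A)
    {ρ : Matrix (StateIdx n w) (StateIdx n w) ℂ} (hρ : ρ.PosSemidef) (htr : ρ.trace = 1) :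
    ‖(dualOracle (stabilizing V) A * ρ).trace - (dualOracle Finset.univ A * ρ).trace‖ ≤
      (6 * η + 16 / ((V.card : ℝ) - 1)) * Fintype.card (BlockIdx w) +
        4 * (Fintype.card (BlockIdx w) * devProb V ρ) := by
  obtain ⟨r, hr⟩ := exists_ensemble hρ
  have h1 := sum_l2_sq_ensemble_eq_one hr htr
  rw [← Matrix.trace_sub, ← Matrix.sub_mul, hr]
  refine (norm_sum_le _ _).trans ?_
  refine (Finset.sum_le_sum fun c _ =>
    norm_form_dualOracle_sub_le hk hk' hA hη hgood (r c)).trans ?_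
  rw [Finset.sum_add_distrib, ← Finset.mul_sum, ← Finset.mul_sum, ← Finset.mul_sum,
    ← Finset.mul_sum, h1, ← devProb_eq_sum hr, mul_one]

lemma fullOracle_form_one (F : Finset (Equiv.Perm (Fin (2 ^ n)))) (hF : F.Nonempty)
    (ψ : StateIdx n w → ℂ) :
    star ψ ⬝ᵥ dualOracle F (1 : Matrix (StateIdx n w) (StateIdx n w) ℂ) *ᵥ ψ =
      star ψ ⬝ᵥ (1 : Matrix (StateIdx n w) (StateIdx n w) ℂ) *ᵥ ψ := by
  have hc : (F.card : ℂ) ≠ 0 := by rw [Nat.cast_ne_zero]; exact hF.card_pos.ne'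
  rw [form_dualOracle]
  simp only [Matrix.one_mulVec, ← l2_sq_eq_dotProduct, l2_fullOracle_mulVec, Finset.sum_const,
    nsmul_eq_mul]
  rw [inv_mul_cancel_left₀ hc]

lemma trace_randomizedOracle {F : Finset (Equiv.Perm (Fin (2 ^ n)))} (hF : F.Nonempty)
    {ρ : Matrix (StateIdx n w) (StateIdx n w) ℂ} (hρ : ρ.PosSemidef) :
    (randomizedOracle F ρ).trace = ρ.trace := by
  obtain ⟨r, hr⟩ := exists_ensemble hρ
  have h1 := trace_mul_randomizedOracle F 1 ρ
  rw [hr, Matrix.one_mul] at h1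
  simp only [fullOracle_form_one F hF] at h1
  rw [h1, ← hr, Matrix.one_mul]

lemma posSemidef_randomizedOracle (F : Finset (Equiv.Perm (Fin (2 ^ n))))
    {ρ : Matrix (StateIdx n w) (StateIdx n w) ℂ} (hρ : ρ.PosSemidef) :
    (randomizedOracle F ρ).PosSemidef := by
  rw [randomizedOracle]
  have hs : (∑ π ∈ F, (inPlace π ⊗ₖ (1 : Matrix (Fin (2 ^ w)) (Fin (2 ^ w)) ℂ)) * ρ *
      (inPlace π ⊗ₖ (1 : Matrix (Fin (2 ^ w)) (Fin (2 ^ w)) ℂ))ᴴ).PosSemidef :=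
    Matrix.posSemidef_sum _ fun π _ => hρ.mul_mul_conjTranspose_same _
  exact hs.smul (by rw [← Complex.ofReal_natCast, ← Complex.ofReal_inv]; exact_mod_cast inv_nonneg.mpr (Nat.cast_nonneg _))

lemma trace_conj_unitary {κ : Type*} [Fintype κ] [DecidableEq κ] (U : Matrix.unitaryGroup κ ℂ)
    (ρ : Matrix κ κ ℂ) : ((U : Matrix κ κ ℂ) * ρ * (U : Matrix κ κ ℂ)ᴴ).trace = ρ.trace := by
  have : (U : Matrix κ κ ℂ)ᴴ * U = 1 := Matrix.mem_unitaryGroup_iff'.mp U.2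
  rw [Matrix.trace_mul_comm, ← Matrix.mul_assoc, this, Matrix.one_mul]

lemma trace_mul_conj {κ : Type*} [Fintype κ] (A U ρ : Matrix κ κ ℂ) :
    (A * (U * ρ * Uᴴ)).trace = (Uᴴ * A * U * ρ).trace := by
  rw [← Matrix.mul_assoc, Matrix.trace_mul_comm, ← Matrix.mul_assoc, ← Matrix.mul_assoc]

/-- After an oracle query, a vector orthogonal to `devVec V` and almost orthogonal to the uniform
vector is observed with small probability. -/
lemma avg_norm_dotProduct_sq_le {V : Finset (Fin (2 ^ n))} (hk : 2 ≤ V.card)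
    (hk' : V.card ≤ Vᶜ.card) {b : StateIdx n w → ℂ} (hb : l2 b ≤ 1) {η : ℝ}
    (hdev : ∀ j, devVec V ⬝ᵥ block b j = 0)
    (hunif : ∀ j, ‖unitInd Finset.univ ⬝ᵥ block b j‖ ≤ η) (ψ : StateIdx n w → ℂ) :
    ((stabilizing V).card : ℝ)⁻¹ * ∑ π ∈ stabilizing V, ‖star b ⬝ᵥ fullOracle w π *ᵥ ψ‖ ^ 2 ≤
      (η + 8 / ((V.card : ℝ) - 1)) * (Fintype.card (BlockIdx w) * l2 ψ ^ 2) := by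
  have hkR : (1 : ℝ) ≤ V.card - 1 := by
    have : (2 : ℝ) ≤ V.card := by exact_mod_cast hk
    linarith
  have hη : 0 ≤ η := (norm_nonneg _).trans (hunif (1, 0))
  have hb' : ∀ j, l2 (block b j) ≤ 1 := fun j => (l2_block_le b j).trans hb
  -- The average is the expectation of the rank-one observable b b† after a query, so the block
  -- bounds apply.
  have e : (((stabilizing V).card : ℝ)⁻¹ * ∑ π ∈ stabilizing V,
      ‖star b ⬝ᵥ fullOracle w π *ᵥ ψ‖ ^ 2 : ℝ) =
      ‖star ψ ⬝ᵥ dualOracle (stabilizing V) (Matrix.vecMulVec b (star b)) *ᵥ ψ‖ := by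
    rw [form_dualOracle]
    have : ∀ φ : StateIdx n w → ℂ, star φ ⬝ᵥ Matrix.vecMulVec b (star b) *ᵥ φ =
        ((‖star b ⬝ᵥ φ‖ ^ 2 : ℝ) : ℂ) := by
      intro φ
      rw [Matrix.vecMulVec_mulVec]
      have h : star φ ⬝ᵥ b = star (star b ⬝ᵥ φ) := by rw [Matrix.star_dotProduct]
      simp only [dotProduct_smul, h]
      simp [Complex.conj_mul']
    simp only [this]
    rw [← Complex.ofReal_sum, ← Complex.ofReal_natCast, ← Complex.ofReal_inv, ← Complex.ofReal_mul,
      Complex.norm_real, Real.norm_of_nonneg (by positivity)]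
  rw [e, form_dualOracle_stabilizing]
  have h1 := sum_sum_mul_le fun i => l2 (block ψ i)
  rw [← l2_sq_eq_sum_block] at h1
  calc _ ≤ ∑ i, ∑ j, (η + 8 / ((V.card : ℝ) - 1)) * (l2 (block ψ i) * l2 (block ψ j)) := by
        refine (norm_sum_le _ _).trans (Finset.sum_le_sum fun i _ => ?_)
        refine (norm_sum_le _ _).trans (Finset.sum_le_sum fun j _ => ?_)
        have eX : matBlock (Matrix.vecMulVec b (star b)) i j =
            Matrix.vecMulVec (block b i) (star (block b j)) := by
          ext x y; rfl
        have hform : ∀ f g : Fin (2 ^ n) → ℂ,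
            f ⬝ᵥ Matrix.vecMulVec (block b i) (star (block b j)) *ᵥ g =
              (f ⬝ᵥ block b i) * (star (block b j) ⬝ᵥ g) := by
          intro f g
          rw [Matrix.vecMulVec_mulVec]
          simp [mul_comm]
        rw [eX]
        refine norm_blockAvg_le_of_mulVec_devVec_eq_zero hk hk' _ _ ?_ ?_ ?_ ?_ ?_ _ _
        · intro f g
          rw [hform, norm_mul]
          have m1 := norm_dotProduct_le f (block b i)
          have m2 := norm_dotProduct_le (block b j) g
          refine mul_le_mul (m1.trans (mul_le_of_le_one_right (l2_nonneg f) (hb' i)))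
            (m2.trans (mul_le_of_le_one_left (l2_nonneg g) (hb' j))) (norm_nonneg _) (l2_nonneg f)
        · rw [Matrix.vecMul_vecMulVec, hdev, zero_smul]
        · rw [Matrix.vecMulVec_mulVec, ← star_devVec_dotProduct, hdev]
          simp
        · rw [hform, norm_mul]
          refine (mul_le_of_le_one_right (norm_nonneg _) ?_).trans (hunif i)
          refine (norm_dotProduct_le _ _).trans ?_
          exact mul_le_one₀ (hb' j) (l2_nonneg _) (l2_unitInd_le _)
        · intro S
          -- A partial trace of a rank-one block is an inner product of one vector with a
          -- restriction of the other, hence at most 1 however large S is.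
          have : ∑ a ∈ S, Matrix.vecMulVec (block b i) (star (block b j)) a a =
              star (block b j) ⬝ᵥ fun a => if a ∈ S then block b i a else 0 := by
            simp [dotProduct, Matrix.vecMulVec_apply, mul_comm]
          rw [this]
          refine (norm_dotProduct_le _ _).trans (mul_le_one₀ (hb' j) (l2_nonneg _) ?_)
          exact (l2_le_of_norm_le fun a => by by_cases h : a ∈ S <;> simp [h]).trans (hb' i)
    _ = (η + 8 / ((V.card : ℝ) - 1)) * ∑ i, ∑ j, l2 (block ψ i) * l2 (block ψ j) := by
        simp only [Finset.mul_sum]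
    _ ≤ _ := by
        refine mul_le_mul_of_nonneg_left h1 ?_
        have : 0 ≤ 8 / ((V.card : ℝ) - 1) := div_nonneg (by norm_num) (by linarith)
        linarith

end Dynamics

/-! ### Growth of the deviation weight and the hybrid argument -/

section Hybrid

variable {n w : ℕ}

lemma norm_add_sq_le_weighted {E : Type*} [SeminormedAddCommGroup E] (a b : E) {s : ℝ}
    (hs : 0 < s) : ‖a + b‖ ^ 2 ≤ (1 + 1 / s) * ‖a‖ ^ 2 + (1 + s) * ‖b‖ ^ 2 := by
  have h1 : ‖a + b‖ ^ 2 ≤ (‖a‖ + ‖b‖) ^ 2 := pow_le_pow_left₀ (norm_nonneg _) (norm_add_le a b) 2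
  have h2 : (1 + 1 / s) * ‖a‖ ^ 2 + (1 + s) * ‖b‖ ^ 2 - (‖a‖ + ‖b‖) ^ 2 =
      (‖a‖ - s * ‖b‖) ^ 2 / s := by
    field_simp
    ring
  have h3 : 0 ≤ (‖a‖ - s * ‖b‖) ^ 2 / s := by positivity
  linarith

lemma conjTranspose_devMat (V : Finset (Fin (2 ^ n))) : (devMat w V)ᴴ = devMat w V := by
  have hu : ∀ x, star (devVec V x) = devVec V x := fun x => congrFun (star_devVec V) x
  ext p q
  simp only [Matrix.conjTranspose_apply, devMat, Matrix.of_apply]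
  by_cases h : (p.1.2, p.2) = (q.1.2, q.2)
  · rw [if_pos h, if_pos h.symm, star_mul', hu, hu, mul_comm]
  · rw [if_neg h, if_neg (Ne.symm h), star_zero]

/-- Split χ into its part along u and the rest. The gate preserves the norm of the first part, whose
square is the old weight; the parameter s balances the two contributions in the squared sum. -/
lemma devWeight_conj_le {V : Finset (Fin (2 ^ n))} (h0 : V.Nonempty) (h1 : Vᶜ.Nonempty)
    (U : Matrix.unitaryGroup (StateIdx n w) ℂ) (χ : StateIdx n w → ℂ) {s : ℝ} (hs : 0 < s) :
    devWeight V ((U : Matrix (StateIdx n w) (StateIdx n w) ℂ) *ᵥ χ) ≤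
      (1 + 1 / s) * devWeight V χ + (1 + s) * devWeight V
        ((U : Matrix (StateIdx n w) (StateIdx n w) ℂ) *ᵥ (χ - devMat w V *ᵥ χ)) := by
  set U' := (U : Matrix (StateIdx n w) (StateIdx n w) ℂ)
  have e : U' *ᵥ χ = U' *ᵥ (devMat w V *ᵥ χ) + U' *ᵥ (χ - devMat w V *ᵥ χ) := by
    rw [← Matrix.mulVec_add, add_sub_cancel]
  have h2 : devWeight V (U' *ᵥ (devMat w V *ᵥ χ)) ≤ devWeight V χ := by
    refine (devWeight_le h0 h1 _).trans ?_
    rw [l2_mulVec_unitary, l2_devMat_mulVec_sq h0 h1]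
  have h3 : devWeight V (U' *ᵥ χ) ≤ (1 + 1 / s) * devWeight V (U' *ᵥ (devMat w V *ᵥ χ)) +
      (1 + s) * devWeight V (U' *ᵥ (χ - devMat w V *ᵥ χ)) := by
    conv_lhs => rw [e]
    simp only [devWeight, Finset.mul_sum]
    rw [← Finset.sum_add_distrib]
    refine Finset.sum_le_sum fun j _ => ?_
    have : ∀ φ ξ : StateIdx n w → ℂ, devVec V ⬝ᵥ block (φ + ξ) j =
        devVec V ⬝ᵥ block φ j + devVec V ⬝ᵥ block ξ j := fun φ ξ => by
      rw [← dotProduct_add]; rfl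
    rw [this]
    exact norm_add_sq_le_weighted _ _ hs
  have : 0 < 1 + 1 / s := by positivity
  exact h3.trans (add_le_add_left (mul_le_mul_of_nonneg_left h2 this.le) _)

/-- The component of `Uᴴ (devVec V ⊗ eᵢ)` orthogonal to the vectors along `devVec V`. -/
def pulledBack (V : Finset (Fin (2 ^ n))) (U : Matrix (StateIdx n w) (StateIdx n w) ℂ)
    (i : BlockIdx w) : StateIdx n w → ℂ :=
  Uᴴ *ᵥ embed i (devVec V) - devMat w V *ᵥ (Uᴴ *ᵥ embed i (devVec V))

lemma devVec_dotProduct_block_mulVec (V : Finset (Fin (2 ^ n)))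
    (U : Matrix (StateIdx n w) (StateIdx n w) ℂ) (i : BlockIdx w) (χ : StateIdx n w → ℂ) :
    devVec V ⬝ᵥ block (U *ᵥ (χ - devMat w V *ᵥ χ)) i = star (pulledBack V U i) ⬝ᵥ χ := by
  have e1 : ∀ ξ : StateIdx n w → ℂ, devVec V ⬝ᵥ block ξ i =
      star (embed i (devVec V)) ⬝ᵥ ξ := by
    intro ξ
    rw [star_embed, star_devVec, dotProduct_eq_sum_block, Finset.sum_eq_single i]
    · simp [block_embed]
    · intro j _ h; simp [block_embed, h]
    · simp
  rw [e1, pulledBack, star_sub, sub_dotProduct, Matrix.star_mulVec, Matrix.star_mulVec,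
    conjTranspose_devMat, ← Matrix.dotProduct_mulVec, ← Matrix.dotProduct_mulVec,
    Matrix.star_mulVec, ← Matrix.dotProduct_mulVec, Matrix.conjTranspose_conjTranspose,
    Matrix.mulVec_sub, dotProduct_sub]

lemma devVec_dotProduct_block_pulledBack {V : Finset (Fin (2 ^ n))} (h0 : V.Nonempty)
    (h1 : Vᶜ.Nonempty) (U : Matrix (StateIdx n w) (StateIdx n w) ℂ) (i j : BlockIdx w) :
    devVec V ⬝ᵥ block (pulledBack V U i) j = 0 := by
  have e : ∀ c : StateIdx n w → ℂ, block (c - devMat w V *ᵥ c) j =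
      block c j - (devVec V ⬝ᵥ block c j) • devVec V := by
    intro c
    rw [← block_devMat_mulVec]; rfl
  have hu : devVec V ⬝ᵥ devVec V = 1 := by
    have := l2_sq_eq_dotProduct (devVec V)
    rw [star_devVec, l2_devVec h0 h1] at this
    simpa using this.symm
  rw [pulledBack, e, dotProduct_sub, dotProduct_smul, hu]
  simp

/-- The vector is the orthogonal projection of c, of norm at most 1, so its squared norm equals its
inner product with c. -/
lemma l2_pulledBack_le {V : Finset (Fin (2 ^ n))} (h0 : V.Nonempty) (h1 : Vᶜ.Nonempty)
    (U : Matrix.unitaryGroup (StateIdx n w) ℂ) (i : BlockIdx w) :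
    l2 (pulledBack V (U : Matrix (StateIdx n w) (StateIdx n w) ℂ) i) ≤ 1 := by
  set b := pulledBack V (U : Matrix (StateIdx n w) (StateIdx n w) ℂ) i with hb
  set c := (U : Matrix (StateIdx n w) (StateIdx n w) ℂ)ᴴ *ᵥ embed i (devVec V) with hc
  have hcl : l2 c ≤ 1 := by
    have := (contraction_unitary U).conjTranspose.l2_mulVec_le (embed i (devVec V))
    rwa [l2_embed, l2_devVec h0 h1] at this
  have h2 : star b ⬝ᵥ devMat w V *ᵥ c = 0 := by
    rw [dotProduct_eq_sum_block]
    refine Finset.sum_eq_zero fun j _ => ?_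
    rw [block_devMat_mulVec, dotProduct_smul]
    have : block (star b) j = star (block b j) := rfl
    rw [this, ← star_devVec_dotProduct, hb, devVec_dotProduct_block_pulledBack h0 h1]
    simp
  have h3 : ((l2 b ^ 2 : ℝ) : ℂ) = star b ⬝ᵥ c := by
    rw [l2_sq_eq_dotProduct]
    conv_lhs => rw [hb]
    rw [← hb]
    have : b = c - devMat w V *ᵥ c := rfl
    calc star b ⬝ᵥ b = star b ⬝ᵥ (c - devMat w V *ᵥ c) := by rw [← this]
      _ = star b ⬝ᵥ c := by rw [dotProduct_sub, h2, sub_zero]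
  have h4 := norm_dotProduct_le b c
  rw [← h3, Complex.norm_real, Real.norm_of_nonneg (sq_nonneg _), sq] at h4
  rcases (l2_nonneg b).eq_or_lt with h | h
  · rw [← h]; exact zero_le_one
  · exact (le_of_mul_le_mul_left h4 h).trans hcl

/-- Removing the part along u does not affect the overlap with the uniform vector. What remains is
the conjugate of a gate entry controlled by `GoodGate`. -/
lemma norm_unitInd_dotProduct_block_pulledBack_le {V : Finset (Fin (2 ^ n))}
    {U : Matrix (StateIdx n w) (StateIdx n w) ℂ} {η : ℝ} (hU : GoodGate V η U)
    (i j : BlockIdx w) :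
    ‖unitInd Finset.univ ⬝ᵥ block (pulledBack V U i) j‖ ≤ η := by
  have e : ∀ c : StateIdx n w → ℂ, block (c - devMat w V *ᵥ c) j =
      block c j - (devVec V ⬝ᵥ block c j) • devVec V := by
    intro c
    rw [← block_devMat_mulVec]; rfl
  have e2 : unitInd Finset.univ ⬝ᵥ block (pulledBack V U i) j =
      star (embed j (unitInd Finset.univ)) ⬝ᵥ Uᴴ *ᵥ embed i (devVec V) := by
    rw [pulledBack, e, dotProduct_sub, dotProduct_smul, dotProduct_comm _ (devVec V),
      devVec_dotProduct_unitInd_univ, smul_zero, sub_zero, star_embed, star_unitInd,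
      dotProduct_eq_sum_block, Finset.sum_eq_single j]
    · simp [block_embed]
    · intro j' _ h; simp [block_embed, h]
    · simp
  rw [e2, star_dotProduct_mulVec, norm_star, Matrix.conjTranspose_conjTranspose, form_embed,
    star_devVec]
  exact hU i j

/-- The bound for the weight along `devVec V` that one gate and query can create. -/
def leak (w k : ℕ) (η : ℝ) : ℝ :=
  Fintype.card (BlockIdx w) * ((η + 8 / ((k : ℝ) - 1)) * Fintype.card (BlockIdx w))

lemma leak_nonneg (w : ℕ) {k : ℕ} (hk : 2 ≤ k) {η : ℝ} (hη : 0 ≤ η) : 0 ≤ leak w k η := by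
  have : (2 : ℝ) ≤ k := by exact_mod_cast hk
  have : 0 ≤ 8 / ((k : ℝ) - 1) := div_nonneg (by norm_num) (by linarith)
  rw [leak]
  positivity

/-- The query preserves the old weight along u. New weight can enter only by overlap of the queried
state with the vectors `pulledBack`, one for each block, and each overlap is small on average over
T_V. -/
lemma avg_devWeight_le {V : Finset (Fin (2 ^ n))} (hk : 2 ≤ V.card) (hk' : V.card ≤ Vᶜ.card)
    {U : Matrix.unitaryGroup (StateIdx n w) ℂ} {η : ℝ}
    (hU : GoodGate V η (U : Matrix (StateIdx n w) (StateIdx n w) ℂ)) {s : ℝ} (hs : 0 < s)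
    (ψ : StateIdx n w → ℂ) :
    ((stabilizing V).card : ℝ)⁻¹ * ∑ π ∈ stabilizing V,
        devWeight V ((U : Matrix (StateIdx n w) (StateIdx n w) ℂ) *ᵥ (fullOracle w π *ᵥ ψ)) ≤
      (1 + 1 / s) * devWeight V ψ + (1 + s) * (leak w V.card η * l2 ψ ^ 2) := by
  have h0 : V.Nonempty := Finset.card_pos.mp (by omega)
  have h1 : Vᶜ.Nonempty := Finset.card_pos.mp (by omega)
  set U' := (U : Matrix (StateIdx n w) (StateIdx n w) ℂ)
  have hc : ((stabilizing V).card : ℝ) ≠ 0 := by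
    rw [Nat.cast_ne_zero]
    exact Finset.card_ne_zero_of_mem (one_mem_stabilizing V)
  calc _ ≤ ((stabilizing V).card : ℝ)⁻¹ * ∑ π ∈ stabilizing V,
        ((1 + 1 / s) * devWeight V ψ + (1 + s) * ∑ i,
          ‖star (pulledBack V U' i) ⬝ᵥ fullOracle w π *ᵥ ψ‖ ^ 2) := by
        gcongr with π hπ
        refine (devWeight_conj_le h0 h1 U _ hs).trans ?_
        rw [devWeight_fullOracle hπ]
        simp only [devWeight, devVec_dotProduct_block_mulVec]
        exact le_rfl
    _ = (1 + 1 / s) * devWeight V ψ + (1 + s) * ∑ i, (((stabilizing V).card : ℝ)⁻¹ *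
          ∑ π ∈ stabilizing V, ‖star (pulledBack V U' i) ⬝ᵥ fullOracle w π *ᵥ ψ‖ ^ 2) := by
        rw [Finset.sum_add_distrib, Finset.sum_const, nsmul_eq_mul, mul_add, inv_mul_cancel_left₀ hc,
          ← Finset.mul_sum, ← Finset.mul_sum, Finset.sum_comm]
        ring
    _ ≤ (1 + 1 / s) * devWeight V ψ + (1 + s) * ∑ _i : BlockIdx w,
          (η + 8 / ((V.card : ℝ) - 1)) * (Fintype.card (BlockIdx w) * l2 ψ ^ 2) := by
        refine add_le_add_right (mul_le_mul_of_nonneg_left (Finset.sum_le_sum fun i _ => ?_)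
          (by positivity)) _
        exact avg_norm_dotProduct_sq_le hk hk' (l2_pulledBack_le h0 h1 U i)
          (devVec_dotProduct_block_pulledBack h0 h1 U' i)
          (norm_unitInd_dotProduct_block_pulledBack_le hU i) ψ
    _ = _ := by
        rw [Finset.sum_const, nsmul_eq_mul, Finset.card_univ, leak]
        ring

lemma devProb_step_le {V : Finset (Fin (2 ^ n))} (hk : 2 ≤ V.card) (hk' : V.card ≤ Vᶜ.card)
    {U : Matrix.unitaryGroup (StateIdx n w) ℂ} {η : ℝ}
    (hU : GoodGate V η (U : Matrix (StateIdx n w) (StateIdx n w) ℂ)) {s : ℝ} (hs : 0 < s)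
    {ρ : Matrix (StateIdx n w) (StateIdx n w) ℂ} (hρ : ρ.PosSemidef) (htr : ρ.trace = 1) :
    devProb V ((U : Matrix (StateIdx n w) (StateIdx n w) ℂ) * randomizedOracle (stabilizing V) ρ *
        (U : Matrix (StateIdx n w) (StateIdx n w) ℂ)ᴴ) ≤
      (1 + 1 / s) * devProb V ρ + (1 + s) * leak w V.card η := by
  obtain ⟨r, hr⟩ := exists_ensemble hρ
  have h1 := sum_l2_sq_ensemble_eq_one hr htr
  have e : ∀ ψ : StateIdx n w → ℂ, (star ψ ⬝ᵥ dualOracle (stabilizing V)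
      ((U : Matrix (StateIdx n w) (StateIdx n w) ℂ)ᴴ * devMat w V *
        (U : Matrix (StateIdx n w) (StateIdx n w) ℂ)) *ᵥ ψ).re =
      ((stabilizing V).card : ℝ)⁻¹ * ∑ π ∈ stabilizing V,
        devWeight V ((U : Matrix (StateIdx n w) (StateIdx n w) ℂ) *ᵥ (fullOracle w π *ᵥ ψ)) := by
    intro ψ
    rw [form_dualOracle]
    simp only [form_conj, form_devMat]
    rw [← Complex.ofReal_sum, ← Complex.ofReal_natCast, ← Complex.ofReal_inv, ← Complex.ofReal_mul,
      Complex.ofReal_re]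
  rw [devProb, trace_mul_conj, trace_mul_randomizedOracle, hr, Complex.re_sum]
  simp only [e]
  refine (Finset.sum_le_sum fun c _ => avg_devWeight_le hk hk' hU hs (r c)).trans ?_
  rw [Finset.sum_add_distrib, ← Finset.mul_sum, ← Finset.mul_sum, ← Finset.mul_sum, h1,
    ← devProb_eq_sum hr, mul_one]

/-- One step of a query algorithm: a unitary followed by an oracle query. -/
def stepState (F : Finset (Equiv.Perm (Fin (2 ^ n))))
    (ρ : Matrix (StateIdx n w) (StateIdx n w) ℂ) (U : Matrix.unitaryGroup (StateIdx n w) ℂ) :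
    Matrix (StateIdx n w) (StateIdx n w) ℂ :=
  randomizedOracle F ((U : Matrix (StateIdx n w) (StateIdx n w) ℂ) * ρ *
    (U : Matrix (StateIdx n w) (StateIdx n w) ℂ)ᴴ)

/-- The observable `E` evolved backwards through the steps of an algorithm that is given the
oracle presenting all permutations. -/
def backward (E : Matrix (StateIdx n w) (StateIdx n w) ℂ)
    (l : List (Matrix.unitaryGroup (StateIdx n w) ℂ)) : Matrix (StateIdx n w) (StateIdx n w) ℂ :=
  l.foldr (fun U A => (U : Matrix (StateIdx n w) (StateIdx n w) ℂ)ᴴ *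
    dualOracle Finset.univ A * (U : Matrix (StateIdx n w) (StateIdx n w) ℂ)) E

lemma contraction_backward {E : Matrix (StateIdx n w) (StateIdx n w) ℂ} (hE : Contraction E)
    (l : List (Matrix.unitaryGroup (StateIdx n w) ℂ)) : Contraction (backward E l) := by
  induction l with
  | nil => exact hE
  | cons U l ih => exact (ih.dualOracle _).conj_unitary U

lemma trace_mul_foldl_stepState (E : Matrix (StateIdx n w) (StateIdx n w) ℂ)
    (l : List (Matrix.unitaryGroup (StateIdx n w) ℂ))
    (ρ : Matrix (StateIdx n w) (StateIdx n w) ℂ) :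
    (E * l.foldl (stepState Finset.univ) ρ).trace = (backward E l * ρ).trace := by
  induction l generalizing ρ with
  | nil => rfl
  | cons U l ih =>
    rw [List.foldl_cons, ih, stepState, trace_mul_randomizedOracle, trace_mul_conj]
    rfl

/-- The error made in one query when the oracle presents `T_V` instead of all permutations. -/
def queryError (w k : ℕ) (η p : ℝ) : ℝ :=
  (6 * η + 16 / ((k : ℝ) - 1)) * Fintype.card (BlockIdx w) + 4 * (Fintype.card (BlockIdx w) * p)

lemma queryError_mono (w k : ℕ) (η : ℝ) {p q : ℝ} (h : p ≤ q) :
    queryError w k η p ≤ queryError w k η q := by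
  unfold queryError; gcongr

/-- The state ρ is the one just before a query, so `length + 1` queries remain. The number s tracks
the step: the weight along u is at most s² times `leak`, a bound that reproduces itself with s + 1.
-/
lemma norm_trace_foldl_sub_le {V : Finset (Fin (2 ^ n))} (hk : 2 ≤ V.card)
    (hk' : V.card ≤ Vᶜ.card) {E : Matrix (StateIdx n w) (StateIdx n w) ℂ} (hE : Contraction E)
    {η : ℝ} (hη : 0 ≤ η) (l : List (Matrix.unitaryGroup (StateIdx n w) ℂ))
    (hU : ∀ U ∈ l, GoodGate V η (U : Matrix (StateIdx n w) (StateIdx n w) ℂ))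
    (hA : ∀ l', l' <:+ l → GoodObservable V η (backward E l')) (s : ℕ) (hs : 1 ≤ s)
    {ρ : Matrix (StateIdx n w) (StateIdx n w) ℂ} (hρ : ρ.PosSemidef) (htr : ρ.trace = 1)
    (hdev : devProb V ρ ≤ (s : ℝ) ^ 2 * leak w V.card η) :
    ‖(E * l.foldl (stepState (stabilizing V)) (randomizedOracle (stabilizing V) ρ)).trace -
        (E * l.foldl (stepState Finset.univ) (randomizedOracle Finset.univ ρ)).trace‖ ≤
      (l.length + 1) *
        queryError w V.card η (((s + l.length : ℕ) : ℝ) ^ 2 * leak w V.card η) := by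
  have hleak := leak_nonneg w hk hη
  induction l generalizing s ρ with
  | nil =>
    rw [List.foldl_nil, List.foldl_nil, trace_mul_randomizedOracle, trace_mul_randomizedOracle]
    refine (norm_trace_dualOracle_sub_le hk hk' hE hη (hA [] (List.suffix_refl _)) hρ htr).trans ?_
    simp only [List.length_nil, Nat.cast_zero, zero_add, one_mul, add_zero]
    exact queryError_mono w _ η hdev
  | cons U l ih =>
    set σ := (U : Matrix (StateIdx n w) (StateIdx n w) ℂ) *
      randomizedOracle (stabilizing V) ρ * (U : Matrix (StateIdx n w) (StateIdx n w) ℂ)ᴴ with hσ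
    have hσ0 : σ.PosSemidef :=
      (posSemidef_randomizedOracle _ hρ).mul_mul_conjTranspose_same _
    have hσ1 : σ.trace = 1 := by
      rw [hσ, trace_conj_unitary, trace_randomizedOracle ⟨1, one_mem_stabilizing V⟩ hρ, htr]
    have hs0 : (0 : ℝ) < s := by exact_mod_cast hs
    have hσd : devProb V σ ≤ ((s + 1 : ℕ) : ℝ) ^ 2 * leak w V.card η := by
      refine (devProb_step_le hk hk' (hU U List.mem_cons_self) hs0 hρ htr).trans ?_
      -- Using the step index as the weight parameter keeps growth quadratic: (1 + 1/s) s² + (1 + s)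
      -- = (s + 1)².
      have : (1 + 1 / (s : ℝ)) * devProb V ρ ≤
          (1 + 1 / (s : ℝ)) * ((s : ℝ) ^ 2 * leak w V.card η) :=
        mul_le_mul_of_nonneg_left hdev (by positivity)
      refine (add_le_add_left this _).trans (le_of_eq ?_)
      push_cast
      field_simp
      ring
    have hrec := ih (fun U' h => hU U' (List.mem_cons_of_mem _ h))
      (fun l' h => hA l' (h.trans (List.suffix_cons _ _))) (s + 1) (by omega) hσ0 hσ1 hσd
    have hstep := norm_trace_dualOracle_sub_le hk hk'
      (contraction_backward hE (U :: l)) hη (hA _ (List.suffix_refl _)) hρ htr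
    -- The intermediate run makes its first query to T_V and all later ones to all permutations. The
    -- induction hypothesis compares it with the T_V run, `hstep` with the other.
    have e1 : (E * l.foldl (stepState Finset.univ) (randomizedOracle Finset.univ σ)).trace =
        (dualOracle (stabilizing V) (backward E (U :: l)) * ρ).trace := by
      rw [trace_mul_foldl_stepState, trace_mul_randomizedOracle, hσ, trace_mul_conj,
        trace_mul_randomizedOracle]
      rfl
    have e2 : (E * (U :: l).foldl (stepState Finset.univ) (randomizedOracle Finset.univ ρ)).trace =
        (dualOracle Finset.univ (backward E (U :: l)) * ρ).trace := by
      rw [trace_mul_foldl_stepState, trace_mul_randomizedOracle]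
    have e3 : (U :: l).foldl (stepState (stabilizing V)) (randomizedOracle (stabilizing V) ρ) =
        l.foldl (stepState (stabilizing V)) (randomizedOracle (stabilizing V) σ) := rfl
    rw [e1] at hrec
    rw [e3, e2]
    refine (norm_sub_le_norm_sub_add_norm_sub _ _ _).trans (add_le_add hrec hstep) |>.trans ?_
    have hmono : queryError w V.card η (devProb V ρ) ≤
        queryError w V.card η (((s + 1 + l.length : ℕ) : ℝ) ^ 2 * leak w V.card η) := by
      refine queryError_mono w _ η (hdev.trans ?_)
      gcongr
      omega
    have e4 : s + (U :: l).length = s + 1 + l.length := by simp; omega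
    rw [e4]
    have e5 : (((U :: l).length : ℕ) : ℝ) = l.length + 1 := by simp
    rw [e5]
    change _ + queryError w V.card η (devProb V ρ) ≤ _
    linarith

end Hybrid

/-! ### Random subsets that are uncorrelated with given functions -/

section Concentration

/-- These are the first two terms of the binomial expansion; they serve to add one variable to an
elementary symmetric polynomial. -/
lemma pow_add_mul_pow_le {S g : ℝ} (hS : 0 ≤ S) (hg : 0 ≤ g) (k : ℕ) :
    S ^ (k + 1) + (k + 1) * g * S ^ k ≤ (S + g) ^ (k + 1) := by
  induction k with
  | zero => simp
  | succ k ih =>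
    have h1 := mul_le_mul_of_nonneg_right ih (add_nonneg hS hg)
    rw [← pow_succ] at h1
    refine le_trans ?_ h1
    have : 0 ≤ ((k : ℝ) + 1) * g * S ^ k * g := by positivity
    push_cast
    rw [← sub_nonneg]
    refine this.trans (le_of_eq ?_)
    ring

/-- The elementary symmetric polynomial of degree `k` is at most `(∑ g) ^ k / k!`. -/
lemma factorial_mul_sum_powersetCard_prod_le {ι : Type*} [DecidableEq ι] (s : Finset ι)
    {g : ι → ℝ} (hg : ∀ a, 0 ≤ g a) (k : ℕ) :
    (k.factorial : ℝ) * ∑ V ∈ s.powersetCard k, ∏ a ∈ V, g a ≤ (∑ a ∈ s, g a) ^ k := by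
  induction s using Finset.induction_on generalizing k with
  | empty =>
    cases k with
    | zero => simp
    | succ k => rw [Finset.powersetCard_eq_empty.mpr (by simp)]; simp
  | insert a s ha ih =>
    cases k with
    | zero => simp
    | succ k =>
      rw [Finset.powersetCard_succ_insert ha, Finset.sum_union, Finset.sum_image]
      · have h1 : ∑ V ∈ s.powersetCard k, ∏ b ∈ insert a V, g b =
            g a * ∑ V ∈ s.powersetCard k, ∏ b ∈ V, g b := by
          rw [Finset.mul_sum]
          refine Finset.sum_congr rfl fun V hV => ?_
          rw [Finset.prod_insert fun h => ha ((Finset.mem_powersetCard.mp hV).1 h)]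
        rw [h1, Finset.sum_insert ha, add_comm (g a)]
        have hS : 0 ≤ ∑ b ∈ s, g b := Finset.sum_nonneg fun b _ => hg b
        refine le_trans ?_ (pow_add_mul_pow_le hS (hg a) k)
        have i1 := ih (k + 1)
        have i2 := mul_le_mul_of_nonneg_left (ih k)
          (show 0 ≤ ((k : ℝ) + 1) * g a from mul_nonneg (by positivity) (hg a))
        rw [mul_add]
        refine add_le_add i1 (le_trans (le_of_eq ?_) i2)
        rw [Nat.factorial_succ]
        push_cast
        ring
      · intro V hV W hW h
        have hV' : a ∉ V := fun h => ha ((Finset.mem_powersetCard.mp hV).1 h)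
        have hW' : a ∉ W := fun h => ha ((Finset.mem_powersetCard.mp hW).1 h)
        rw [← Finset.erase_insert hV', h, Finset.erase_insert hW']
      · rw [Finset.disjoint_left]
        rintro V hV hV'
        obtain ⟨W, _, rfl⟩ := Finset.mem_image.mp hV'
        exact ha ((Finset.mem_powersetCard.mp hV).1 (Finset.mem_insert_self a W))

/-- Each factor of the falling factorial is at least N - k, and by Bernoulli (1 - k/N)^k ≥ 1 - k²/N
≥ 1/2. -/
lemma pow_le_two_mul_factorial_mul_choose {N k : ℕ} (h : 2 * k ^ 2 ≤ N) :
    (N : ℝ) ^ k ≤ 2 * (k.factorial * N.choose k) := by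
  rcases Nat.eq_zero_or_pos k with rfl | hk
  · simp
  have hkN : k ≤ N := by nlinarith
  have hN : (0 : ℝ) < N := by
    have : 0 < N := by omega
    exact_mod_cast this
  have h1 : ((N + 1 - k : ℕ) : ℝ) ^ k ≤ k.factorial * N.choose k := by
    have := Nat.pow_sub_le_descFactorial N k
    rw [Nat.descFactorial_eq_factorial_mul_choose] at this
    exact_mod_cast this
  have hsub : (N : ℝ) - k ≤ ((N + 1 - k : ℕ) : ℝ) := by
    rw [Nat.cast_sub (by omega)]
    push_cast; linarith
  have hkN' : (k : ℝ) ≤ N := by exact_mod_cast hkN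
  have h2 : ((N : ℝ) - k) ^ k ≤ k.factorial * N.choose k :=
    (pow_le_pow_left₀ (by linarith) hsub k).trans h1
  have h3 : 1 + (k : ℝ) * (-(k / N)) ≤ (1 + -((k : ℝ) / N)) ^ k := by
    apply one_add_mul_le_pow
    have : (k : ℝ) / N ≤ 1 := (div_le_one hN).mpr hkN'
    linarith
  have h4 : (1 : ℝ) / 2 ≤ 1 + (k : ℝ) * (-(k / N)) := by
    have : (k : ℝ) * (k / N) ≤ 1 / 2 := by
      rw [← mul_div_assoc, div_le_iff₀ hN]
      have : (2 : ℝ) * k ^ 2 ≤ N := by exact_mod_cast h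
      linarith
    linarith
  have h5 : ((N : ℝ) - k) ^ k = N ^ k * (1 + -((k : ℝ) / N)) ^ k := by
    rw [← mul_pow]
    congr 1
    field_simp
    ring
  have h6 : (N : ℝ) ^ k * (1 / 2) ≤ N ^ k * (1 + -((k : ℝ) / N)) ^ k :=
    mul_le_mul_of_nonneg_left (h4.trans h3) (by positivity)
  linarith

variable {ι : Type*} [Fintype ι]

lemma sum_norm_le (φ : ι → ℂ) : ∑ a, ‖φ a‖ ≤ √(Fintype.card ι) * l2 φ := by
  have h := sq_sum_le_card_mul_sum_sq (s := Finset.univ) (f := fun a => ‖φ a‖)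
  rw [← l2_sq, Finset.card_univ] at h
  have := Real.sqrt_le_sqrt h
  rwa [Real.sqrt_sq (Finset.sum_nonneg fun _ _ => norm_nonneg _), Real.sqrt_mul (Nat.cast_nonneg _),
    Real.sqrt_sq (l2_nonneg _)] at this

/-- The mean of a function. -/
def mean (h : ι → ℝ) : ℝ := (Fintype.card ι : ℝ)⁻¹ * ∑ a, h a

lemma abs_mean_le {h : ι → ℝ} (hh : ∀ a, |h a| ≤ 1) : |mean h| ≤ 1 := by
  rw [mean, abs_mul, abs_of_nonneg (by positivity)]
  have : |∑ a, h a| ≤ Fintype.card ι := by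
    refine (Finset.abs_sum_le_sum_abs _ _).trans ?_
    simpa using Finset.sum_le_sum fun a (_ : a ∈ Finset.univ) => hh a
  calc _ ≤ (Fintype.card ι : ℝ)⁻¹ * Fintype.card ι := by gcongr
    _ ≤ 1 := inv_mul_le_one

/-- On [0, 1], exp x ≤ 1 + 2x, and the sum of the entries is at most √N ≤ N/k. -/
lemma sum_exp_norm_le {k : ℕ} (hk0 : 0 < k) (hk : 2 * k ^ 2 ≤ Fintype.card ι) {φ : ι → ℂ}
    (hφ : l2 φ ≤ 1) : ∑ a, Real.exp ‖φ a‖ ≤ Fintype.card ι * (1 + 4 / k) := by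
  have h1 : ∀ a, Real.exp ‖φ a‖ ≤ 1 + 2 * ‖φ a‖ := by
    intro a
    have ha : ‖φ a‖ ≤ 1 := by
      refine le_trans ?_ hφ
      rw [← sq_le_sq₀ (norm_nonneg _) (l2_nonneg _), l2_sq]
      exact Finset.single_le_sum (f := fun a => ‖φ a‖ ^ 2) (fun _ _ => sq_nonneg _)
        (Finset.mem_univ a)
    have := (abs_le.mp (Real.abs_exp_sub_one_le
      (show |‖φ a‖| ≤ 1 by rwa [abs_of_nonneg (norm_nonneg _)]))).2
    rw [abs_of_nonneg (norm_nonneg _)] at this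
    linarith
  refine (Finset.sum_le_sum fun a _ => h1 a).trans ?_
  rw [Finset.sum_add_distrib, ← Finset.mul_sum]
  have h2 := (sum_norm_le φ).trans (mul_le_of_le_one_right (Real.sqrt_nonneg _) hφ)
  have hk' : (0 : ℝ) < k := by exact_mod_cast hk0
  have h3 : (k : ℝ) * √(Fintype.card ι) ≤ Fintype.card ι := by
    have : (k : ℝ) ≤ √(Fintype.card ι) := by
      apply Real.le_sqrt_of_sq_le
      have : k ^ 2 ≤ Fintype.card ι := by omega
      exact_mod_cast this
    calc (k : ℝ) * √(Fintype.card ι) ≤ √(Fintype.card ι) * √(Fintype.card ι) := by gcongr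
      _ = _ := Real.mul_self_sqrt (Nat.cast_nonneg _)
  have h4 : √(Fintype.card ι) ≤ (Fintype.card ι : ℝ) / k := by
    rw [le_div_iff₀ hk']; linarith
  have h5 : (Fintype.card ι : ℝ) * (1 + 4 / k) = Fintype.card ι + 4 * (Fintype.card ι / k) := by
    ring
  have h6 : 0 ≤ (Fintype.card ι : ℝ) / k := by positivity
  rw [h5]
  simp only [Finset.sum_const, nsmul_eq_mul, mul_one, Finset.card_univ]
  linarith

/-- The exponents lie in [-1, 1] since k ≥ 4, so exp x ≤ 1 + x + x². Centering removes the linear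
term and the square is at most 4/k. -/
lemma sum_exp_sub_mean_le {k : ℕ} (hk : 4 ≤ k) [Nonempty ι] {h : ι → ℝ} (hh : ∀ a, |h a| ≤ 1) :
    ∑ a, Real.exp ((h a - mean h) / √k) ≤ Fintype.card ι * (1 + 4 / k) := by
  have hk' : (0 : ℝ) < k := by exact_mod_cast (by omega : 0 < k)
  have hs : (2 : ℝ) ≤ √k := by
    apply Real.le_sqrt_of_sq_le
    have : (4 : ℝ) ≤ k := by exact_mod_cast hk
    linarith
  have hm := abs_mean_le hh
  have hd : ∀ a, |h a - mean h| ≤ 2 := fun a => (abs_sub _ _).trans (by linarith [hh a])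
  have h1 : ∀ a, Real.exp ((h a - mean h) / √k) ≤ 1 + (h a - mean h) / √k + 4 / k := by
    intro a
    have hx : |(h a - mean h) / √k| ≤ 1 := by
      rw [abs_div, abs_of_nonneg (Real.sqrt_nonneg _), div_le_one (by linarith)]
      exact (hd a).trans hs
    have h2 := (abs_le.mp (Real.abs_exp_sub_one_sub_id_le hx)).2
    have h3 : ((h a - mean h) / √k) ^ 2 ≤ 4 / k := by
      rw [div_pow, Real.sq_sqrt hk'.le]
      gcongr
      rw [← sq_abs]
      nlinarith [hd a, abs_nonneg (h a - mean h)]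
    linarith
  refine (Finset.sum_le_sum fun a _ => h1 a).trans (le_of_eq ?_)
  have hN : (Fintype.card ι : ℝ) ≠ 0 := by exact_mod_cast Fintype.card_ne_zero
  have h4 : ∑ a, (h a - mean h) / √k = 0 := by
    rw [← Finset.sum_div, Finset.sum_sub_distrib, mean, Finset.sum_const, nsmul_eq_mul,
      Finset.card_univ, mul_inv_cancel_left₀ hN, sub_self, zero_div]
  rw [Finset.sum_add_distrib, Finset.sum_add_distrib, h4]
  simp only [Finset.sum_const, nsmul_eq_mul, Finset.card_univ]
  ring

variable [DecidableEq ι]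

/-- A large deviation bound for the sum of `f` over a random subset of size `k`. -/
lemma card_filter_le_sum_le {k : ℕ} (hk0 : 0 < k) (hk : 2 * k ^ 2 ≤ Fintype.card ι) (f : ι → ℝ)
    {c τ : ℝ} (hf : ∑ a, Real.exp (f a) ≤ Fintype.card ι * (1 + c / k)) :
    (((Finset.univ.powersetCard k).filter fun V : Finset ι => τ ≤ ∑ a ∈ V, f a).card : ℝ) ≤
      2 * Real.exp (c - τ) * (Fintype.card ι).choose k := by
  set B := (Finset.univ.powersetCard k).filter fun V : Finset ι => τ ≤ ∑ a ∈ V, f a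
  -- Markov's inequality for the exponential moment; the sum over k-subsets is an elementary
  -- symmetric polynomial in the values exp (f a).
  have h1 : (B.card : ℝ) * Real.exp τ ≤
      ∑ V ∈ (Finset.univ : Finset ι).powersetCard k, ∏ a ∈ V, Real.exp (f a) := by
    rw [← nsmul_eq_mul, ← Finset.sum_const]
    refine (Finset.sum_le_sum (g := fun V => ∏ a ∈ V, Real.exp (f a)) fun V hV => ?_).trans
      (Finset.sum_le_sum_of_subset_of_nonneg (Finset.filter_subset _ _) fun V _ _ =>
        Finset.prod_nonneg fun a _ => (Real.exp_pos _).le)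
    rw [← Real.exp_sum]
    exact Real.exp_le_exp.mpr (Finset.mem_filter.mp hV).2
  have h2 := factorial_mul_sum_powersetCard_prod_le Finset.univ
    (fun a => (Real.exp_pos (f a)).le) k
  have h0 : 0 ≤ ∑ a, Real.exp (f a) := Finset.sum_nonneg fun a _ => (Real.exp_pos _).le
  have h3 : (∑ a, Real.exp (f a)) ^ k ≤
      2 * (k.factorial * (Fintype.card ι).choose k) * Real.exp c := by
    refine (pow_le_pow_left₀ h0 (hf.trans (mul_le_mul_of_nonneg_left
      (show 1 + c / k ≤ Real.exp (c / k) by linarith [Real.add_one_le_exp (c / k)])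
        (Nat.cast_nonneg _))) k).trans ?_
    rw [mul_pow, ← Real.exp_nat_mul]
    have hk' : (k : ℝ) ≠ 0 := by exact_mod_cast hk0.ne'
    rw [mul_div_cancel₀ c hk']
    exact mul_le_mul_of_nonneg_right (pow_le_two_mul_factorial_mul_choose hk) (Real.exp_pos c).le
  have hfac : (0 : ℝ) < k.factorial := by exact_mod_cast k.factorial_pos
  have h4 : (k.factorial : ℝ) * (B.card * Real.exp τ) ≤
      k.factorial * (2 * Real.exp c * (Fintype.card ι).choose k) := by
    refine (mul_le_mul_of_nonneg_left h1 hfac.le).trans (h2.trans (h3.trans (le_of_eq ?_)))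
    ring
  have h5 := le_of_mul_le_mul_left h4 hfac
  rw [Real.exp_sub, ← mul_div_assoc, div_mul_eq_mul_div, le_div_iff₀ (Real.exp_pos τ)]
  exact h5

/-- A subset of size `k` on which finitely many functions have small sum. -/
lemma exists_forall_sum_lt {κ : Type*} [Fintype κ] {k : ℕ} (hk0 : 0 < k)
    (hk : 2 * k ^ 2 ≤ Fintype.card ι) (f : κ → ι → ℝ) {c τ : ℝ}
    (hf : ∀ i, ∑ a, Real.exp (f i a) ≤ Fintype.card ι * (1 + c / k))
    (hκ : Fintype.card κ * (2 * Real.exp (c - τ)) < 1) :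
    ∃ V : Finset ι, V.card = k ∧ ∀ i, ∑ a ∈ V, f i a < τ := by
  by_contra! hcon
  set P := (Finset.univ : Finset ι).powersetCard k with hP
  have hkN : k ≤ Fintype.card ι := by nlinarith
  have hC : (0 : ℝ) < (Fintype.card ι).choose k := by exact_mod_cast Nat.choose_pos hkN
  have hsub : P ⊆ Finset.univ.biUnion fun i => P.filter fun V => τ ≤ ∑ a ∈ V, f i a := by
    intro V hV
    obtain ⟨i, hi⟩ := hcon V (Finset.mem_powersetCard.mp hV).2
    exact Finset.mem_biUnion.mpr ⟨i, Finset.mem_univ i, Finset.mem_filter.mpr ⟨hV, hi⟩⟩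
  have h1 : (P.card : ℝ) ≤ ∑ i, ((P.filter fun V => τ ≤ ∑ a ∈ V, f i a).card : ℝ) := by
    exact_mod_cast (Finset.card_le_card hsub).trans Finset.card_biUnion_le
  have h2 := h1.trans (Finset.sum_le_sum fun i _ => card_filter_le_sum_le hk0 hk (f i) (hf i))
  rw [Finset.sum_const, nsmul_eq_mul, Finset.card_univ, hP, Finset.card_powersetCard,
    Finset.card_univ, ← mul_assoc] at h2
  have h3 := mul_lt_mul_of_pos_right hκ hC
  linarith

/-- The inner product is a factor at most 2/√k times the sum of φ over V minus k/N times its total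
sum; the latter term is at most k/√N times the norm, hence at most the norm. -/
lemma norm_devVec_dotProduct_le_of_sum {V : Finset ι} (hV0 : 0 < V.card)
    (hV : 2 * V.card ^ 2 ≤ Fintype.card ι) {φ : ι → ℂ} {τ : ℝ} (hτ : 1 ≤ τ)
    (h : ∑ a ∈ V, ‖φ a‖ ≤ τ * l2 φ) : ‖devVec V ⬝ᵥ φ‖ ≤ 4 * τ / √V.card * l2 φ := by
  have hk' : (0 : ℝ) < V.card := by exact_mod_cast hV0
  have hkN : (2 : ℝ) * V.card ^ 2 ≤ Fintype.card ι := by exact_mod_cast hV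
  have hk1 : (1 : ℝ) ≤ V.card := by exact_mod_cast hV0
  have hN : (0 : ℝ) < Fintype.card ι := by nlinarith
  have hl := l2_nonneg φ
  have e : devVec V ⬝ᵥ φ =
      (√((Fintype.card ι : ℝ) / (V.card * (Fintype.card ι - V.card))) : ℂ) *
        (∑ a ∈ V, φ a - ((V.card : ℝ) / Fintype.card ι : ℝ) * ∑ a, φ a) := by
    have h1 : ∑ a ∈ V, φ a = ∑ a, if a ∈ V then φ a else 0 := by simp
    rw [h1, Finset.mul_sum, ← Finset.sum_sub_distrib, Finset.mul_sum]
    refine Finset.sum_congr rfl fun a _ => ?_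
    by_cases ha : a ∈ V <;> simp [devVec, ha] <;> ring
  have h2 : √((Fintype.card ι : ℝ) / (V.card * (Fintype.card ι - V.card))) ≤ 2 / √V.card := by
    have : (2 : ℝ) / √V.card = √(4 / V.card) := by
      rw [Real.sqrt_div (by norm_num), show (4 : ℝ) = 2 ^ 2 by norm_num,
        Real.sqrt_sq (by norm_num)]
    rw [this]
    apply Real.sqrt_le_sqrt
    have h3 : (0 : ℝ) < Fintype.card ι - V.card := by nlinarith
    rw [div_le_div_iff₀ (by positivity) hk']
    nlinarith
  have h3 : ‖∑ a ∈ V, φ a - ((V.card : ℝ) / Fintype.card ι : ℝ) * ∑ a, φ a‖ ≤ 2 * τ * l2 φ := by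
    refine (norm_sub_le _ _).trans ?_
    have a1 := (norm_sum_le V φ).trans h
    have a2 : ‖(((V.card : ℝ) / Fintype.card ι : ℝ) : ℂ) * ∑ a, φ a‖ ≤ 1 * l2 φ := by
      rw [norm_mul, Complex.norm_real, Real.norm_of_nonneg (by positivity)]
      have a3 := (norm_sum_le Finset.univ φ).trans (sum_norm_le φ)
      calc _ ≤ (V.card : ℝ) / Fintype.card ι * (√(Fintype.card ι) * l2 φ) := by gcongr
        _ = (V.card : ℝ) / Fintype.card ι * √(Fintype.card ι) * l2 φ := by ring
        _ ≤ 1 * l2 φ := by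
          gcongr
          have a4 : (V.card : ℝ) ≤ √(Fintype.card ι) := by
            apply Real.le_sqrt_of_sq_le; nlinarith
          rw [div_mul_eq_mul_div, div_le_one hN]
          calc (V.card : ℝ) * √(Fintype.card ι) ≤ √(Fintype.card ι) * √(Fintype.card ι) := by
                gcongr
            _ = _ := Real.mul_self_sqrt (Nat.cast_nonneg _)
    have : 1 * l2 φ ≤ τ * l2 φ := by gcongr
    linarith
  rw [e, norm_mul, Complex.norm_real, Real.norm_of_nonneg (Real.sqrt_nonneg _)]
  calc _ ≤ 2 / √V.card * (2 * τ * l2 φ) := mul_le_mul h2 h3 (norm_nonneg _) (by positivity)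
    _ = _ := by ring

/-- A subset of size `k` that correlates neither with finitely many bounded functions nor with
finitely many vectors. -/
lemma exists_uncorrelated_subset {I K : Type*} [Fintype I] [Fintype K] {k : ℕ} (hk : 4 ≤ k)
    (hkN : 2 * k ^ 2 ≤ Fintype.card ι) (h : I → ι → ℂ) (hh : ∀ i a, ‖h i a‖ ≤ 1)
    (φ : K → ι → ℂ) {τ : ℝ} (hτ : 1 ≤ τ)
    (hcard : (4 * Fintype.card I + Fintype.card K : ℝ) * (2 * Real.exp (4 - τ)) < 1) :
    ∃ V : Finset ι, V.card = k ∧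
      (∀ i, ‖(V.card : ℂ)⁻¹ * ∑ a ∈ V, h i a - (Fintype.card ι : ℂ)⁻¹ * ∑ a, h i a‖ ≤
        4 * τ / √k) ∧
      ∀ j, ‖devVec V ⬝ᵥ φ j‖ ≤ 4 * τ / √k * l2 (φ j) := by
  have hk0 : 0 < k := by omega
  have hN : 0 < Fintype.card ι := by nlinarith
  have : Nonempty ι := Fintype.card_pos_iff.mp hN
  have hkR : (0 : ℝ) < k := by exact_mod_cast hk0
  have hsk : 0 < √(k : ℝ) := Real.sqrt_pos.mpr hkR
  -- The tail bound is one-sided and real, so each complex function is tested through ±Re and ±Im.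
  let part : Fin 4 → ℂ → ℝ := ![fun z => z.re, fun z => -z.re, fun z => z.im, fun z => -z.im]
  have hpart : ∀ b z, |part b z| ≤ ‖z‖ := by
    intro b z
    fin_cases b
    · exact Complex.abs_re_le_norm z
    · simpa [part] using Complex.abs_re_le_norm z
    · exact Complex.abs_im_le_norm z
    · simpa [part] using Complex.abs_im_le_norm z
  -- Bounded functions are centered and scaled by 1/√k, vectors are normalized; in both cases the
  -- exponential moment bound holds with c = 4. A zero vector gives the zero function.
  let f : (I × Fin 4) ⊕ K → ι → ℝ := Sum.elim
    (fun p a => (part p.2 (h p.1 a) - mean fun a => part p.2 (h p.1 a)) / √k)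
    (fun j a => ‖(((l2 (φ j))⁻¹ : ℝ) : ℂ) • φ j a‖)
  obtain ⟨V, hVk, hV⟩ := exists_forall_sum_lt (c := 4) (τ := τ) hk0 hkN f (by
      rintro (⟨i, b⟩ | j)
      · exact sum_exp_sub_mean_le hk fun a => (hpart b _).trans (hh i a)
      · refine sum_exp_norm_le hk0 hkN (φ := (((l2 (φ j))⁻¹ : ℝ) : ℂ) • φ j) ?_
        rw [l2_smul, Complex.norm_real, Real.norm_of_nonneg (inv_nonneg.mpr (l2_nonneg _))]
        exact inv_mul_le_one) (by
      simp only [Fintype.card_sum, Fintype.card_prod, Fintype.card_fin]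
      push_cast
      rwa [mul_comm (Fintype.card I : ℝ)])
  refine ⟨V, hVk, fun i => ?_, fun j => ?_⟩
  · have key : ∀ b, (k : ℝ)⁻¹ * ∑ a ∈ V, part b (h i a) - (Fintype.card ι : ℝ)⁻¹ *
        ∑ a, part b (h i a) ≤ τ / √k := by
      intro b
      have h1 := hV (Sum.inl (i, b))
      simp only [f, Sum.elim_inl] at h1
      rw [← Finset.sum_div, Finset.sum_sub_distrib, Finset.sum_const, nsmul_eq_mul, hVk,
        div_lt_iff₀ hsk, mean] at h1
      set m := (Fintype.card ι : ℝ)⁻¹ * ∑ a, part b (h i a)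
      rw [sub_le_iff_le_add, inv_mul_le_iff₀ hkR]
      have h2 : (k : ℝ) * (τ / √k + m) = τ * √k + k * m := by
        have : (k : ℝ) = √k * √k := (Real.mul_self_sqrt hkR.le).symm
        rw [mul_add]
        congr 1
        conv_lhs => rw [this]
        rw [Real.sqrt_mul_self hsk.le]
        field_simp
      rw [h2]
      linarith
    have k0 := key 0
    have k1 := key 1
    have k2 := key 2
    have k3 := key 3
    simp only [part, Matrix.cons_val, Finset.sum_neg_distrib] at k0 k1 k2 k3
    refine (Complex.norm_le_abs_re_add_abs_im _).trans ?_
    have er : ((V.card : ℂ)⁻¹ * ∑ a ∈ V, h i a - (Fintype.card ι : ℂ)⁻¹ * ∑ a, h i a).re =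
        (k : ℝ)⁻¹ * ∑ a ∈ V, (h i a).re - (Fintype.card ι : ℝ)⁻¹ * ∑ a, (h i a).re := by
      rw [hVk, ← Complex.ofReal_natCast, ← Complex.ofReal_natCast, ← Complex.ofReal_inv,
        ← Complex.ofReal_inv, Complex.sub_re, Complex.re_ofReal_mul, Complex.re_ofReal_mul,
        Complex.re_sum, Complex.re_sum]
    have ei : ((V.card : ℂ)⁻¹ * ∑ a ∈ V, h i a - (Fintype.card ι : ℂ)⁻¹ * ∑ a, h i a).im =
        (k : ℝ)⁻¹ * ∑ a ∈ V, (h i a).im - (Fintype.card ι : ℝ)⁻¹ * ∑ a, (h i a).im := by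
      rw [hVk, ← Complex.ofReal_natCast, ← Complex.ofReal_natCast, ← Complex.ofReal_inv,
        ← Complex.ofReal_inv, Complex.sub_im, Complex.im_ofReal_mul, Complex.im_ofReal_mul,
        Complex.im_sum, Complex.im_sum]
    rw [er, ei]
    have b1 : |(k : ℝ)⁻¹ * ∑ a ∈ V, (h i a).re - (Fintype.card ι : ℝ)⁻¹ * ∑ a, (h i a).re| ≤
        τ / √k := abs_le.mpr ⟨by linarith, k0⟩
    have b2 : |(k : ℝ)⁻¹ * ∑ a ∈ V, (h i a).im - (Fintype.card ι : ℝ)⁻¹ * ∑ a, (h i a).im| ≤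
        τ / √k := abs_le.mpr ⟨by linarith, k2⟩
    have b3 : 0 ≤ τ / √k := by positivity
    have b4 : 4 * τ / √(k : ℝ) = 4 * (τ / √k) := by ring
    rw [b4]
    linarith
  · have hb := norm_devVec_dotProduct_le_of_sum (V := V) (φ := φ j) (by omega) (by rwa [hVk]) hτ ?_
    · rwa [hVk] at hb
    · have h1 := hV (Sum.inr j)
      simp only [f, Sum.elim_inr, norm_smul, Complex.norm_real, norm_inv, Real.norm_eq_abs] at h1
      rw [abs_of_nonneg (l2_nonneg _), ← Finset.mul_sum] at h1
      rcases (l2_nonneg (φ j)).eq_or_lt with h0 | h0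
      · have : φ j = 0 := l2_eq_zero h0.symm
        simp [this, l2]
      · rw [inv_mul_lt_iff₀ h0] at h1
        linarith

end Concentration

/-! ### One subset against all witnesses -/

section Verifiers

variable {n w : ℕ}

/-- The observable of a query algorithm, evolved backwards to just after its first `t` steps. -/
def QueryAlgorithm.observable (Q : QueryAlgorithm n w) (t : ℕ) :
    Matrix (StateIdx n w) (StateIdx n w) ℂ := backward Q.accept (Q.unitaries.drop t)

/-- The gate of a query algorithm in step `t`. -/
def QueryAlgorithm.gate (Q : QueryAlgorithm n w) (t : ℕ) : Matrix.unitaryGroup (StateIdx n w) ℂ :=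
  -- The default 1 makes every index up to T meaningful whatever the number of queries; without
  -- queries, `firstState` is the initial state.
  Q.unitaries.getD t 1

/-- The state of a query algorithm before its first query. -/
def QueryAlgorithm.firstState (Q : QueryAlgorithm n w) : Matrix (StateIdx n w) (StateIdx n w) ℂ :=
  (Q.gate 0 : Matrix (StateIdx n w) (StateIdx n w) ℂ) * Q.init *
    (Q.gate 0 : Matrix (StateIdx n w) (StateIdx n w) ℂ)ᴴ

lemma QueryAlgorithm.firstState_posSemidef (Q : QueryAlgorithm n w) : Q.firstState.PosSemidef :=
  Q.init_posSemidef.mul_mul_conjTranspose_same _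

/-- Vectors whose mixture is the state before the first query. -/
def QueryAlgorithm.ensemble (Q : QueryAlgorithm n w) : StateIdx n w → StateIdx n w → ℂ :=
  (exists_ensemble Q.firstState_posSemidef).choose

lemma QueryAlgorithm.ensemble_spec (Q : QueryAlgorithm n w)
    (A : Matrix (StateIdx n w) (StateIdx n w) ℂ) :
    (A * Q.firstState).trace = ∑ c, star (Q.ensemble c) ⬝ᵥ A *ᵥ Q.ensemble c :=
  (exists_ensemble Q.firstState_posSemidef).choose_spec A

lemma QueryAlgorithm.contraction_observable (Q : QueryAlgorithm n w) (t : ℕ) :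
    Contraction (Q.observable t) :=
  contraction_backward (contraction_of_posSemidef Q.accept_posSemidef Q.accept_compl_posSemidef) _

lemma QueryAlgorithm.firstState_trace (Q : QueryAlgorithm n w) : Q.firstState.trace = 1 := by
  rw [firstState, trace_conj_unitary, Q.init_trace]

/-- The vectors that a subset must not correlate with, so that a query algorithm with at most `T`
queries does not notice it. -/
def QueryAlgorithm.testVec (Q : QueryAlgorithm n w) (T : ℕ) :
    (Fin 3 × Fin (T + 1) × BlockIdx w × BlockIdx w) ⊕ (StateIdx n w × BlockIdx w) →
      Fin (2 ^ n) → ℂ :=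
  Sum.elim
    (fun p => (![matBlock (Q.observable p.2.1) p.2.2.1 p.2.2.2,
      (matBlock (Q.observable p.2.1) p.2.2.1 p.2.2.2)ᵀ,
      matBlock (Q.gate p.2.1 : Matrix (StateIdx n w) (StateIdx n w) ℂ) p.2.2.1 p.2.2.2] p.1) *ᵥ
        unitInd Finset.univ)
    (fun p => block (Q.ensemble p.1) p.2)

/-- The diagonals that a subset must not correlate with, so that a query algorithm with at most `T`
queries does not notice it. -/
def QueryAlgorithm.testDiag (Q : QueryAlgorithm n w) (T : ℕ)
    (p : Fin (T + 1) × BlockIdx w × BlockIdx w) : Fin (2 ^ n) → ℂ :=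
  fun a => matBlock (Q.observable p.1) p.2.1 p.2.2 a a

lemma Contraction.transpose {ι κ : Type*} [Fintype ι] [Fintype κ] {A : Matrix ι κ ℂ}
    (hA : Contraction A) : Contraction Aᵀ := by
  intro f g
  have := hA (star g) (star f)
  rw [star_star, l2_star, l2_star] at this
  rw [Matrix.dotProduct_mulVec, Matrix.vecMul_transpose, dotProduct_comm, mul_comm]
  exact this

lemma le_leak (w : ℕ) {k : ℕ} (hk : 2 ≤ k) {η : ℝ} (hη : 0 ≤ η) : η ≤ leak w k η := by
  have h1 : (2 : ℝ) ≤ k := by exact_mod_cast hk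
  have h2 : 0 ≤ 8 / ((k : ℝ) - 1) := div_nonneg (by norm_num) (by linarith)
  have h3 : (1 : ℝ) ≤ Fintype.card (BlockIdx w) := by
    exact_mod_cast Fintype.card_pos (α := BlockIdx w)
  rw [leak]
  set L : ℝ := ((Fintype.card (BlockIdx w) : ℕ) : ℝ)
  have h4 : η ≤ (η + 8 / ((k : ℝ) - 1)) * L := by nlinarith
  nlinarith

/-- The test functions control every backward observable, every gate and the state before the first
query. The initial weight along u is at most η² ≤ η ≤ `leak`, which starts the hybrid argument at s
= 1. -/
lemma abs_acceptProb_sub_le {V : Finset (Fin (2 ^ n))} (hk : 2 ≤ V.card) (hk' : V.card ≤ Vᶜ.card)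
    (Q : QueryAlgorithm n w) {T : ℕ} (hT : Q.unitaries.length ≤ T) {η : ℝ} (hη : 0 ≤ η)
    (hη1 : η ≤ 1)
    (hdiag : ∀ p, ‖(V.card : ℂ)⁻¹ * ∑ a ∈ V, Q.testDiag T p a -
      (Fintype.card (Fin (2 ^ n)) : ℂ)⁻¹ * ∑ a, Q.testDiag T p a‖ ≤ η)
    (hvec : ∀ p, ‖devVec V ⬝ᵥ Q.testVec T p‖ ≤ η * l2 (Q.testVec T p)) :
    |Q.acceptProb (stabilizing V) - Q.acceptProb Finset.univ| ≤
      T * queryError w V.card η ((T : ℝ) ^ 2 * leak w V.card η) := by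
  have hleak := leak_nonneg w hk hη
  have hqe : 0 ≤ queryError w V.card η ((T : ℝ) ^ 2 * leak w V.card η) := by
    have h1 : (2 : ℝ) ≤ V.card := by exact_mod_cast hk
    have h2 : 0 ≤ 16 / ((V.card : ℝ) - 1) := div_nonneg (by norm_num) (by linarith)
    unfold queryError
    positivity
  have hunit : ∀ {X : Matrix (Fin (2 ^ n)) (Fin (2 ^ n)) ℂ}, Contraction X →
      l2 (X *ᵥ unitInd Finset.univ) ≤ 1 := fun hX =>
    (hX.l2_mulVec_le _).trans (l2_unitInd_le _)
  have hobs : ∀ t : Fin (T + 1), GoodObservable V η (Q.observable t) := by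
    intro t
    have hc := fun i j => (Q.contraction_observable t).matBlock i j
    refine ⟨fun i j => ?_, fun i j => ?_, fun i j => ?_⟩
    · have := hdiag (t, i, j)
      rwa [← Finset.card_univ] at this
    · exact (hvec (Sum.inl (0, t, i, j))).trans (mul_le_of_le_one_right hη (hunit (hc i j)))
    · have := (hvec (Sum.inl (1, t, i, j))).trans
        (mul_le_of_le_one_right hη (hunit (hc i j).transpose))
      rw [Matrix.dotProduct_mulVec, ← Matrix.mulVec_transpose, dotProduct_comm]
      exact this
  have hgate : ∀ t : Fin (T + 1),
      GoodGate V η (Q.gate t : Matrix (StateIdx n w) (StateIdx n w) ℂ) := fun t i j =>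
    (hvec (Sum.inl (2, t, i, j))).trans (mul_le_of_le_one_right hη
      (hunit ((contraction_unitary (Q.gate t)).matBlock i j)))
  have hfirst : devProb V Q.firstState ≤ ((1 : ℕ) : ℝ) ^ 2 * leak w V.card η := by
    rw [devProb_eq_sum Q.ensemble_spec, Nat.cast_one, one_pow, one_mul]
    have h1 := sum_l2_sq_ensemble_eq_one Q.ensemble_spec Q.firstState_trace
    calc _ ≤ ∑ c, η ^ 2 * l2 (Q.ensemble c) ^ 2 := by
          refine Finset.sum_le_sum fun c _ => ?_
          rw [l2_sq_eq_sum_block, Finset.mul_sum, devWeight]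
          refine Finset.sum_le_sum fun j _ => ?_
          rw [← mul_pow]
          exact pow_le_pow_left₀ (norm_nonneg _) (hvec (Sum.inr (c, j))) 2
      _ = η ^ 2 := by rw [← Finset.mul_sum, h1, mul_one]
      _ ≤ η := by nlinarith
      _ ≤ _ := le_leak w hk hη
  have hfinal : ∀ F, Q.finalState F = Q.unitaries.foldl (stepState F) Q.init := by
    intro F
    unfold QueryAlgorithm.finalState
    -- In `finalState` the coercion to matrices sits on the whole list, as a monadic map; here it is
    -- absorbed into the folded function.
    rw [bind_pure_comp, List.map_eq_map, List.foldl_map]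
    rfl
  rw [QueryAlgorithm.acceptProb, QueryAlgorithm.acceptProb, ← Complex.sub_re]
  refine (Complex.abs_re_le_norm _).trans ?_
  rw [hfinal, hfinal]
  rcases hl : Q.unitaries with _ | ⟨U, l⟩
  · simp only [List.foldl_nil, sub_self, norm_zero]
    positivity
  · have hlen : l.length + 1 ≤ T := by simpa [hl] using hT
    have e : ∀ F, (U :: l).foldl (stepState F) Q.init =
        l.foldl (stepState F) (randomizedOracle F Q.firstState) := by
      intro F
      rw [QueryAlgorithm.firstState, QueryAlgorithm.gate, hl]
      rfl
    rw [e, e]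
    refine (norm_trace_foldl_sub_le hk hk'
      (contraction_of_posSemidef Q.accept_posSemidef Q.accept_compl_posSemidef) hη l ?_ ?_ 1 le_rfl
      Q.firstState_posSemidef Q.firstState_trace hfirst).trans ?_
    · intro U' hU'
      obtain ⟨t, ht, rfl⟩ := List.mem_iff_getElem.mp hU'
      have := hgate ⟨t + 1, by omega⟩
      simpa [QueryAlgorithm.gate, hl, ht] using this
    · intro l' hl'
      obtain ⟨t, ht⟩ := hl'
      have h2 : l.drop t.length = l' := by rw [← ht, List.drop_left]
      have h3 : t.length ≤ l.length := by rw [← ht]; simp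
      have := hobs ⟨t.length + 1, by omega⟩
      simpa [QueryAlgorithm.observable, hl, h2] using this
    · have h1 : ((l.length : ℝ) + 1) ≤ T := by exact_mod_cast hlen
      have h2 : (((1 + l.length : ℕ) : ℝ)) ≤ T := by exact_mod_cast (by omega : 1 + l.length ≤ T)
      have h3 : queryError w V.card η (((1 + l.length : ℕ) : ℝ) ^ 2 * leak w V.card η) ≤
          queryError w V.card η ((T : ℝ) ^ 2 * leak w V.card η) :=
        queryError_mono w _ η (by gcongr)
      calc _ ≤ ((l.length : ℝ) + 1) * queryError w V.card η ((T : ℝ) ^ 2 * leak w V.card η) := by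
            gcongr
        _ ≤ _ := by gcongr

/-- Replace 1/(k - 1) by η: the terms become 6 + 16 = 22 and 4·(1 + 8) = 36, whence 58. Of the three
factors L in the dominant term, two come from `leak` and one from the query error. -/
lemma queryError_le (w : ℕ) {k T : ℕ} (hk : 2 ≤ k) {η : ℝ} (hη : 1 / ((k : ℝ) - 1) ≤ η) :
    T * queryError w k η ((T : ℝ) ^ 2 * leak w k η) ≤
      58 * η * (Fintype.card (BlockIdx w) : ℝ) ^ 3 * ((T : ℝ) + 1) ^ 3 := by
  have h1 : (2 : ℝ) ≤ k := by exact_mod_cast hk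
  have h3 : (1 : ℝ) ≤ Fintype.card (BlockIdx w) := by
    exact_mod_cast Fintype.card_pos (α := BlockIdx w)
  have hr : 0 ≤ 1 / ((k : ℝ) - 1) := div_nonneg (by norm_num) (by linarith)
  have h16 : 16 / ((k : ℝ) - 1) = 16 * (1 / ((k : ℝ) - 1)) := by ring
  have h8 : 8 / ((k : ℝ) - 1) = 8 * (1 / ((k : ℝ) - 1)) := by ring
  have hη0 : 0 ≤ η := hr.trans hη
  rw [queryError, leak, h16, h8]
  set r := 1 / ((k : ℝ) - 1)
  set L : ℝ := ((Fintype.card (BlockIdx w) : ℕ) : ℝ)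
  have hT : (0 : ℝ) ≤ T := Nat.cast_nonneg T
  have hL2 : L ≤ L ^ 3 := le_self_pow₀ h3 (by norm_num)
  have hL0 : 0 ≤ L ^ 3 := by positivity
  have b1 : (6 * η + 16 * r) * L ≤ 22 * η * L ^ 3 :=
    mul_le_mul (by linarith) hL2 (by linarith) (by linarith)
  have b2 : 4 * (L * ((T : ℝ) ^ 2 * (L * ((η + 8 * r) * L)))) ≤ 36 * η * L ^ 3 * (T : ℝ) ^ 2 := by
    have : 4 * (L * ((T : ℝ) ^ 2 * (L * ((η + 8 * r) * L)))) =
        4 * (η + 8 * r) * (L ^ 3 * (T : ℝ) ^ 2) := by ring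
    rw [this]
    have : 36 * η * L ^ 3 * (T : ℝ) ^ 2 = 36 * η * (L ^ 3 * (T : ℝ) ^ 2) := by ring
    rw [this]
    apply mul_le_mul_of_nonneg_right _ (by positivity)
    linarith
  have b3 : (T : ℝ) * (22 + 36 * (T : ℝ) ^ 2) ≤ 58 * ((T : ℝ) + 1) ^ 3 := by
    have : 0 ≤ (T : ℝ) ^ 3 := by positivity
    have : 0 ≤ (T : ℝ) ^ 2 := by positivity
    ring_nf
    linarith
  calc _ ≤ (T : ℝ) * (22 * η * L ^ 3 + 36 * η * L ^ 3 * (T : ℝ) ^ 2) := by gcongr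
    _ = η * L ^ 3 * ((T : ℝ) * (22 + 36 * (T : ℝ) ^ 2)) := by ring
    _ ≤ η * L ^ 3 * (58 * ((T : ℝ) + 1) ^ 3) := by gcongr
    _ = _ := by ring

/-- A verifier that decides the hidden-subset problem has a small gap between completeness and
soundness. -/
lemma Verifier.gap_le_of_decides (A : Verifier n) {k T : ℕ} (hT : A.queryCount ≤ T) (hk : 4 ≤ k)
    (hkN : 2 * k ^ 2 ≤ 2 ^ n) {τ : ℝ} (hτ : 1 ≤ τ) (hη : 4 * τ / √k ≤ 1)
    (hcard : (2 : ℝ) ^ A.witnessLength * (8 * ((T : ℝ) + 1) *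
      (Fintype.card (BlockIdx A.workspace) : ℝ) ^ 2 * 2 ^ n) * (2 * Real.exp (4 - τ)) < 1)
    {c s : ℝ} (hdec : A.Decides k c s) :
    c - s ≤ 58 * (4 * τ / √k) * (Fintype.card (BlockIdx A.workspace) : ℝ) ^ 3 *
      ((T : ℝ) + 1) ^ 3 := by
  set w := A.workspace
  have hkR : (4 : ℝ) ≤ k := by exact_mod_cast hk
  have hsk : 0 < √(k : ℝ) := Real.sqrt_pos.mpr (by linarith)
  obtain ⟨V, hVk, hdiag, hvec⟩ := exists_uncorrelated_subset (ι := Fin (2 ^ n)) hk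
    (by rwa [Fintype.card_fin])
    (fun p : (Fin A.witnessLength → Bool) × (Fin (T + 1) × BlockIdx w × BlockIdx w) =>
      (A.algorithm p.1).testDiag T p.2)
    (fun p a => (((A.algorithm p.1).contraction_observable p.2.1).matBlock _ _).norm_apply_le a a)
    (fun p : (Fin A.witnessLength → Bool) × ((Fin 3 × Fin (T + 1) × BlockIdx w × BlockIdx w) ⊕
      (StateIdx n w × BlockIdx w)) => (A.algorithm p.1).testVec T p.2) hτ (by
      -- For each witness there are 4(T+1)L² tests of diagonals, 3(T+1)L² of observables and gates,
      -- and L²·2^n of the ensemble vectors; together at most 8(T+1)L²·2^n.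
      refine lt_of_le_of_lt (mul_le_mul_of_nonneg_right ?_ (by positivity)) hcard
      have hI : (Fintype.card ((Fin A.witnessLength → Bool) ×
          (Fin (T + 1) × BlockIdx w × BlockIdx w)) : ℝ) = 2 ^ A.witnessLength *
          (((T : ℝ) + 1) * ((Fintype.card (BlockIdx w) : ℕ) : ℝ) ^ 2) := by
        simp only [Fintype.card_prod, Fintype.card_fun, Fintype.card_bool, Fintype.card_fin]
        push_cast
        ring
      have hK : (Fintype.card ((Fin A.witnessLength → Bool) ×
          ((Fin 3 × Fin (T + 1) × BlockIdx w × BlockIdx w) ⊕ (StateIdx n w × BlockIdx w))) : ℝ) =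
          2 ^ A.witnessLength * (3 * (((T : ℝ) + 1) *
            ((Fintype.card (BlockIdx w) : ℕ) : ℝ) ^ 2) +
              ((Fintype.card (BlockIdx w) : ℕ) : ℝ) ^ 2 * 2 ^ n) := by
        simp only [Fintype.card_prod, Fintype.card_sum, Fintype.card_fun, Fintype.card_bool,
          Fintype.card_fin]
        push_cast
        ring
      rw [hI, hK]
      set L : ℝ := ((Fintype.card (BlockIdx w) : ℕ) : ℝ)
      have h1 : (1 : ℝ) ≤ 2 ^ n := one_le_pow₀ (by norm_num)
      have h2 : (0 : ℝ) ≤ T := Nat.cast_nonneg T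
      have h3 : 0 ≤ ((T : ℝ) + 1) * L ^ 2 := by positivity
      have h4 : 7 * (((T : ℝ) + 1) * L ^ 2) ≤ 7 * (((T : ℝ) + 1) * L ^ 2) * 2 ^ n :=
        le_mul_of_one_le_right (by positivity) h1
      have h5 : L ^ 2 * 2 ^ n ≤ ((T : ℝ) + 1) * L ^ 2 * 2 ^ n := by
        have : L ^ 2 ≤ ((T : ℝ) + 1) * L ^ 2 := le_mul_of_one_le_left (by positivity) (by linarith)
        gcongr
      have h6 : 0 ≤ (2 : ℝ) ^ A.witnessLength := by positivity
      have h7 : 7 * (((T : ℝ) + 1) * L ^ 2) + L ^ 2 * 2 ^ n ≤ 8 * ((T : ℝ) + 1) * L ^ 2 * 2 ^ n := by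
        linarith
      have := mul_le_mul_of_nonneg_left h7 h6
      linarith)
  -- V was chosen against all witnesses at once, so it may be fixed before the witness that the
  -- verifier needs for it.
  obtain ⟨y, hy⟩ := hdec.1 V hVk
  have hs := hdec.2 y
  have hTy : (A.algorithm y).unitaries.length ≤ T :=
    (Finset.le_sup (f := fun y => (A.algorithm y).unitaries.length) (Finset.mem_univ y)).trans hT
  have hVc : V.card ≤ Vᶜ.card := by
    have := Finset.card_add_card_compl V
    rw [Fintype.card_fin] at this
    nlinarith
  have hmain := abs_acceptProb_sub_le (by omega) hVc (A.algorithm y) hTy (by positivity) hη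
    (fun p => hdiag (y, p)) (fun p => hvec (y, p))
  have hle := queryError_le w (k := V.card) (T := T) (by omega) (η := 4 * τ / √k) (by
    rw [hVk, div_le_div_iff₀ (by linarith) hsk]
    have h1 : √(k : ℝ) ≤ k := by
      rw [Real.sqrt_le_left (by linarith)]
      nlinarith
    nlinarith)
  have := (le_abs_self _).trans (hmain.trans hle)
  linarith

end Verifiers

/-! ### Polynomial against exponential growth -/

section Growth

/-- One additional power of n absorbs the implied constant. -/
lemma eventually_le_pow_of_isBigO {f : ℕ → ℕ} {d : ℕ}
    (h : (fun n => (f n : ℝ)) =O[atTop] fun n : ℕ => (n : ℝ) ^ d) :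
    ∀ᶠ n : ℕ in atTop, (f n : ℝ) ≤ (n : ℝ) ^ (d + 1) := by
  obtain ⟨C, hC⟩ := h.bound
  filter_upwards [hC, eventually_ge_atTop ⌈C⌉₊] with n hn hnC
  have h1 : C ≤ n := (Nat.le_ceil C).trans (by exact_mod_cast hnC)
  rw [Real.norm_of_nonneg (Nat.cast_nonneg _), Real.norm_of_nonneg (by positivity)] at hn
  calc (f n : ℝ) ≤ C * (n : ℝ) ^ d := hn
    _ ≤ n * (n : ℝ) ^ d := by gcongr
    _ = _ := by ring

/-- This is where a logarithmic workspace matters: 2^(C log n) is polynomial. The extra power of n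
absorbs the factor 2 from the sign. -/
lemma eventually_card_blockIdx_le {f : ℕ → ℕ}
    (h : (fun n => (f n : ℝ)) =O[atTop] fun n : ℕ => Real.log (n : ℝ)) :
    ∃ d : ℕ, ∀ᶠ n : ℕ in atTop, (Fintype.card (BlockIdx (f n)) : ℝ) ≤ (n : ℝ) ^ d := by
  obtain ⟨C, hC⟩ := h.bound
  refine ⟨⌈C⌉₊ + 1, ?_⟩
  filter_upwards [hC, eventually_ge_atTop 2] with n hn hn2
  have hn2' : (2 : ℝ) ≤ n := by exact_mod_cast hn2
  have hlog : 0 ≤ Real.log n := Real.log_nonneg (by linarith)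
  rw [Real.norm_of_nonneg (Nat.cast_nonneg _), Real.norm_of_nonneg hlog] at hn
  have h1 : (2 : ℝ) ^ f n ≤ (n : ℝ) ^ ⌈C⌉₊ := by
    have h2 : (2 : ℝ) ≤ Real.exp 1 := by linarith [Real.exp_one_gt_d9]
    calc (2 : ℝ) ^ f n ≤ Real.exp 1 ^ f n := by gcongr
      _ = Real.exp (f n) := by rw [← Real.exp_nat_mul, mul_one]
      _ ≤ Real.exp (⌈C⌉₊ * Real.log n) :=
        Real.exp_le_exp.mpr (hn.trans (mul_le_mul_of_nonneg_right (Nat.le_ceil C) hlog))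
      _ = _ := by rw [Real.exp_nat_mul, Real.exp_log (by linarith)]
  have h3 : (Fintype.card (BlockIdx (f n)) : ℝ) = 2 * 2 ^ f n := by simp
  rw [h3, pow_succ, mul_comm]
  gcongr

lemma eventually_const_mul_pow_lt_exp (c : ℝ) (d : ℕ) {δ : ℝ} (hδ : 0 < δ) :
    ∀ᶠ n : ℕ in atTop, c * (n : ℝ) ^ d < Real.exp (δ * n) := by
  have h := ((isLittleO_pow_exp_pos_mul_atTop d hδ).comp_tendsto
    tendsto_natCast_atTop_atTop).bound (show 0 < (|c| + 1)⁻¹ by positivity)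
  filter_upwards [h] with n hn
  simp only [Function.comp_apply] at hn
  rw [Real.norm_of_nonneg (by positivity), Real.norm_of_nonneg (Real.exp_pos _).le,
    inv_mul_eq_div, le_div_iff₀ (by positivity)] at hn
  rcases (show (0 : ℝ) ≤ (n : ℝ) ^ d by positivity).eq_or_lt with h0 | h0
  · rw [← h0, mul_zero]; exact Real.exp_pos _
  · refine lt_of_lt_of_le ?_ hn
    rw [mul_comm]
    have := le_abs_self c
    gcongr
    linarith

end Growth

/-! ### Choice of parameters and conclusion -/

/-- The verifier at a fixed size does not decide the hidden-subset problem once the size is large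
compared with the polynomial bounds; here `Y` stands for `2 ^ (α n / 4)`. -/
lemma Verifier.not_decides_of_bounds {n : ℕ} (A : Verifier n) {D k : ℕ} {Y c s : ℝ} (hn : 1 ≤ n)
    (hL : (Fintype.card (BlockIdx A.workspace) : ℝ) ≤ (n : ℝ) ^ D)
    (hm : (A.witnessLength : ℝ) ≤ (n : ℝ) ^ D) (hT : (A.queryCount : ℝ) + 1 ≤ (n : ℝ) ^ D)
    (hgap : 1 / (n : ℝ) ^ D ≤ c - s) (hk : |(k : ℝ) - Y ^ 4| < 1) (hY8 : 8 ≤ Y)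
    (hY1 : (n : ℝ) ^ D + n + 7 + 3 * D * n < Y) (hY2 : 464 * (n : ℝ) ^ (7 * D) < Y)
    (hYN : 8 * (Y ^ 4) ^ 2 ≤ 2 ^ n) : ¬ A.Decides k c s := by
  intro hdec
  have hnR : (1 : ℝ) ≤ n := by exact_mod_cast hn
  obtain ⟨hk1, hk2⟩ := abs_lt.mp hk
  have hY4 : 8 ≤ Y ^ 4 := hY8.trans (le_self_pow₀ (by linarith) (by norm_num))
  have hk4 : (4 : ℝ) ≤ k := by linarith
  have hkN : 2 * k ^ 2 ≤ 2 ^ n := by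
    have : (2 : ℝ) * k ^ 2 ≤ 2 ^ n := by
      have h2 : (k : ℝ) ≤ 2 * Y ^ 4 := by linarith
      calc (2 : ℝ) * k ^ 2 ≤ 2 * (2 * Y ^ 4) ^ 2 := by gcongr
        _ = 8 * (Y ^ 4) ^ 2 := by ring
        _ ≤ 2 ^ n := hYN
    exact_mod_cast this
  have hsk : Y ^ 2 / 2 ≤ √(k : ℝ) := by
    apply Real.le_sqrt_of_sq_le
    have : (Y ^ 2 / 2) ^ 2 = Y ^ 4 / 4 := by ring
    linarith
  -- The threshold is τ = Y. As k is within 1 of Y⁴, √k is at least Y²/2, and the correlation bound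
  -- is of order 1/Y.
  have hη : 4 * Y / √(k : ℝ) ≤ 8 / Y := by
    have h1 : 0 < Y ^ 2 / 2 := by positivity
    calc 4 * Y / √(k : ℝ) ≤ 4 * Y / (Y ^ 2 / 2) := by gcongr
      _ = 8 / Y := by field_simp; norm_num
  have hη1 : 4 * Y / √(k : ℝ) ≤ 1 := hη.trans ((div_le_one (by linarith)).mpr hY8)
  set L : ℝ := ((Fintype.card (BlockIdx A.workspace) : ℕ) : ℝ) with hLdef
  have hL0 : 0 ≤ L := Nat.cast_nonneg _
  have he : (2 : ℝ) ≤ Real.exp 1 := by linarith [Real.exp_one_gt_d9]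
  have hcard : (2 : ℝ) ^ A.witnessLength * (8 * ((A.queryCount : ℝ) + 1) * L ^ 2 * 2 ^ n) *
      (2 * Real.exp (4 - Y)) < 1 := by
    have h1 : (2 : ℝ) ^ A.witnessLength ≤ Real.exp ((n : ℝ) ^ D) := by
      calc (2 : ℝ) ^ A.witnessLength ≤ Real.exp 1 ^ A.witnessLength := by gcongr
        _ = Real.exp A.witnessLength := by rw [← Real.exp_nat_mul, mul_one]
        _ ≤ _ := Real.exp_le_exp.mpr hm
    have h2 : (2 : ℝ) ^ n ≤ Real.exp n := by
      calc (2 : ℝ) ^ n ≤ Real.exp 1 ^ n := by gcongr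
        _ = Real.exp n := by rw [← Real.exp_nat_mul, mul_one]
    have h3 : ((A.queryCount : ℝ) + 1) * L ^ 2 ≤ Real.exp (3 * D * n) := by
      calc ((A.queryCount : ℝ) + 1) * L ^ 2 ≤ (n : ℝ) ^ D * ((n : ℝ) ^ D) ^ 2 := by gcongr
        _ = (n : ℝ) ^ (3 * D) := by ring
        _ ≤ Real.exp n ^ (3 * D) := by
          gcongr
          linarith [Real.add_one_le_exp (n : ℝ)]
        _ = _ := by rw [← Real.exp_nat_mul]; push_cast; rfl
    -- The constant 16 = 8·2 of the union bound costs 3 in the exponent; with the 4 of exp (4 - Y)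
    -- this is the 7 in `hY1`.
    have h4 : (16 : ℝ) < Real.exp 3 := by
      have : Real.exp 3 = Real.exp 1 ^ 3 := by rw [← Real.exp_nat_mul]; norm_num
      rw [this]
      calc (16 : ℝ) < 2.7 ^ 3 := by norm_num
        _ ≤ Real.exp 1 ^ 3 := by gcongr; linarith [Real.exp_one_gt_d9]
    calc (2 : ℝ) ^ A.witnessLength * (8 * ((A.queryCount : ℝ) + 1) * L ^ 2 * 2 ^ n) *
          (2 * Real.exp (4 - Y))
        = 2 ^ A.witnessLength * (((A.queryCount : ℝ) + 1) * L ^ 2 * 2 ^ n) *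
          (16 * Real.exp (4 - Y)) := by ring
      _ ≤ Real.exp ((n : ℝ) ^ D) * (Real.exp (3 * D * n) * Real.exp n) *
          (Real.exp 3 * Real.exp (4 - Y)) := by gcongr
      _ = Real.exp ((n : ℝ) ^ D + (3 * D * n + n) + (3 + (4 - Y))) := by
        simp only [Real.exp_add]
      _ < 1 := by
        rw [Real.exp_lt_one_iff]
        linarith
  have hmain := A.gap_le_of_decides le_rfl (by exact_mod_cast hk4) hkN (by linarith : 1 ≤ Y) hη1
    hcard hdec
  have hnD : (0 : ℝ) < (n : ℝ) ^ D := by positivity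
  have hlt : 58 * (4 * Y / √(k : ℝ)) * L ^ 3 * ((A.queryCount : ℝ) + 1) ^ 3 <
      1 / (n : ℝ) ^ D := by
    -- Here 464 = 58·8; six powers of n^D come from the blocks and queries, the seventh from the gap
    -- 1/n^D.
    calc _ ≤ 58 * (8 / Y) * ((n : ℝ) ^ D) ^ 3 * ((n : ℝ) ^ D) ^ 3 := by gcongr
      _ = 464 * (n : ℝ) ^ (7 * D) / Y / (n : ℝ) ^ D := by
        field_simp
        ring
      _ < 1 / (n : ℝ) ^ D := by
        gcongr
        rwa [div_lt_one (by linarith)]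
  linarith

end HiddenSubset
end

theorem mainTheorem1 (α : ℝ) (hα₀ : 0 < α) (hα₁ : α < 1 / 2)
    (A : ∀ n : ℕ, HiddenSubset.Verifier n)
    (hworkspace : (fun n : ℕ => ((A n).workspace : ℝ)) =O[atTop] fun n : ℕ => Real.log (n : ℝ))
    (hwitness : ∃ d : ℕ,
      (fun n : ℕ => ((A n).witnessLength : ℝ)) =O[atTop] fun n : ℕ => (n : ℝ) ^ d)
    (hqueries : ∃ d : ℕ,
      (fun n : ℕ => ((A n).queryCount : ℝ)) =O[atTop] fun n : ℕ => (n : ℝ) ^ d)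
    (completeness soundness : ℕ → ℝ)
    (hgap : ∃ d : ℕ, ∀ᶠ n : ℕ in atTop, 1 / (n : ℝ) ^ d ≤ completeness n - soundness n) :
    ∀ᶠ n : ℕ in atTop, ∀ k : ℕ, |(k : ℝ) - ((2 : ℝ) ^ n) ^ α| < 1 →
      ¬ (A n).Decides k (completeness n) (soundness n) := by
  obtain ⟨d₁, h₁⟩ := HiddenSubset.eventually_card_blockIdx_le hworkspace
  obtain ⟨d₂, h₂⟩ := hwitness
  obtain ⟨d₃, h₃⟩ := hqueries
  obtain ⟨d₄, h₄⟩ := hgap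
  replace h₂ := HiddenSubset.eventually_le_pow_of_isBigO h₂
  replace h₃ := HiddenSubset.eventually_le_pow_of_isBigO h₃
  set D := d₁ + (d₂ + 1) + (d₃ + 2) + d₄ with hD
  have hlog2 : 0 < Real.log 2 := Real.log_pos (by norm_num)
  -- With this rate exp (δ n) = 2^(α n / 4), the fourth root of N^α.
  set δ := α * Real.log 2 / 4 with hδ
  have hδ0 : 0 < δ := by positivity
  -- Since N / (N^α)² = exp ((1 - 2α) n log 2), the assumption α < 1/2 makes this ratio eventually
  -- exceed 8, which yields 2k² ≤ N.
  have hε0 : 0 < (1 - 2 * α) * Real.log 2 := mul_pos (by linarith) hlog2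
  filter_upwards [h₁, h₂, h₃, h₄, eventually_ge_atTop 2,
    HiddenSubset.eventually_const_mul_pow_lt_exp 8 0 hδ0,
    HiddenSubset.eventually_const_mul_pow_lt_exp (9 + 3 * D) (D + 1) hδ0,
    HiddenSubset.eventually_const_mul_pow_lt_exp 464 (7 * D) hδ0,
    HiddenSubset.eventually_const_mul_pow_lt_exp 8 0 hε0] with n h₁ h₂ h₃ h₄ hn hY8 hY1 hY2 hYN k hk
  have hn2 : (2 : ℝ) ≤ n := by exact_mod_cast hn
  have hn1 : (1 : ℝ) ≤ n := by linarith
  have hX : ((2 : ℝ) ^ n) ^ α = Real.exp (δ * n) ^ 4 := by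
    rw [← Real.exp_nat_mul, ← Real.rpow_natCast, ← Real.rpow_mul (by norm_num),
      Real.rpow_def_of_pos (by norm_num)]
    congr 1
    rw [hδ]
    push_cast
    ring
  rw [hX] at hk
  have hT : ((A n).queryCount : ℝ) + 1 ≤ (n : ℝ) ^ (d₃ + 2) := by
    have h5 : (1 : ℝ) ≤ (n : ℝ) ^ (d₃ + 1) := one_le_pow₀ hn1
    have h6 : (n : ℝ) ^ (d₃ + 1) * 2 ≤ (n : ℝ) ^ (d₃ + 1) * n := by gcongr
    rw [pow_succ (n : ℝ) (d₃ + 1)]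
    linarith
  refine (A n).not_decides_of_bounds (D := D) (by omega)
    (h₁.trans (pow_le_pow_right₀ hn1 (by omega))) (h₂.trans (pow_le_pow_right₀ hn1 (by omega)))
    (hT.trans (pow_le_pow_right₀ hn1 (by omega))) (le_trans ?_ h₄) hk (by linarith) ?_ hY2 ?_
  · exact one_div_le_one_div_of_le (by positivity) (pow_le_pow_right₀ hn1 (by omega))
  · refine lt_of_le_of_lt ?_ hY1
    have h5 : (n : ℝ) ^ D ≤ (n : ℝ) ^ (D + 1) := pow_le_pow_right₀ hn1 (by omega)
    have h6 : (n : ℝ) ≤ (n : ℝ) ^ (D + 1) := le_self_pow₀ hn1 (by omega)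
    have h7 : (1 : ℝ) ≤ (n : ℝ) ^ (D + 1) := one_le_pow₀ hn1
    have h8 : 3 * (D : ℝ) * n ≤ 3 * (D : ℝ) * (n : ℝ) ^ (D + 1) := by gcongr
    linarith
  · rw [pow_zero, mul_one] at hYN
    have h5 : (2 : ℝ) ^ n = Real.exp ((1 - 2 * α) * Real.log 2 * n) *
        (Real.exp (δ * n) ^ 4) ^ 2 := by
      rw [← pow_mul, ← Real.exp_nat_mul, ← Real.exp_add, ← Real.rpow_natCast,
        Real.rpow_def_of_pos (by norm_num)]
      congr 1
      rw [hδ]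
      push_cast
      ring
    rw [h5]
    gcongr
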